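/- **Setting.** Consider a discounted Markov decision process with state space $\mathcal S$, action space $\mathcal A$, transition kernel $\mathcal P$, initial distribution $\rho$, discount factor $\gamma\in(0,1)$ and reward $r:\mathcal S\times\mathcal A\to[-r_{\max},r_{\max}]$, $r_{\max}>0$, and policies with densities $\pi_\theta(\cdot\mid s)$, $\theta\in\mathbb R^d$. Let $J(\theta)=\mathbb E\big[\sum_{t\ge 0}\gamma^t r(s_t,a_t)\big]$ with $s_0\sim\rho$, $a_t\sim\pi_\theta(\cdot\mid s_t)$, $s_{t+1}\sim\mathcal P(\cdot\mid s_t,a_t)$. For a trajectory $\tau=(s_0,a_0,\dots,s_{H-1},a_{H-1})$ sampled in this way let $$g_H(\tau,\theta)=\sum_{t=0}^{H-1}\Big(\sum_{h=t}^{H-1}\gamma^h r(s_h,a_h)\Big)\nabla\log\pi_\theta(a_t\mid s_t).$$ Assume that for all $s,a$ the map $\theta\mapsto\pi_\theta(a\mid s)$ is positive and twice continuously differentiable, that $\|\nabla\log\pi_\theta(a\mid s)\|\le M_g$ and $\|\nabla^2\log\pi_\theta(a\mid s)\|\le M_h$ for all $\theta$, and that $\theta\mapsto\nabla^2\log\pi_\theta(a\mid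 s)$ is $l_2$-Lipschitz, where $M_g,M_h,l_2>0$ (Euclidean and spectral norms). Put $$L_g=\frac{r_{\max}(M_g^2+M_h)}{(1-\gamma)^2},\quad \sigma^2=\frac{r_{\max}^2M_g^2}{(1-\gamma)^3},\quad D_g=\frac{M_gr_{\max}}{1-\gamma}\sqrt{\tfrac1{1-\gamma}+H},\quad D_h=\frac{(M_h+M_g^2)r_{\max}}{1-\gamma}\Big(\tfrac1{1-\gamma}+H\Big).$$ **Method (Rennala NIGT).** Given $\theta_0$, $\eta$, $\alpha$, $M_{\rm init}$, $M$, $H$: let $d_0=\mathrm{Agg}(\theta_0,M_{\rm init})$, $\theta_1=\theta_0+\alpha d_0/\|d_0\|$ and, for $t\ge1$, $$\tilde\theta_t=\theta_t+\tfrac{1-\eta}{\eta}(\theta_t-\theta_{t-1}),\quad g_t=\mathrm{Agg}(\tilde\theta_t,M),\quad d_t=(1-\eta)d_{t-1}+\eta g_t,\quad \theta_{t+1}=\theta_t+\alpha d_t/\|d_t\|$$ (with $0/\|0\|=0$). A call $\mathrm{Agg}(\theta,B)$ broadcasts $\theta$ to $n\ge 1$ agents; each agent repeatedly samples an independent trajectory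 $\tau$ from $\pi_\theta$ and computes $g_H(\tau,\theta)$; as soon as $B$ stochastic gradients in total have arrived, all computations are stopped and the average of these $B$ gradients is aggregated and returned. Agent $i$ needs at most $\dot h_i H$ seconds per stochastic gradient, where $0<\dot h_1\le\dots\le\dot h_n$, and each broadcast and each aggregation takes at most $\kappa\ge0$ seconds. The times are otherwise arbitrary; they may depend on the previous calls, but the order of arrival in a call does not depend on the trajectories sampled in it. **Theorem.** (i) $J$ is twice continuously differentiable and $\nabla^2J$ is Lipschitz with constant $$\frac{r_{\max}(l_2+3M_gM_h)}{(1-\gamma)^2}+\frac{4r_{\max}M_g^3(1+\gamma)}{(1-\gamma)^3}.$$ (ii) Let $L_h>0$ be any Lipschitz constant of $\nabla^2J$ (for instance the one in (i)), $\varepsilon>0$, and $\Delta>0$ with $\sup_\theta J(\theta)-J(\theta_0)\le\Delta$. Take $$M_{\rm init}=\max\Big\{\Big\lceil\frac{\sigma^2}{\varepsilon^2}\Big\rceil,1\Big\},\qquad M=\max\Big\{\Big\lceil\Big(\frac{\sigma^2}{\varepsilon^2}+\frac{\sigma^2\sqrt{L_h}\Delta}{\varepsilon^{7/2}}\Big)\Big/\Big(\frac{L_g\Delta}{\varepsilon^2}+\frac{\sqrt{L_h}\Delta}{\varepsilon^{3/2}}\Big)\Big\rceil,1\Big\},$$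 $$\eta=\min\Big\{\frac{M\varepsilon^2}{64\sigma^2},\frac12\Big\},\qquad \alpha=\min\Big\{\frac{\varepsilon}{8L_g},\frac{\eta\sqrt\varepsilon}{4\sqrt{L_h}}\Big\},$$ and let $H$ be an integer solution of $H=\max\big\{\big\lceil\log_\gamma\frac{\varepsilon\eta}{64\max\{D_g,\alpha D_h\}}\big\rceil,1\big\}$ ($D_g$ and $D_h$ depend on $H$); such a solution exists. Then there is $T\ge1$, depending only on the problem and the parameters above and not on $n$, $(\dot h_i)$, $\kappa$ or the execution, such that a uniformly sampled iterate $\bar\theta_T$ from $\{\theta_0,\dots,\theta_{T-1}\}$ satisfies $\mathbb E\|\nabla J(\bar\theta_T)\|\le\varepsilon$, and $\theta_0,\dots,\theta_{T-1}$ have been computed after at most $$C\,\log\!\Big(e+\frac{\sigma^2}{\varepsilon^2}\Big)\left(\kappa\Big(\frac{L_g\Delta}{\varepsilon^2}+\frac{\sqrt{L_h}\Delta}{\varepsilon^{3/2}}\Big)+\frac1{1-\gamma}\min_{m\in[n]}\left[\Big(\frac1m\sum_{i=1}^m\frac1{\dot h_i}\Big)^{-1}\Big(\frac{L_g\Delta}{\varepsilon^2}+\frac{\sqrt{L_h}\Delta}{\varepsilon^{3/2}}+\frac{\sigma^2}{m\varepsilon^2}+\frac{\sigma^2\sqrt{L_h}\Delta}{m\varepsilon^{7/2}}\Big)\right]\right)$$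 seconds, where $C$ is a universal constant. -/

import Mathlib

open MeasureTheory ProbabilityTheory

namespace RennalaNIGT

/-- The parameter space `ℝ^d` with its Euclidean norm. -/
abbrev Param (d : ℕ) : Type := EuclideanSpace ℝ (Fin d)

/-! ### The discounted Markov decision process and its parameterized policy -/

/-- A discounted Markov decision process `(S, A, P, r, ρ, γ)` with rewards in `[-rmax, rmax]`. -/
structure MDP (S A : Type*) [MeasurableSpace S] [MeasurableSpace A] where
  /-- initial state distribution -/
  ρ : Measure S
  /-- transition kernel -/
  P : Kernel (S × A) S
  /-- reward function -/
  r : S → A → ℝ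
  /-- bound on the reward -/
  rmax : ℝ
  /-- discount factor -/
  γ : ℝ
  isProbabilityMeasure_ρ : IsProbabilityMeasure ρ
  isMarkovKernel_P : IsMarkovKernel P
  measurable_r : Measurable (Function.uncurry r)
  rmax_pos : 0 < rmax
  abs_r_le : ∀ s a, |r s a| ≤ rmax
  γ_pos : 0 < γ
  γ_lt_one : γ < 1

/-- A policy with parameter `θ ∈ ℝ^d`: for every `θ` and every state `s`, a probability density
`dens θ s a = π_θ(a | s)` with respect to a fixed reference measure `ν` on the actions (for
instance counting or Lebesgue measure). -/
structure Policy (S A : Type*) [MeasurableSpace S] [MeasurableSpace A] (d : ℕ) where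
  ν : Measure A
  dens : Param d → S → A → ℝ
  sigmaFinite_ν : SigmaFinite ν
  measurable_dens : ∀ θ, Measurable (Function.uncurry (dens θ))
  dens_nonneg : ∀ θ s a, 0 ≤ dens θ s a
  lintegral_dens : ∀ θ s, ∫⁻ a, ENNReal.ofReal (dens θ s a) ∂ν = 1

attribute [instance] MDP.isProbabilityMeasure_ρ MDP.isMarkovKernel_P Policy.sigmaFinite_ν

section

variable {S A : Type*} [MeasurableSpace S] [MeasurableSpace A] {d : ℕ}

/-- The Markov kernel `s ↦ π_θ(· | s)` from states to actions. -/
noncomputable def Policy.kernel (pol : Policy S A d) (θ : Param d) : Kernel S A :=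
  Kernel.withDensity (Kernel.const S pol.ν) (fun s a => ENNReal.ofReal (pol.dens θ s a))

instance (pol : Policy S A d) (θ : Param d) : IsMarkovKernel (pol.kernel θ) := by
  have hm : Measurable (Function.uncurry fun s a => ENNReal.ofReal (pol.dens θ s a)) :=
    (pol.measurable_dens θ).ennreal_ofReal
  refine ⟨fun s => ⟨?_⟩⟩
  rw [Policy.kernel, Kernel.withDensity_apply' _ hm]
  simpa using pol.lintegral_dens θ s

/-- One step of the chain of state-action pairs: from `(s_t, a_t)`, the next state
`s_{t+1} ∼ P(· | s_t, a_t)` and then the next action `a_{t+1} ∼ π_θ(· | s_{t+1})`. -/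
noncomputable def stepKernel (mdp : MDP S A) (pol : Policy S A d) (θ : Param d) :
    Kernel (S × A) (S × A) :=
  mdp.P ⊗ₖ Kernel.prodMkLeft (S × A) (pol.kernel θ)

instance (mdp : MDP S A) (pol : Policy S A d) (θ : Param d) :
    IsMarkovKernel (stepKernel mdp pol θ) := by
  unfold stepKernel; infer_instance

/-- The law of the infinite trajectory `(s_t, a_t)_{t ≥ 0}` under `π_θ`: `s_0 ∼ ρ`,
`a_t ∼ π_θ(· | s_t)`, `s_{t+1} ∼ P(· | s_t, a_t)`. -/
noncomputable def trajLaw (mdp : MDP S A) (pol : Policy S A d) (θ : Param d) :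
    Measure (ℕ → S × A) :=
  Kernel.trajMeasure (X := fun _ => S × A) (mdp.ρ ⊗ₘ pol.kernel θ)
    (fun t => (stepKernel mdp pol θ).comap
      (fun x : (i : Finset.Iic t) → S × A => x ⟨t, Finset.mem_Iic.2 le_rfl⟩)
      (measurable_pi_apply _))

/-- The law `p(· | π_θ)` of the trajectory `(s_0, a_0, …, s_{H-1}, a_{H-1})` of length `H`. -/
noncomputable def finTrajLaw (mdp : MDP S A) (pol : Policy S A d) (θ : Param d) (H : ℕ) :
    Measure (Fin H → S × A) :=
  (trajLaw mdp pol θ).map (fun x t => x t)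

/-- The expected discounted return `J(θ)`. -/
noncomputable def J (mdp : MDP S A) (pol : Policy S A d) (θ : Param d) : ℝ :=
  ∫ x, ∑' t : ℕ, mdp.γ ^ t * mdp.r (x t).1 (x t).2 ∂(trajLaw mdp pol θ)

/-- The truncated stochastic policy gradient `g_H(τ, θ)`. -/
noncomputable def stochGrad (mdp : MDP S A) (pol : Policy S A d) (H : ℕ)
    (τ : Fin H → S × A) (θ : Param d) : Param d :=
  ∑ t : Fin H, (∑ h ∈ Finset.Ici t, mdp.γ ^ (h : ℕ) * mdp.r (τ h).1 (τ h).2) •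
    gradient (fun θ' => Real.log (pol.dens θ' (τ t).1 (τ t).2)) θ

/-! ### Assumptions on the policy -/

/-- `π_θ(a | s)` is positive and twice continuously differentiable in `θ`, with
`‖∇ log π_θ(a | s)‖ ≤ Mg` and `‖∇² log π_θ(a | s)‖ ≤ Mh` (spectral norm), where `Mg, Mh > 0`. -/
structure BoundedScore (pol : Policy S A d) (Mg Mh : ℝ) : Prop where
  Mg_pos : 0 < Mg
  Mh_pos : 0 < Mh
  dens_pos : ∀ θ s a, 0 < pol.dens θ s a
  contDiff : ∀ s a, ContDiff ℝ 2 (fun θ => pol.dens θ s a)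
  norm_grad_le : ∀ s a θ, ‖fderiv ℝ (fun θ' => Real.log (pol.dens θ' s a)) θ‖ ≤ Mg
  norm_hess_le : ∀ s a θ,
    ‖fderiv ℝ (fderiv ℝ (fun θ' => Real.log (pol.dens θ' s a))) θ‖ ≤ Mh

/-- `π_θ(a | s)` is positive and twice continuously differentiable in `θ`, and
`∇² log π_θ(a | s)` is `l₂`-Lipschitz in `θ` (spectral norm), where `l₂ > 0`. -/
structure LipschitzScoreHessian (pol : Policy S A d) (l₂ : ℝ) : Prop where
  l₂_pos : 0 < l₂
  dens_pos : ∀ θ s a, 0 < pol.dens θ s a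
  contDiff : ∀ s a, ContDiff ℝ 2 (fun θ => pol.dens θ s a)
  lipschitz : ∀ s a θ θ',
    ‖fderiv ℝ (fderiv ℝ (fun ϑ => Real.log (pol.dens ϑ s a))) θ
      - fderiv ℝ (fderiv ℝ (fun ϑ => Real.log (pol.dens ϑ s a))) θ'‖ ≤ l₂ * ‖θ - θ'‖

/-- `f` is twice continuously differentiable and its Hessian is `L`-Lipschitz (spectral norm). -/
def HessianLipschitz (f : Param d → ℝ) (L : ℝ) : Prop :=
  ContDiff ℝ 2 f ∧
    ∀ θ θ', ‖fderiv ℝ (fderiv ℝ f) θ - fderiv ℝ (fderiv ℝ f) θ'‖ ≤ L * ‖θ - θ'‖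

/-! ### The constants of the problem -/

/-- `L_g`, the smoothness constant of `J`. -/
noncomputable def Lg (mdp : MDP S A) (Mg Mh : ℝ) : ℝ :=
  mdp.rmax * (Mg ^ 2 + Mh) / (1 - mdp.γ) ^ 2

/-- An explicit Lipschitz constant for the Hessian of `J`. -/
noncomputable def hessConst (mdp : MDP S A) (Mg Mh l₂ : ℝ) : ℝ :=
  mdp.rmax * (l₂ + 3 * Mg * Mh) / (1 - mdp.γ) ^ 2
    + 4 * mdp.rmax * Mg ^ 3 * (1 + mdp.γ) / (1 - mdp.γ) ^ 3

/-- `σ²`, the variance bound of the stochastic gradient. -/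
noncomputable def sigmaSq (mdp : MDP S A) (Mg : ℝ) : ℝ :=
  mdp.rmax ^ 2 * Mg ^ 2 / (1 - mdp.γ) ^ 3

/-- `D_g`, as a function of the horizon `H`. -/
noncomputable def Dg (mdp : MDP S A) (Mg : ℝ) (H : ℕ) : ℝ :=
  Mg * mdp.rmax / (1 - mdp.γ) * √(1 / (1 - mdp.γ) + H)

/-- `D_h`, as a function of the horizon `H`. -/
noncomputable def Dh (mdp : MDP S A) (Mg Mh : ℝ) (H : ℕ) : ℝ :=
  (Mh + Mg ^ 2) * mdp.rmax / (1 - mdp.γ) * (1 / (1 - mdp.γ) + H)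

/-- `H` is an integer solution of
`H = max {⌈log_γ (ε η / (64 max {D_g, α D_h}))⌉, 1}`, where `D_g` and `D_h` depend on `H`. -/
def IsHorizon (mdp : MDP S A) (Mg Mh ε η α : ℝ) (H : ℕ) : Prop :=
  H = max ⌈Real.logb mdp.γ (ε * η / (64 * max (Dg mdp Mg H) (α * Dh mdp Mg Mh H)))⌉₊ 1

end

/-! ### The parameters of the method -/

/-- `L_g Δ / ε² + √L_h Δ / ε^{3/2}`. -/
noncomputable def iterRate (Lg Lh Δ ε : ℝ) : ℝ :=
  Lg * Δ / ε ^ 2 + √Lh * Δ / ε ^ (3 / 2 : ℝ)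

/-- `σ² / ε² + σ² √L_h Δ / ε^{7/2}`. -/
noncomputable def noiseRate (σsq Lh Δ ε : ℝ) : ℝ :=
  σsq / ε ^ 2 + σsq * √Lh * Δ / ε ^ (7 / 2 : ℝ)

/-- The initial batch size `M_init`. -/
noncomputable def initBatch (σsq ε : ℝ) : ℕ := max ⌈σsq / ε ^ 2⌉₊ 1

/-- The batch size `M`. -/
noncomputable def batch (σsq Lg Lh Δ ε : ℝ) : ℕ :=
  max ⌈noiseRate σsq Lh Δ ε / iterRate Lg Lh Δ ε⌉₊ 1

/-- The momentum `η`. -/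
noncomputable def momentum (σsq ε : ℝ) (M : ℕ) : ℝ := min (M * ε ^ 2 / (64 * σsq)) (1 / 2)

/-- The step size `α`. -/
noncomputable def stepSize (Lg Lh ε η : ℝ) : ℝ := min (ε / (8 * Lg)) (η * √ε / (4 * √Lh))

/-! ### Asynchronous collection of a batch -/

/-- The number of stochastic gradients that agent `i` has delivered before the `j`-th arrival
(counted from `0`), when the `l`-th arrival comes from agent `order l`. -/
def delivered {n : ℕ} (order : ℕ → Fin n) (j : ℕ) (i : Fin n) : ℕ :=
  ((Finset.range j).filter (fun l => order l = i)).card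

/-- The time at which agent `i` finishes its `k`-th stochastic gradient (counted from `0`), if it
receives the point at time `bcast i` and computes without pause, its `l`-th gradient taking
`dur i l` seconds. Time is measured from the start of the aggregation call. -/
noncomputable def finishTime {n : ℕ} (bcast : Fin n → ℝ) (dur : Fin n → ℕ → ℝ)
    (i : Fin n) (k : ℕ) : ℝ :=
  bcast i + ∑ l ∈ Finset.range (k + 1), dur i l

/-- `order` lists the agents in the order in which their gradients arrive: whenever the method
waits for a gradient, the next one comes from an agent whose current computation finishes first
(ties are broken arbitrarily). -/
def IsArrivalOrder {n : ℕ} (bcast : Fin n → ℝ) (dur : Fin n → ℕ → ℝ) (order : ℕ → Fin n) : Prop :=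
  ∀ j i, finishTime bcast dur (order j) (delivered order j (order j))
    ≤ finishTime bcast dur i (delivered order j i)

/-- The time of the `j`-th arrival (counted from `0`). -/
noncomputable def arrivalTime {n : ℕ} (bcast : Fin n → ℝ) (dur : Fin n → ℕ → ℝ)
    (order : ℕ → Fin n) (j : ℕ) : ℝ :=
  finishTime bcast dur (order j) (delivered order j (order j))

/-- The average of the first `M` arriving stochastic gradients, where `grad i k` is the `k`-th
gradient computed by agent `i`. -/
noncomputable def aggregate {n d : ℕ} (M : ℕ) (order : ℕ → Fin n)
    (grad : Fin n → ℕ → Param d) : Param d :=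
  ∑ j ∈ Finset.range M, (1 / M : ℝ) • grad (order j) (delivered order j (order j))

/-! ### The method -/

/-- An execution of the method on a probability space `(Ω, μ)` with `n` agents, from `θ₀`, with
momentum `η`, step size `α`, batch sizes `Minit`, `M` and horizon `H`, under the time model in
which agent `i` needs at most `hdot i * H` seconds per stochastic gradient and transmitting a
vector takes at most `κ` seconds.

Aggregation call number `t` is made at the point `query t`; call `0` (at `θ₀`) collects `Minit`
gradients and the others collect `M`. In each call every agent starts afresh. The times may be
random and may depend on everything that happened in the previous calls, but the order of arrival
in a call does not depend on the trajectories sampled in that call. -/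
structure Execution {S A Ω : Type*} [MeasurableSpace S] [MeasurableSpace A]
    [mΩ : MeasurableSpace Ω] (μ : Measure Ω) {d : ℕ} (mdp : MDP S A) (pol : Policy S A d)
    {n : ℕ} (hdot : Fin n → ℝ) (κ : ℝ) (θ₀ : Param d) (η α : ℝ) (Minit M H : ℕ) where
  /-- `ℱ t` is the information available when call `t` starts -/
  ℱ : Filtration ℕ mΩ
  /-- `traj t i k` is the `k`-th trajectory sampled by agent `i` in call `t` -/
  traj : ℕ → Fin n → ℕ → Ω → (Fin H → S × A)
  /-- `bcast t i` is the time after which agent `i` has received the point of call `t` -/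
  bcast : ℕ → Fin n → Ω → ℝ
  /-- `dur t i k` is the time agent `i` needs for its `k`-th stochastic gradient in call `t` -/
  dur : ℕ → Fin n → ℕ → Ω → ℝ
  /-- `aggr t` is the duration of the final aggregation of call `t` -/
  aggr : ℕ → Ω → ℝ
  /-- `order t j` is the agent whose gradient is the `j`-th to arrive in call `t` -/
  order : ℕ → ℕ → Ω → Fin n
  /-- the iterates `θ_t` -/
  θ : ℕ → Ω → Param d
  /-- the points at which the stochastic gradients are computed: `θ₀`, and then `θ̃_t` -/
  query : ℕ → Ω → Param d
  /-- the aggregated gradients: `d_0`, and then `g_t` -/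
  g : ℕ → Ω → Param d
  /-- the search directions `d_t` -/
  dir : ℕ → Ω → Param d
  -- the time model
  bcast_mem : ∀ t i ω, bcast t i ω ∈ Set.Icc 0 κ
  dur_mem : ∀ t i k ω, dur t i k ω ∈ Set.Icc 0 (hdot i * H)
  aggr_mem : ∀ t ω, aggr t ω ∈ Set.Icc 0 κ
  isArrivalOrder : ∀ t ω, IsArrivalOrder (fun i => bcast t i ω) (fun i k => dur t i k ω)
    (fun j => order t j ω)
  -- given `ℱ t`, the trajectories of call `t` are i.i.d. with law `p(· | π_θ)` at `θ = query t`
  measurable_order : ∀ t j, Measurable[ℱ t] (order t j)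
  measurable_traj : ∀ t i k, Measurable[ℱ (t + 1)] (traj t i k)
  condLaw_traj : ∀ (t : ℕ) (I : Finset (Fin n × ℕ)) (B : Fin n × ℕ → Set (Fin H → S × A)),
    (∀ p, MeasurableSet (B p)) →
    μ[(⋂ p ∈ I, traj t p.1 p.2 ⁻¹' B p).indicator (fun _ => (1 : ℝ)) | ℱ t]
      =ᵐ[μ] fun ω => ∏ p ∈ I, (finTrajLaw mdp pol (query t ω) H).real (B p)
  -- the updates
  g_eq : ∀ t ω, g t ω = aggregate (if t = 0 then Minit else M) (fun j => order t j ω)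
    (fun i k => stochGrad mdp pol H (traj t i k ω) (query t ω))
  θ_zero : ∀ ω, θ 0 ω = θ₀
  query_zero : ∀ ω, query 0 ω = θ₀
  dir_zero : ∀ ω, dir 0 ω = g 0 ω
  θ_succ : ∀ t ω, θ (t + 1) ω = θ t ω + α • (‖dir t ω‖⁻¹ • dir t ω)
  query_succ : ∀ t ω,
    query (t + 1) ω = θ (t + 1) ω + ((1 - η) / η) • (θ (t + 1) ω - θ t ω)
  dir_succ : ∀ t ω, dir (t + 1) ω = (1 - η) • dir t ω + η • g (t + 1) ω

namespace Execution

variable {S A Ω : Type*} [MeasurableSpace S] [MeasurableSpace A] [MeasurableSpace Ω]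
  {μ : Measure Ω} {d : ℕ} {mdp : MDP S A} {pol : Policy S A d} {n : ℕ} {hdot : Fin n → ℝ} {κ : ℝ}
  {θ₀ : Param d} {η α : ℝ} {Minit M H : ℕ}

/-- The duration of aggregation call `t`: the call ends when the last gradient of the batch has
arrived and the aggregated vector has been communicated. -/
noncomputable def callTime (X : Execution μ mdp pol hdot κ θ₀ η α Minit M H) (t : ℕ) (ω : Ω) : ℝ :=
  arrivalTime (fun i => X.bcast t i ω) (fun i k => X.dur t i k ω) (fun j => X.order t j ω)
    ((if t = 0 then Minit else M) - 1) + X.aggr t ω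

/-- The time at which the iterate `θ_t` is available. -/
noncomputable def clock (X : Execution μ mdp pol hdot κ θ₀ η α Minit M H) (t : ℕ) (ω : Ω) : ℝ :=
  ∑ s ∈ Finset.range t, X.callTime s ω

/-- `𝔼 ‖∇J(θ̄_T)‖`, where `θ̄_T` is sampled uniformly from `{θ_0, …, θ_{T-1}}`. -/
noncomputable def expGradNorm (X : Execution μ mdp pol hdot κ θ₀ η α Minit M H) (T : ℕ) : ℝ :=
  (1 / T : ℝ) * ∑ t ∈ Finset.range T, ∫ ω, ‖gradient (J mdp pol) (X.θ t ω)‖ ∂μ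

end Execution

/-- `(1/m ∑_{i ≤ m} 1/ḣ_i)⁻¹`, the harmonic mean of the first `m` entries of `hdot`; the index
`m : Fin n` counts from `0`, so that it stands for `m + 1` agents. -/
noncomputable def harmonicMean {n : ℕ} (hdot : Fin n → ℝ) (m : Fin n) : ℝ :=
  ((1 / ((m : ℝ) + 1)) * ∑ i ∈ Finset.Iic m, 1 / hdot i)⁻¹

/-- The time complexity, up to a constant and logarithmic factors:
`κ (L_g Δ/ε² + √L_h Δ/ε^{3/2}) + 1/(1-γ) min_m [(1/m ∑_{i≤m} 1/ḣ_i)⁻¹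
(L_g Δ/ε² + √L_h Δ/ε^{3/2} + σ²/(m ε²) + σ² √L_h Δ/(m ε^{7/2}))]`. -/
noncomputable def timeComplexity {n : ℕ} (hdot : Fin n → ℝ) (κ γ σsq Lg Lh Δ ε : ℝ) : ℝ :=
  κ * (Lg * Δ / ε ^ 2 + √Lh * Δ / ε ^ (3 / 2 : ℝ))
    + 1 / (1 - γ) * ⨅ m : Fin n, harmonicMean hdot m *
        (Lg * Δ / ε ^ 2 + √Lh * Δ / ε ^ (3 / 2 : ℝ)
          + σsq / (((m : ℝ) + 1) * ε ^ 2)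
          + σsq * √Lh * Δ / (((m : ℝ) + 1) * ε ^ (7 / 2 : ℝ)))

end RennalaNIGT

/-! Smoothness of `J` rests on likelihood ratios. The initial law and the transitions do not involve
the parameter, so on the first `N` state-action pairs the trajectory laws of two parameters differ
by the exponential of a difference of sums of log-policies (`lintegral_trajLaw_changeOfMeasure`).
Expectations of bounded functions of these pairs can therefore be differentiated under a fixed law,
and every derivative brings down scores, the derivatives of the log-likelihood. A function of the
first `k` pairs has the same expectation whether the likelihood has `k` or `k + 1` factors.
Comparing derivatives of the two expressions shows that the scores, and likewise the quantities `∂∂π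
/ π`, are martingale differences (`martingaleDiff_score`, `martingaleDiff_secondScore`). By
orthogonality a sum of `N` of them has size `√N` only. For the expected reward at time `t` this
bounds the gradient, the Hessian and the Lipschitz constant of the Hessian by multiples of `√(t+1)`,
of `t+1`, and of `t+1` plus `(t+1)²`; discounted summation gives `Lg` and `hessConst`. Since `∇² log
π` is merely Lipschitz, the Hessian of `J` need not be differentiable; `abs_sub_le_of_local`
replaces the missing third derivative by the derivative of a part with frozen Hessian plus a
Lipschitz error.

For the method, the arrival order of a call is known when the call starts, so the gradients of a
batch are conditionally i.i.d. and their average has variance at most `σ²` over the batch size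
(`integral_norm_noise_sq_le`). The error of `d_t` splits into an exponential average of this noise
and a rest bounded surely: extrapolation to `θ̃_t` cancels the first order drift of the gradient,
which leaves the truncation bias plus `L_h α² / η²` (`norm_dir_sub_le`). A normalized step along an
approximate gradient gains `α (‖∇J‖ - 2 · error)` up to `L_g α²`; telescoping yields
`expGradNorm_le`.

The time bound has three ingredients. With `R` for `iterRate`, `O(R)` iterations suffice once `R` is
bounded below, because `M` is about `noiseRate / R` (`iterations_le`). The horizon is at most a
logarithm over `1 - γ`, as its fixed-point equation depends on `H` only logarithmically
(`horizon_le`). Finally, at the end of a call no agent has been idle, so counting the gradients of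
any first `m` agents bounds its duration by their harmonic mean (`arrivalTime_le`). If `L_g Δ / ε² ≤
1/4`, then `θ₀` is already good enough and no call is made; otherwise `R ≥ 1/4`, which absorbs all
roundings. -/

namespace RennalaNIGT

/-! ### Measurability of derivatives with respect to a parameter -/

open Filter Topology in
/-- Directional derivatives of a parametrized measurable function are measurable. -/
lemma measurable_fderiv_apply {Ω E : Type*} {m : MeasurableSpace Ω} [NormedAddCommGroup E]
    [NormedSpace ℝ E] {f : E → Ω → ℝ} (hm : ∀ θ, Measurable[m] (f θ))
    (hd : ∀ ω, Differentiable ℝ (fun θ => f θ ω)) (θ u : E) :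
    Measurable[m] (fun ω => fderiv ℝ (fun θ' => f θ' ω) θ u) := by
  have hlim : ∀ ω, Tendsto (fun n : ℕ =>
      (1 / ((n : ℝ) + 1))⁻¹ * (f (θ + (1 / ((n : ℝ) + 1)) • u) ω - f θ ω)) atTop
      (𝓝 (fderiv ℝ (fun θ' => f θ' ω) θ u)) := by
    intro ω
    have h1 : HasDerivAt (fun s : ℝ => f (θ + s • u) ω) (fderiv ℝ (fun θ' => f θ' ω) θ u) 0 := by
      have h2 : HasFDerivAt (fun θ' => f θ' ω) (fderiv ℝ (fun θ' => f θ' ω) θ) (θ + (0 : ℝ) • u) := by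
        simpa using (hd ω θ).hasFDerivAt
      have h3 : HasDerivAt (fun s : ℝ => θ + s • u) u 0 := by
        simpa using ((hasDerivAt_id (0 : ℝ)).smul_const u).const_add θ
      exact h2.comp_hasDerivAt (0 : ℝ) h3
    rw [hasDerivAt_iff_tendsto_slope_zero] at h1
    have h4 : Tendsto (fun n : ℕ => 1 / ((n : ℝ) + 1)) atTop (𝓝[≠] 0) :=
      tendsto_nhdsWithin_iff.2 ⟨tendsto_one_div_add_atTop_nhds_zero_nat,
        Eventually.of_forall fun n => by
          have : (0 : ℝ) < 1 / ((n : ℝ) + 1) := by positivity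
          exact this.ne'⟩
    simpa [Function.comp_def] using h1.comp h4
  exact measurable_of_tendsto_metrizable (fun n => ((hm _).sub (hm _)).const_mul _)
    (tendsto_pi_nhds.2 hlim)

/-- In finite dimension a linear form is a finite combination of coordinate forms whose coefficients
are its values on a basis. -/
lemma stronglyMeasurable_clm {Ω E : Type*} {m : MeasurableSpace Ω} [NormedAddCommGroup E]
    [NormedSpace ℝ E] [FiniteDimensional ℝ E] {φ : Ω → E →L[ℝ] ℝ}
    (h : ∀ u, Measurable[m] (fun ω => φ ω u)) : StronglyMeasurable[m] φ := by
  let b := Module.finBasis ℝ E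
  have : φ = fun ω => ∑ i, φ ω (b i) • LinearMap.toContinuousLinearMap (b.coord i) := by
    ext ω u
    conv_lhs => rw [← b.sum_repr u]
    rw [map_sum, sum_apply]
    exact Finset.sum_congr rfl fun i _ => by simp [mul_comm]
  rw [this]
  refine Finset.stronglyMeasurable_fun_sum _ fun i _ => ?_
  exact (h _).stronglyMeasurable.smul_const _

/-! ### Parametrized families with two bounded derivatives -/

section Family

variable {Ω E : Type*} [NormedAddCommGroup E] [NormedSpace ℝ E]

/-- A family of functions on `Ω`, measurable with respect to `m`, which is twice continuously
differentiable in the parameter with bounded derivatives. -/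
structure SmoothFamily (m : MeasurableSpace Ω) (ℓ : E → Ω → ℝ) (c₁ c₂ : ℝ) : Prop where
  contDiff : ∀ ω, ContDiff ℝ 2 (fun θ => ℓ θ ω)
  measurable : ∀ θ, Measurable[m] (ℓ θ)
  c₁_nonneg : 0 ≤ c₁
  c₂_nonneg : 0 ≤ c₂
  norm_fderiv_le : ∀ ω θ, ‖fderiv ℝ (fun θ' => ℓ θ' ω) θ‖ ≤ c₁
  norm_fderiv₂_le : ∀ ω θ, ‖fderiv ℝ (fderiv ℝ (fun θ' => ℓ θ' ω)) θ‖ ≤ c₂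

/-- The first derivative of a family in its parameter. -/
noncomputable def score (ℓ : E → Ω → ℝ) (θ : E) (ω : Ω) : E →L[ℝ] ℝ :=
  fderiv ℝ (fun θ' => ℓ θ' ω) θ

/-- The second derivative of a family in its parameter. -/
noncomputable def hess (ℓ : E → Ω → ℝ) (θ : E) (ω : Ω) : E →L[ℝ] E →L[ℝ] ℝ :=
  fderiv ℝ (fderiv ℝ (fun θ' => ℓ θ' ω)) θ

namespace SmoothFamily

variable {m : MeasurableSpace Ω} {ℓ : E → Ω → ℝ} {c₁ c₂ : ℝ}

lemma hasFDerivAt (h : SmoothFamily m ℓ c₁ c₂) (θ : E) (ω : Ω) :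
    HasFDerivAt (fun θ' => ℓ θ' ω) (score ℓ θ ω) θ :=
  ((h.contDiff ω).differentiable (by norm_num) θ).hasFDerivAt

lemma hasFDerivAt_score (h : SmoothFamily m ℓ c₁ c₂) (θ : E) (ω : Ω) :
    HasFDerivAt (fun θ' => score ℓ θ' ω) (hess ℓ θ ω) θ :=
  (((h.contDiff ω).fderiv_right (m := 1) (by norm_num)).differentiable
    (by norm_num) θ).hasFDerivAt

lemma hasFDerivAt_score_apply (h : SmoothFamily m ℓ c₁ c₂) (θ u : E) (ω : Ω) :
    HasFDerivAt (fun θ' => score ℓ θ' ω u) ((hess ℓ θ ω).flip u) θ := by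
  have := (h.hasFDerivAt_score θ ω).clm_apply (hasFDerivAt_const u θ)
  refine this.congr_fderiv ?_
  ext v; simp

lemma abs_score_le (h : SmoothFamily m ℓ c₁ c₂) (θ u : E) (ω : Ω) :
    |score ℓ θ ω u| ≤ c₁ * ‖u‖ :=
  ((score ℓ θ ω).le_opNorm u).trans
    (mul_le_mul_of_nonneg_right (h.norm_fderiv_le ω θ) (norm_nonneg u))

lemma norm_score_le (h : SmoothFamily m ℓ c₁ c₂) (θ : E) (ω : Ω) : ‖score ℓ θ ω‖ ≤ c₁ :=
  h.norm_fderiv_le ω θ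

lemma norm_hess_le (h : SmoothFamily m ℓ c₁ c₂) (θ : E) (ω : Ω) : ‖hess ℓ θ ω‖ ≤ c₂ :=
  h.norm_fderiv₂_le ω θ

lemma abs_hess_le (h : SmoothFamily m ℓ c₁ c₂) (θ u v : E) (ω : Ω) :
    |hess ℓ θ ω u v| ≤ c₂ * ‖u‖ * ‖v‖ := by
  refine ((hess ℓ θ ω).le_opNorm₂ u v).trans ?_
  gcongr
  exact h.norm_hess_le θ ω

lemma measurable_score (h : SmoothFamily m ℓ c₁ c₂) (θ u : E) :
    Measurable[m] (fun ω => score ℓ θ ω u) :=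
  measurable_fderiv_apply h.measurable (fun ω => (h.contDiff ω).differentiable (by norm_num)) θ u

lemma measurable_hess (h : SmoothFamily m ℓ c₁ c₂) (θ u v : E) :
    Measurable[m] (fun ω => hess ℓ θ ω u v) := by
  have := measurable_fderiv_apply (f := fun θ ω => score ℓ θ ω v)
    (fun θ => h.measurable_score θ v)
    (fun ω θ => (h.hasFDerivAt_score_apply θ v ω).differentiableAt) θ u
  have e : (fun ω => hess ℓ θ ω u v) = fun ω => fderiv ℝ (fun θ' => score ℓ θ' ω v) θ u := by
    ext ω
    rw [(h.hasFDerivAt_score_apply θ v ω).fderiv]; rfl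
  rwa [e]

lemma abs_sub_le (h : SmoothFamily m ℓ c₁ c₂) (θ θ' : E) (ω : Ω) :
    |ℓ θ' ω - ℓ θ ω| ≤ c₁ * ‖θ' - θ‖ := by
  have := Convex.norm_image_sub_le_of_norm_hasFDerivWithin_le (𝕜 := ℝ)
    (f := fun θ' => ℓ θ' ω) (s := Set.univ)
    (fun x _ => (h.hasFDerivAt x ω).hasFDerivWithinAt) (fun x _ => h.norm_score_le x ω)
    convex_univ (Set.mem_univ θ) (Set.mem_univ θ')
  simpa using this

lemma mono (h : SmoothFamily m ℓ c₁ c₂) {m' : MeasurableSpace Ω} (hm : m ≤ m') :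
    SmoothFamily m' ℓ c₁ c₂ :=
  ⟨h.contDiff, fun θ => (h.measurable θ).mono hm le_rfl, h.c₁_nonneg, h.c₂_nonneg,
    h.norm_fderiv_le, h.norm_fderiv₂_le⟩

lemma comp {Ω' : Type*} {m' : MeasurableSpace Ω'} (h : SmoothFamily m ℓ c₁ c₂) {g : Ω' → Ω}
    (hg : Measurable[m'] g) : SmoothFamily m' (fun θ ω => ℓ θ (g ω)) c₁ c₂ :=
  ⟨fun ω => h.contDiff (g ω), fun θ => (h.measurable θ).comp hg, h.c₁_nonneg, h.c₂_nonneg,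
    fun ω => h.norm_fderiv_le (g ω), fun ω => h.norm_fderiv₂_le (g ω)⟩

lemma add {ℓ' : E → Ω → ℝ} {c₁' c₂' : ℝ} (h : SmoothFamily m ℓ c₁ c₂)
    (h' : SmoothFamily m ℓ' c₁' c₂') :
    SmoothFamily m (fun θ ω => ℓ θ ω + ℓ' θ ω) (c₁ + c₁') (c₂ + c₂') := by
  have e1 : ∀ ω, fderiv ℝ (fun θ => ℓ θ ω + ℓ' θ ω)
      = fun θ => score ℓ θ ω + score ℓ' θ ω := fun ω => by
    ext1 θ; exact ((h.hasFDerivAt θ ω).add (h'.hasFDerivAt θ ω)).fderiv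
  refine ⟨fun ω => (h.contDiff ω).add (h'.contDiff ω),
    fun θ => (h.measurable θ).add (h'.measurable θ), add_nonneg h.c₁_nonneg h'.c₁_nonneg,
    add_nonneg h.c₂_nonneg h'.c₂_nonneg, fun ω θ => ?_, fun ω θ => ?_⟩
  · rw [e1]
    exact (norm_add_le _ _).trans (add_le_add (h.norm_score_le θ ω) (h'.norm_score_le θ ω))
  · rw [e1, ((h.hasFDerivAt_score θ ω).fun_add (h'.hasFDerivAt_score θ ω)).fderiv]
    exact (norm_add_le (hess ℓ θ ω) (hess ℓ' θ ω)).trans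
      (add_le_add (h.norm_hess_le θ ω) (h'.norm_hess_le θ ω))

lemma score_add {ℓ' : E → Ω → ℝ} {c₁' c₂' : ℝ} (h : SmoothFamily m ℓ c₁ c₂)
    (h' : SmoothFamily m ℓ' c₁' c₂') (θ : E) (ω : Ω) :
    score (fun θ ω => ℓ θ ω + ℓ' θ ω) θ ω = score ℓ θ ω + score ℓ' θ ω :=
  ((h.hasFDerivAt θ ω).add (h'.hasFDerivAt θ ω)).fderiv

lemma hess_add {ℓ' : E → Ω → ℝ} {c₁' c₂' : ℝ} (h : SmoothFamily m ℓ c₁ c₂)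
    (h' : SmoothFamily m ℓ' c₁' c₂') (θ : E) (ω : Ω) :
    hess (fun θ ω => ℓ θ ω + ℓ' θ ω) θ ω = hess ℓ θ ω + hess ℓ' θ ω := by
  have e1 : fderiv ℝ (fun θ => ℓ θ ω + ℓ' θ ω)
      = fun θ => score ℓ θ ω + score ℓ' θ ω := by
    ext1 θ; exact ((h.hasFDerivAt θ ω).add (h'.hasFDerivAt θ ω)).fderiv
  rw [hess, e1, ((h.hasFDerivAt_score θ ω).fun_add (h'.hasFDerivAt_score θ ω)).fderiv]

end SmoothFamily

end Family

/-! ### The log-density of the policy as such a family -/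

section Policy

variable {S A : Type*} [MeasurableSpace S] [MeasurableSpace A] {d : ℕ}

/-- The log-density of the policy, as a function of the state-action pair. -/
noncomputable def Policy.logDens (pol : Policy S A d) (θ : Param d) (x : S × A) : ℝ :=
  Real.log (pol.dens θ x.1 x.2)

lemma BoundedScore.smoothFamily {pol : Policy S A d} {Mg Mh : ℝ} (h : BoundedScore pol Mg Mh) :
    SmoothFamily inferInstance pol.logDens Mg Mh where
  contDiff x := (h.contDiff x.1 x.2).log fun θ => (h.dens_pos θ x.1 x.2).ne'
  measurable θ := (pol.measurable_dens θ).log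
  c₁_nonneg := h.Mg_pos.le
  c₂_nonneg := h.Mh_pos.le
  norm_fderiv_le x θ := h.norm_grad_le x.1 x.2 θ
  norm_fderiv₂_le x θ := h.norm_hess_le x.1 x.2 θ

end Policy

/-! ### Change of measure between trajectory laws -/

section ChangeOfMeasure

variable {S A : Type*} [MeasurableSpace S] [MeasurableSpace A] {d : ℕ}

instance (mdp : MDP S A) (pol : Policy S A d) (θ : Param d) :
    IsProbabilityMeasure (trajLaw mdp pol θ) := by
  unfold trajLaw; infer_instance

instance (mdp : MDP S A) (pol : Policy S A d) (θ : Param d) (H : ℕ) :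
    IsProbabilityMeasure (finTrajLaw mdp pol θ H) :=
  Measure.isProbabilityMeasure_map
    (measurable_pi_lambda _ fun _ => measurable_pi_apply _).aemeasurable

/-- The log-likelihood of the actions among the first `N` state-action pairs. -/
noncomputable def Policy.logLik (pol : Policy S A d) (N : ℕ) (θ : Param d) (x : ℕ → S × A) : ℝ :=
  ∑ k ∈ Finset.range N, pol.logDens θ (x k)

lemma Policy.measurable_logDens (pol : Policy S A d) (θ : Param d) :
    Measurable (pol.logDens θ) := (pol.measurable_dens θ).log

lemma Policy.measurable_logLik (pol : Policy S A d) (N : ℕ) (θ : Param d) :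
    Measurable (pol.logLik N θ) :=
  Finset.measurable_fun_sum _ fun k _ => (pol.measurable_logDens θ).comp (measurable_pi_apply k)

/-- Both action laws have positive densities with respect to the same `ν`, so each is the other one
weighted by the quotient. -/
lemma Policy.lintegral_kernel (pol : Policy S A d) (hpos : ∀ θ s a, 0 < pol.dens θ s a)
    (θ θ' : Param d) (s : S) {f : A → ENNReal} (hf : Measurable f) :
    ∫⁻ a, f a ∂(pol.kernel θ' s)
      = ∫⁻ a, ENNReal.ofReal (Real.exp (pol.logDens θ' (s, a) - pol.logDens θ (s, a))) * f a
          ∂(pol.kernel θ s) := by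
  have hm : ∀ θ, Measurable (Function.uncurry fun s a => ENNReal.ofReal (pol.dens θ s a)) :=
    fun θ => (pol.measurable_dens θ).ennreal_ofReal
  have hm' : ∀ θ, Measurable fun a => ENNReal.ofReal (pol.dens θ s a) :=
    fun θ => (hm θ).comp measurable_prodMk_left
  have hl : ∀ θ, Measurable fun a => pol.logDens θ (s, a) := fun θ =>
    (pol.measurable_logDens θ).comp measurable_prodMk_left
  have hw : Measurable fun a =>
      ENNReal.ofReal (Real.exp (pol.logDens θ' (s, a) - pol.logDens θ (s, a))) :=
    ((hl θ').sub (hl θ)).exp.ennreal_ofReal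
  rw [Policy.kernel, Policy.kernel, Kernel.withDensity_apply _ (hm θ'),
    Kernel.withDensity_apply _ (hm θ), lintegral_withDensity_eq_lintegral_mul _ (hm' θ') hf,
    lintegral_withDensity_eq_lintegral_mul _ (hm' θ) (hw.fun_mul hf)]
  refine lintegral_congr fun a => ?_
  simp only [Pi.mul_apply]
  rw [← mul_assoc, ← ENNReal.ofReal_mul (hpos θ s a).le]
  congr 2
  rw [Real.exp_sub, Policy.logDens, Policy.logDens, Real.exp_log (hpos _ _ _),
    Real.exp_log (hpos _ _ _)]
  field_simp [(hpos θ s a).ne']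

/-- The state kernel `q` is common to both parameters and cancels; only the action contributes to
the density. -/
lemma lintegral_compProd_kernel {T : Type*} [MeasurableSpace T] (q : Kernel T S) [IsMarkovKernel q]
    (pol : Policy S A d) (hpos : ∀ θ s a, 0 < pol.dens θ s a)
    (θ θ' : Param d) (y : T) {f : S × A → ENNReal} (hf : Measurable f) :
    ∫⁻ x, f x ∂((q ⊗ₖ Kernel.prodMkLeft T (pol.kernel θ')) y)
      = ∫⁻ x, ENNReal.ofReal (Real.exp (pol.logDens θ' x - pol.logDens θ x)) * f x
          ∂((q ⊗ₖ Kernel.prodMkLeft T (pol.kernel θ)) y) := by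
  have hw : Measurable fun x =>
      ENNReal.ofReal (Real.exp (pol.logDens θ' x - pol.logDens θ x)) :=
    ((pol.measurable_logDens θ').sub (pol.measurable_logDens θ)).exp.ennreal_ofReal
  rw [Kernel.lintegral_compProd _ _ _ hf, Kernel.lintegral_compProd _ _ _ (hw.fun_mul hf)]
  refine lintegral_congr fun s => ?_
  simp only [Kernel.prodMkLeft_apply]
  exact pol.lintegral_kernel hpos θ θ' s (hf.comp measurable_prodMk_left)

lemma lintegral_init (mdp : MDP S A) (pol : Policy S A d) (hpos : ∀ θ s a, 0 < pol.dens θ s a)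
    (θ θ' : Param d) {f : S × A → ENNReal} (hf : Measurable f) :
    ∫⁻ x, f x ∂(mdp.ρ ⊗ₘ pol.kernel θ')
      = ∫⁻ x, ENNReal.ofReal (Real.exp (pol.logDens θ' x - pol.logDens θ x)) * f x
          ∂(mdp.ρ ⊗ₘ pol.kernel θ) := by
  have hw : Measurable fun x =>
      ENNReal.ofReal (Real.exp (pol.logDens θ' x - pol.logDens θ x)) :=
    ((pol.measurable_logDens θ').sub (pol.measurable_logDens θ)).exp.ennreal_ofReal
  rw [Measure.lintegral_compProd hf, Measure.lintegral_compProd (hw.fun_mul hf)]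
  refine lintegral_congr fun s => ?_
  exact pol.lintegral_kernel hpos θ θ' s (hf.comp measurable_prodMk_left)

open Preorder in
lemma lintegral_trajLaw_zero (mdp : MDP S A) (pol : Policy S A d) (θ : Param d)
    {f : S × A → ENNReal} (hf : Measurable f) :
    ∫⁻ x, f (x 0) ∂(trajLaw mdp pol θ) = ∫⁻ x, f x ∂(mdp.ρ ⊗ₘ pol.kernel θ) := by
  have h1 : (trajLaw mdp pol θ).map (frestrictLe (π := fun _ => S × A) 0)
      = (mdp.ρ ⊗ₘ pol.kernel θ).map
        (MeasurableEquiv.piUnique (fun _ : Finset.Iic 0 => S × A)).symm := by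
    rw [trajLaw, Kernel.trajMeasure, Measure.map_comp _ _ (by fun_prop),
      Kernel.traj_map_frestrictLe, Kernel.partialTraj_self, Measure.id_comp]
  have hf' : Measurable fun y : Finset.Iic 0 → S × A => f (y ⟨0, by simp⟩) :=
    hf.comp (measurable_pi_apply _)
  have h2 : ∫⁻ x, f (x 0) ∂(trajLaw mdp pol θ)
      = ∫⁻ y, f (y ⟨0, by simp⟩)
        ∂((trajLaw mdp pol θ).map (frestrictLe (π := fun _ => S × A) 0)) := by
    rw [lintegral_map hf' (by fun_prop)]
    rfl
  rw [h2, h1, lintegral_map hf' (MeasurableEquiv.measurable _)]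
  rfl

-- The Markov step of the Ionescu-Tulcea construction: given the history up to `t`, the next pair is
-- drawn from `stepKernel` at the last pair.
open Preorder in
lemma lintegral_trajLaw_succ (mdp : MDP S A) (pol : Policy S A d) (θ : Param d) (t : ℕ)
    {f : (Finset.Iic t → S × A) × (S × A) → ENNReal} (hf : Measurable f) :
    ∫⁻ x, f (frestrictLe (π := fun _ => S × A) t x, x (t + 1)) ∂(trajLaw mdp pol θ)
      = ∫⁻ x, ∫⁻ z, f (frestrictLe (π := fun _ => S × A) t x, z)
          ∂(stepKernel mdp pol θ (x t)) ∂(trajLaw mdp pol θ) := by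
  have h := Kernel.map_frestrictLe_trajMeasure_compProd_eq_map_trajMeasure
    (X := fun _ => S × A) (μ₀ := mdp.ρ ⊗ₘ pol.kernel θ)
    (κ := fun t => (stepKernel mdp pol θ).comap
      (fun x : (i : Finset.Iic t) → S × A => x ⟨t, Finset.mem_Iic.2 le_rfl⟩)
      (measurable_pi_apply _)) (a := t)
  have h' : ∫⁻ x, f (frestrictLe (π := fun _ => S × A) t x, x (t + 1)) ∂(trajLaw mdp pol θ)
      = ∫⁻ y, f y ∂((trajLaw mdp pol θ).map
        (fun x => (frestrictLe (π := fun _ => S × A) t x, x (t + 1)))) := by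
    rw [lintegral_map hf (by fun_prop)]
  rw [h', trajLaw, ← h, Measure.lintegral_compProd hf, lintegral_map _ (by fun_prop)]
  · rfl
  · exact hf.lintegral_kernel_prod_right'

open Preorder in
/-- Change of measure between the trajectory laws of two parameters. -/
lemma lintegral_trajLaw_changeOfMeasure (mdp : MDP S A) (pol : Policy S A d)
    (hpos : ∀ θ s a, 0 < pol.dens θ s a) (θ θ' : Param d) (t : ℕ)
    {F : (Finset.Iic t → S × A) → ENNReal} (hF : Measurable F) :
    ∫⁻ x, F (frestrictLe (π := fun _ => S × A) t x) ∂(trajLaw mdp pol θ')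
      = ∫⁻ x, ENNReal.ofReal (Real.exp (pol.logLik (t + 1) θ' x - pol.logLik (t + 1) θ x))
          * F (frestrictLe (π := fun _ => S × A) t x) ∂(trajLaw mdp pol θ) := by
  have hw : Measurable fun x =>
      ENNReal.ofReal (Real.exp (pol.logDens θ' x - pol.logDens θ x)) :=
    ((pol.measurable_logDens θ').sub (pol.measurable_logDens θ)).exp.ennreal_ofReal
  induction t with
  | zero =>
    have e : ∀ x : ℕ → S × A, frestrictLe (π := fun _ => S × A) 0 x = fun _ => x 0 := fun x => by
      ext1 ⟨i, hi⟩
      have : i = 0 := by simpa using hi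
      subst this; rfl
    have hf : Measurable fun z : S × A => F (fun _ => z) := hF.comp (by fun_prop)
    simp only [e]
    rw [lintegral_trajLaw_zero mdp pol θ' hf, lintegral_init mdp pol hpos θ θ' hf,
      ← lintegral_trajLaw_zero mdp pol θ (hw.fun_mul hf)]
    simp [Policy.logLik]
  | succ t ih =>
    -- A history up to time `t + 1` is a history up to time `t` together with one more pair.
    let glue : (Finset.Iic t → S × A) × (S × A) → (Finset.Iic (t + 1) → S × A) :=
      fun p i => if h : (i : ℕ) ≤ t then p.1 ⟨i, Finset.mem_Iic.2 h⟩ else p.2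
    have hglue : Measurable glue := by
      refine measurable_pi_lambda _ fun i => ?_
      by_cases h : (i : ℕ) ≤ t
      · simp only [glue, h, dif_pos]; fun_prop
      · simp only [glue, h, dif_neg, not_false_eq_true]; fun_prop
    have e : ∀ x : ℕ → S × A, frestrictLe (π := fun _ => S × A) (t + 1) x
        = glue (frestrictLe (π := fun _ => S × A) t x, x (t + 1)) := fun x => by
      ext1 ⟨i, hi⟩
      by_cases h : i ≤ t
      · simp [glue, h]
      · have : i = t + 1 := le_antisymm (Finset.mem_Iic.1 hi) (by omega)
        subst this
        simp [glue]
    have hf : Measurable fun p => F (glue p) := hF.comp hglue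
    let Lt : Param d → (Finset.Iic t → S × A) → ℝ := fun θ y =>
      ∑ k : Finset.Iic t, pol.logDens θ (y k)
    have hLt : ∀ θ, Measurable (Lt θ) := fun θ =>
      Finset.measurable_fun_sum _ fun k _ => (pol.measurable_logDens θ).comp (measurable_pi_apply k)
    have eLt : ∀ θ (x : ℕ → S × A), pol.logLik (t + 1) θ x
        = Lt θ (frestrictLe (π := fun _ => S × A) t x) := fun θ x => by
      simp only [Policy.logLik, Lt, frestrictLe_apply]
      rw [Finset.sum_coe_sort (Finset.Iic t) (fun k => pol.logDens θ (x k))]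
      congr 1
      ext; simp
    have hwt : Measurable fun y => ENNReal.ofReal (Real.exp (Lt θ' y - Lt θ y)) :=
      ((hLt θ').sub (hLt θ)).exp.ennreal_ofReal
    simp only [e]
    rw [lintegral_trajLaw_succ mdp pol θ' t hf]
    have h1 : ∀ x : ℕ → S × A, ∫⁻ z, F (glue (frestrictLe (π := fun _ => S × A) t x, z))
          ∂(stepKernel mdp pol θ' (x t))
        = ∫⁻ z, ENNReal.ofReal (Real.exp (pol.logDens θ' z - pol.logDens θ z))
          * F (glue (frestrictLe (π := fun _ => S × A) t x, z))
          ∂(stepKernel mdp pol θ (x t)) := fun x =>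
      lintegral_compProd_kernel mdp.P pol hpos θ θ' (x t) (hf.comp measurable_prodMk_left)
    simp only [h1]
    let κ : Kernel (Finset.Iic t → S × A) (S × A) := (stepKernel mdp pol θ).comap
      (fun x => x ⟨t, Finset.mem_Iic.2 le_rfl⟩) (measurable_pi_apply _)
    -- The last pair is integrated out first, with its own weight; the result is a function of the
    -- shorter history, to which the induction hypothesis applies.
    have hG : Measurable fun y : Finset.Iic t → S × A =>
        ∫⁻ z, ENNReal.ofReal (Real.exp (pol.logDens θ' z - pol.logDens θ z))
          * F (glue (y, z)) ∂(κ y) :=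
      Measurable.lintegral_kernel_prod_right' (κ := κ)
        (f := fun p => ENNReal.ofReal (Real.exp (pol.logDens θ' p.2 - pol.logDens θ p.2))
          * F (glue p)) ((hw.comp measurable_snd).mul hf)
    refine (ih hG).trans ?_
    have h2 : ∀ x : ℕ → S × A,
        ENNReal.ofReal (Real.exp (pol.logLik (t + 1 + 1) θ' x - pol.logLik (t + 1 + 1) θ x))
          * F (glue (frestrictLe (π := fun _ => S × A) t x, x (t + 1)))
        = (fun p : (Finset.Iic t → S × A) × (S × A) =>
            ENNReal.ofReal (Real.exp (Lt θ' p.1 - Lt θ p.1))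
            * (ENNReal.ofReal (Real.exp (pol.logDens θ' p.2 - pol.logDens θ p.2)) * F (glue p)))
            (frestrictLe (π := fun _ => S × A) t x, x (t + 1)) := fun x => by
      simp only
      rw [← mul_assoc, ← ENNReal.ofReal_mul (Real.exp_pos _).le, ← Real.exp_add, ← eLt, ← eLt]
      congr 3
      simp only [Policy.logLik, Finset.sum_range_succ]; ring
    simp only [h2]
    refine Eq.trans ?_ (lintegral_trajLaw_succ mdp pol θ t
      (f := fun p => ENNReal.ofReal (Real.exp (Lt θ' p.1 - Lt θ p.1))
        * (ENNReal.ofReal (Real.exp (pol.logDens θ' p.2 - pol.logDens θ p.2)) * F (glue p)))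
      ((hwt.comp measurable_fst).fun_mul ((hw.comp measurable_snd).fun_mul hf))).symm
    refine lintegral_congr fun x => ?_
    have hfx : Measurable fun z => F (glue (frestrictLe (π := fun _ => S × A) t x, z)) :=
      hf.comp measurable_prodMk_left
    rw [← lintegral_const_mul _ (hw.fun_mul hfx), eLt, eLt]
    rfl

/-- The identity for indicators says that the two measures have the same trim to the first `t + 1`
pairs. A Bochner integral of a function measurable there depends on the trim only, so integrability
of `Z` plays no role. -/
lemma integral_trajLaw_changeOfMeasure (mdp : MDP S A) (pol : Policy S A d)
    (hpos : ∀ θ s a, 0 < pol.dens θ s a) (θ θ' : Param d) (t : ℕ)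
    {Z : (ℕ → S × A) → ℝ} (hZ : StronglyMeasurable[Filtration.piLE (X := fun _ => S × A) t] Z) :
    ∫ x, Z x ∂(trajLaw mdp pol θ')
      = ∫ x, Real.exp (pol.logLik (t + 1) θ' x - pol.logLik (t + 1) θ x) * Z x
          ∂(trajLaw mdp pol θ) := by
  have hm := (Filtration.piLE (X := fun _ => S × A)).le t
  let w : (ℕ → S × A) → ENNReal := fun x =>
    ENNReal.ofReal (Real.exp (pol.logLik (t + 1) θ' x - pol.logLik (t + 1) θ x))
  have hw : Measurable w :=
    ((pol.measurable_logLik _ θ').sub (pol.measurable_logLik _ θ)).exp.ennreal_ofReal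
  have e : (trajLaw mdp pol θ').trim hm = ((trajLaw mdp pol θ).withDensity w).trim hm := by
    refine @Measure.ext _ (_) _ _ fun B hB => ?_
    rw [trim_measurableSet_eq hm hB, trim_measurableSet_eq hm hB]
    rw [withDensity_apply _ (hm _ hB)]
    have hB' := hB
    rw [Filtration.piLE_eq_comap_frestrictLe] at hB'
    obtain ⟨D, hD, rfl⟩ := hB'
    have := lintegral_trajLaw_changeOfMeasure mdp pol hpos θ θ' t
      (F := D.indicator 1) (measurable_one.indicator hD)
    rw [← lintegral_indicator_one (hm _ hB), ← lintegral_indicator (hm _ hB)]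
    refine Eq.trans ?_ (this.trans ?_)
    · rfl
    · refine lintegral_congr fun x => ?_
      by_cases hx : Preorder.frestrictLe (π := fun _ => S × A) t x ∈ D
      · simp [hx, w]
      · simp [hx]
  rw [integral_trim hm hZ, e, ← integral_trim hm hZ,
    integral_withDensity_eq_integral_toReal_smul hw (by simp [w])]
  refine integral_congr_ae (Filter.Eventually.of_forall fun x => ?_)
  simp [w, ENNReal.toReal_ofReal (Real.exp_pos _).le]

end ChangeOfMeasure

/-! ### Families of laws given by likelihoods -/

section Family

variable {Ω E : Type*} [NormedAddCommGroup E] [NormedSpace ℝ E]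

/-- A family of probability measures which on the sub-σ-algebra `m` are given by the
log-likelihoods `ℓ`. -/
structure LikelihoodFamily (m m₀ : MeasurableSpace Ω) (P : E → Measure[m₀] Ω) (ℓ : E → Ω → ℝ)
    (c₁ c₂ : ℝ) : Prop extends SmoothFamily m ℓ c₁ c₂ where
  le : m ≤ m₀
  isProbabilityMeasure : ∀ θ, IsProbabilityMeasure (P θ)
  integral_eq : ∀ (θ θ' : E) (Z : Ω → ℝ), StronglyMeasurable[m] Z →
    ∫ x, Z x ∂(P θ') = ∫ x, Real.exp (ℓ θ' x - ℓ θ x) * Z x ∂(P θ)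

end Family

section

variable {S A : Type*} [MeasurableSpace S] [MeasurableSpace A] {d : ℕ}

lemma BoundedScore.smoothFamily_eval {pol : Policy S A d} {Mg Mh : ℝ} (h : BoundedScore pol Mg Mh)
    {k t : ℕ} (hkt : k ≤ t) :
    SmoothFamily (Filtration.piLE (X := fun _ => S × A) t)
      (fun θ (x : ℕ → S × A) => pol.logDens θ (x k)) Mg Mh := by
  refine h.smoothFamily.comp (g := fun x : ℕ → S × A => x k) ?_
  rw [Filtration.piLE_eq_comap_frestrictLe]
  have h1 : Measurable fun y : Finset.Iic t → S × A => y ⟨k, Finset.mem_Iic.2 hkt⟩ :=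
    measurable_pi_apply _
  exact h1.comp (comap_measurable _)

lemma BoundedScore.smoothFamily_logLik {pol : Policy S A d} {Mg Mh : ℝ}
    (h : BoundedScore pol Mg Mh) (t N : ℕ) (hN : N ≤ t + 1) :
    SmoothFamily (Filtration.piLE (X := fun _ => S × A) t) (pol.logLik N) (N * Mg) (N * Mh) := by
  induction N with
  | zero =>
    have e : ∀ x : ℕ → S × A, (fun θ => pol.logLik 0 θ x) = fun _ => 0 := fun x => by
      ext; simp [Policy.logLik]
    have e' : ∀ θ : Param d, pol.logLik 0 θ = fun _ : ℕ → S × A => 0 := fun x => by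
      ext; simp [Policy.logLik]
    have e2 : fderiv ℝ (fun _ : Param d => (0 : ℝ)) = fun _ => 0 := by ext1; simp
    refine ⟨fun x => ?_, fun θ => ?_, by simp, by simp, fun x θ => ?_, fun x θ => ?_⟩
    · rw [e]; exact contDiff_const
    · rw [e']; exact measurable_const
    · rw [e]; simp
    · have hz : ‖fderiv ℝ (fun _ : Param d => (0 : Param d →L[ℝ] ℝ)) θ‖ = 0 := by
        rw [fderiv_fun_const]; exact ContinuousLinearMap.opNorm_zero
      rw [e, e2]
      exact hz.trans_le (by simp)
  | succ N ih =>
    have := (ih (by omega)).add (h.smoothFamily_eval (k := N) (t := t) (by omega))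
    have e : pol.logLik (N + 1)
        = fun θ (x : ℕ → S × A) => pol.logLik N θ x + pol.logDens θ (x N) := by
      ext θ x; simp [Policy.logLik, Finset.sum_range_succ]
    rw [e]
    convert! this using 1 <;> push_cast <;> ring

/-- The trajectory laws, restricted to the first `t + 1` state-action pairs, form a likelihood
family. -/
lemma BoundedScore.likelihoodFamily {pol : Policy S A d} {Mg Mh : ℝ} (h : BoundedScore pol Mg Mh)
    (mdp : MDP S A) (t : ℕ) :
    LikelihoodFamily (Filtration.piLE (X := fun _ => S × A) t) inferInstance (trajLaw mdp pol)
      (pol.logLik (t + 1)) ((t + 1 : ℕ) * Mg) ((t + 1 : ℕ) * Mh) where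
  toSmoothFamily := h.smoothFamily_logLik t (t + 1) le_rfl
  le := Filtration.le _ t
  isProbabilityMeasure _ := inferInstance
  integral_eq θ θ' _ hZ := integral_trajLaw_changeOfMeasure mdp pol h.dens_pos θ θ' t hZ

end

/-! ### Differentiating expectations whose law depends on the parameter -/

section Calculus

open Filter Topology Set in
/-- A function whose increments at every point are those of a differentiable function with
derivative bounded by `K`, up to an error `L ‖θ' - θ‖`, is `(K + L)`-Lipschitz. -/
lemma abs_sub_le_of_local {E : Type*} [NormedAddCommGroup E] [NormedSpace ℝ E] {φ : E → ℝ}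
    {K L : ℝ}
    (h : ∀ θ, ∃ (ψ : E → ℝ) (D : E →L[ℝ] ℝ), HasFDerivAt ψ D θ ∧ (∀ w, |D w| ≤ K * ‖w‖) ∧
      ∀ θ', |φ θ' - φ θ - (ψ θ' - ψ θ)| ≤ L * ‖θ' - θ‖) (x y : E) :
    |φ x - φ y| ≤ (K + L) * ‖x - y‖ := by
  have hcont : Continuous φ := by
    rw [continuous_iff_continuousAt]
    intro θ
    obtain ⟨ψ, D, hD, -, hL⟩ := h θ
    have h1 : Tendsto (fun θ' => ψ θ' - ψ θ) (𝓝 θ) (𝓝 0) := by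
      simpa using hD.continuousAt.tendsto.sub_const (ψ θ)
    have h2 : Tendsto (fun θ' => φ θ' - φ θ - (ψ θ' - ψ θ)) (𝓝 θ) (𝓝 0) := by
      refine squeeze_zero_norm (a := fun θ' => L * ‖θ' - θ‖) (fun θ' => hL θ') ?_
      have : ContinuousAt (fun θ' => L * ‖θ' - θ‖) θ := by fun_prop
      simpa using this.tendsto
    have h3 := (h1.add h2).add_const (φ θ)
    simp only [add_sub_cancel, sub_add_cancel, add_zero, zero_add] at h3
    exact h3
  have key : ∀ x y, φ x - φ y ≤ (K + L) * ‖x - y‖ := by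
    intro x y
    set w := x - y with hw
    -- Mean value inequality on the segment from `y` to `x`. It needs continuity and a bound on
    -- right slopes only, and at each point the slope of `φ` is that of `ψ` up to `L * ‖w‖`.
    have hB := image_le_of_liminf_slope_right_le_deriv_boundary (f := fun s : ℝ => φ (y + s • w))
      (a := 0) (b := 1) (B := fun s => φ y + s * ((K + L) * ‖w‖)) (B' := fun _ => (K + L) * ‖w‖)
      (by fun_prop) (by simp) (by fun_prop)
      (fun s _ => by
        simpa using (((hasDerivAt_id s).mul_const ((K + L) * ‖w‖)).const_add
          (φ y)).hasDerivWithinAt)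
      (fun s hs r hr => by
        obtain ⟨ψ, D, hD, hK, hL⟩ := h (y + s • w)
        have h1 : HasDerivAt (fun s : ℝ => ψ (y + s • w)) (D w) s := by
          have h3 : HasDerivAt (fun s : ℝ => y + s • w) w s := by
            simpa using ((hasDerivAt_id s).smul_const w).const_add y
          exact hD.comp_hasDerivAt s h3
        have h2 : Tendsto (slope (fun s : ℝ => ψ (y + s • w)) s) (𝓝[>] s) (𝓝 (D w)) :=
          h1.tendsto_slope.mono_left (nhdsWithin_mono _ fun z hz => ne_of_gt hz)
        have h4 : D w < r - L * ‖w‖ := by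
          have := (abs_le.1 (hK w)).2
          nlinarith
        refine Eventually.frequently ?_
        filter_upwards [h2.eventually_lt_const h4, self_mem_nhdsWithin] with z hz hz'
        have hzs : 0 < z - s := sub_pos.2 hz'
        rw [slope_def_field] at hz ⊢
        have h5 := (abs_le.1 (hL (y + z • w))).2
        have h6 : ‖y + z • w - (y + s • w)‖ = (z - s) * ‖w‖ := by
          rw [add_sub_add_left_eq_sub, ← sub_smul, norm_smul, Real.norm_of_nonneg hzs.le]
        rw [h6] at h5
        rw [div_lt_iff₀ hzs] at hz ⊢
        nlinarith)
    have := hB (right_mem_Icc.2 zero_le_one)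
    simp only [one_smul, one_mul] at this
    rw [hw, add_sub_cancel] at this
    linarith
  rw [abs_le]
  refine ⟨?_, key x y⟩
  have := key y x
  rw [norm_sub_rev] at this
  linarith

variable {Ω E : Type*} [NormedAddCommGroup E] [NormedSpace ℝ E] [FiniteDimensional ℝ E]

/-- Differentiation under the expectation of a bounded family with bounded derivative. -/
lemma hasFDerivAt_integral_of_bounded {m₀ : MeasurableSpace Ω} (μ : Measure Ω)
    [IsProbabilityMeasure μ] {F : E → Ω → ℝ} {F' : E → Ω → E →L[ℝ] ℝ} {θ : E} {C : ℝ}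
    (hm : ∀ θ', Measurable (F θ')) (hb : ∀ ω, |F θ ω| ≤ C)
    (hd : ∀ θ' ω, HasFDerivAt (fun θ' => F θ' ω) (F' θ' ω) θ')
    (hb' : ∀ θ' ∈ Metric.ball θ 1, ∀ ω, ‖F' θ' ω‖ ≤ C) :
    ∃ D : E →L[ℝ] ℝ, HasFDerivAt (fun θ' => ∫ ω, F θ' ω ∂μ) D θ ∧ ∀ u, D u = ∫ ω, F' θ ω u ∂μ := by
  have hF' : StronglyMeasurable (F' θ) := stronglyMeasurable_clm fun u => by
    have := measurable_fderiv_apply hm (fun ω θ' => (hd θ' ω).differentiableAt) θ u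
    have e : (fun ω => F' θ ω u) = fun ω => fderiv ℝ (fun θ' => F θ' ω) θ u := by
      ext ω; rw [(hd θ ω).fderiv]
    rwa [e]
  refine ⟨∫ ω, F' θ ω ∂μ, ?_, fun u => ?_⟩
  · exact hasFDerivAt_integral_of_dominated_of_fderiv_le (bound := fun _ => C)
      (Metric.ball_mem_nhds θ one_pos)
      (Filter.Eventually.of_forall fun θ' => (hm θ').aestronglyMeasurable)
      (Integrable.of_bound (hm θ).aestronglyMeasurable C (Filter.Eventually.of_forall hb))
      hF'.aestronglyMeasurable
      (Filter.Eventually.of_forall fun ω θ' hθ' => hb' θ' hθ' ω)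
      (integrable_const C) (Filter.Eventually.of_forall fun ω θ' _ => hd θ' ω)
  · refine ContinuousLinearMap.integral_apply ?_ u
    exact Integrable.of_bound hF'.aestronglyMeasurable C
      (Filter.Eventually.of_forall (hb' θ (Metric.mem_ball_self one_pos)))

namespace LikelihoodFamily

variable {m m₀ : MeasurableSpace Ω} {P : E → Measure[m₀] Ω} {ℓ : E → Ω → ℝ} {c₁ c₂ : ℝ}

/-- On a unit ball the density ratio is bounded by a constant; this is the domination used whenever
an expectation is differentiated. -/
lemma exp_le (h : LikelihoodFamily m m₀ P ℓ c₁ c₂) {θ θ' : E} (hθ : θ' ∈ Metric.ball θ 1)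
    (ω : Ω) : Real.exp (ℓ θ' ω - ℓ θ ω) ≤ Real.exp c₁ := by
  refine Real.exp_le_exp.2 ((le_abs_self _).trans ((h.abs_sub_le θ θ' ω).trans ?_))
  rw [Metric.mem_ball, dist_eq_norm] at hθ
  exact mul_le_of_le_one_right h.c₁_nonneg hθ.le

/-- The derivative of the expectation of a parametrized function, when the law also depends on
the parameter. -/
lemma hasFDerivAt_integral (h : LikelihoodFamily m m₀ P ℓ c₁ c₂) {Q : E → Ω → ℝ}
    {Q' : E → Ω → E →L[ℝ] ℝ} {C C' : ℝ} (hQm : ∀ θ, Measurable[m] (Q θ))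
    (hQd : ∀ θ ω, HasFDerivAt (fun θ' => Q θ' ω) (Q' θ ω) θ)
    (hQb : ∀ θ ω, |Q θ ω| ≤ C) (hQ'b : ∀ θ ω, ‖Q' θ ω‖ ≤ C') (θ : E) :
    ∃ D : E →L[ℝ] ℝ, HasFDerivAt (fun θ' => ∫ ω, Q θ' ω ∂(P θ')) D θ ∧
      ∀ u, D u = ∫ ω, (score ℓ θ ω u * Q θ ω + Q' θ ω u) ∂(P θ) := by
  have := h.isProbabilityMeasure θ
  -- All laws are expressed through the single law `P θ`. At `θ` itself the weight is `1` and its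
  -- derivative is the score.
  obtain ⟨D, hD, hDu⟩ := hasFDerivAt_integral_of_bounded (P θ) (θ := θ)
    (F := fun θ' ω => Real.exp (ℓ θ' ω - ℓ θ ω) * Q θ' ω)
    (F' := fun θ' ω => Real.exp (ℓ θ' ω - ℓ θ ω) • Q' θ' ω
      + Q θ' ω • (Real.exp (ℓ θ' ω - ℓ θ ω) • score ℓ θ' ω))
    (C := max C (Real.exp c₁ * C' + C * (Real.exp c₁ * c₁)))
    (fun θ' => ((((h.measurable θ').sub (h.measurable θ)).exp).mul (hQm θ')).mono h.le le_rfl)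
    (fun ω => by simpa using Or.inl (hQb θ ω))
    (fun θ' ω => (((h.hasFDerivAt θ' ω).sub_const _).exp).mul (hQd θ' ω))
    (fun θ' hθ' ω => by
      refine (norm_add_le _ _).trans ((add_le_add ?_ ?_).trans (le_max_right _ _))
      · rw [norm_smul, Real.norm_of_nonneg (Real.exp_pos _).le]
        have := h.exp_le hθ' ω
        gcongr
        exact hQ'b θ' ω
      · rw [norm_smul, norm_smul, Real.norm_of_nonneg (Real.exp_pos _).le, Real.norm_eq_abs]
        have := h.exp_le hθ' ω
        have := hQb θ' ω
        have h3 := h.norm_score_le θ' ω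
        have : 0 ≤ C := (abs_nonneg _).trans this
        gcongr)
  refine ⟨D, ?_, fun u => ?_⟩
  · have e : (fun θ' => ∫ ω, Q θ' ω ∂(P θ'))
        = fun θ' => ∫ ω, Real.exp (ℓ θ' ω - ℓ θ ω) * Q θ' ω ∂(P θ) := by
      ext θ'
      exact h.integral_eq θ θ' _ (hQm θ').stronglyMeasurable
    rwa [e]
  · rw [hDu]
    refine integral_congr_ae (Filter.Eventually.of_forall fun ω => ?_)
    simp; ring

/-- Dominated convergence under the fixed law `P θ`, with the density ratio as a weight. -/
lemma continuous_integral (h : LikelihoodFamily m m₀ P ℓ c₁ c₂) {Q : E → Ω → ℝ}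
    {C : ℝ} (hQm : ∀ θ, Measurable[m] (Q θ))
    (hQc : ∀ ω, Continuous (fun θ' => Q θ' ω)) (hQb : ∀ θ ω, |Q θ ω| ≤ C) :
    Continuous (fun θ => ∫ ω, Q θ ω ∂(P θ)) := by
  rw [continuous_iff_continuousAt]
  intro θ
  have := h.isProbabilityMeasure θ
  have e : (fun θ' => ∫ ω, Q θ' ω ∂(P θ'))
      = fun θ' => ∫ ω, Real.exp (ℓ θ' ω - ℓ θ ω) * Q θ' ω ∂(P θ) := by
    ext θ'
    exact h.integral_eq θ θ' _ (hQm θ').stronglyMeasurable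
  rw [e]
  refine continuousAt_of_dominated (bound := fun _ => Real.exp c₁ * C)
    (Filter.Eventually.of_forall fun θ' =>
      (((((h.measurable θ').sub (h.measurable θ)).exp).mul (hQm θ')).mono h.le
        le_rfl).aestronglyMeasurable) ?_ (integrable_const _)
    (Filter.Eventually.of_forall fun ω => ?_)
  · filter_upwards [Metric.ball_mem_nhds θ one_pos] with θ' hθ'
    refine Filter.Eventually.of_forall fun ω => ?_
    rw [norm_mul, Real.norm_of_nonneg (Real.exp_pos _).le]
    have := h.exp_le hθ' ω
    gcongr
    exact hQb θ' ω
  · exact ((((h.contDiff ω).continuous.sub continuous_const).rexp).mul (hQc ω)).continuousAt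

variable {Z : Ω → ℝ} {R : ℝ}

lemma hasFDerivAt_expectation (h : LikelihoodFamily m m₀ P ℓ c₁ c₂) (hZm : Measurable[m] Z)
    (hZb : ∀ ω, |Z ω| ≤ R) (θ : E) :
    ∃ D : E →L[ℝ] ℝ, HasFDerivAt (fun θ' => ∫ ω, Z ω ∂(P θ')) D θ ∧
      ∀ u, D u = ∫ ω, score ℓ θ ω u * Z ω ∂(P θ) := by
  obtain ⟨D, hD, hDu⟩ := h.hasFDerivAt_integral (Q := fun _ => Z) (Q' := fun _ _ => 0)
    (C := R) (C' := 0) (fun _ => hZm) (fun _ _ => hasFDerivAt_const _ _) (fun _ => hZb)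
    (by simp) θ
  exact ⟨D, hD, fun u => by simpa using hDu u⟩

lemma fderiv_expectation (h : LikelihoodFamily m m₀ P ℓ c₁ c₂) (hZm : Measurable[m] Z)
    (hZb : ∀ ω, |Z ω| ≤ R) (θ u : E) :
    fderiv ℝ (fun θ' => ∫ ω, Z ω ∂(P θ')) θ u = ∫ ω, score ℓ θ ω u * Z ω ∂(P θ) := by
  obtain ⟨D, hD, hDu⟩ := h.hasFDerivAt_expectation hZm hZb θ
  rw [hD.fderiv, hDu]

lemma measurable_score_mul (h : LikelihoodFamily m m₀ P ℓ c₁ c₂) (hZm : Measurable[m] Z)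
    (θ u : E) : Measurable[m] (fun ω => score ℓ θ ω u * Z ω) :=
  (h.measurable_score θ u).mul hZm

lemma abs_score_mul_le (h : LikelihoodFamily m m₀ P ℓ c₁ c₂)
    (hZb : ∀ ω, |Z ω| ≤ R) (θ u : E) (ω : Ω) : |score ℓ θ ω u * Z ω| ≤ c₁ * ‖u‖ * R := by
  rw [abs_mul]
  have h0 : 0 ≤ R := (abs_nonneg _).trans (hZb ω)
  have := h.abs_score_le θ u ω
  have := hZb ω
  have := h.c₁_nonneg
  gcongr

/-- The second derivative: the Hessian comes from differentiating the score, the product of scores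
from the dependence of the law on the parameter. -/
lemma hasFDerivAt_score_expectation (h : LikelihoodFamily m m₀ P ℓ c₁ c₂) (hZm : Measurable[m] Z)
    (hZb : ∀ ω, |Z ω| ≤ R) (θ u : E) :
    ∃ D : E →L[ℝ] ℝ, HasFDerivAt (fun θ' => ∫ ω, score ℓ θ' ω u * Z ω ∂(P θ')) D θ ∧
      ∀ v, D v = ∫ ω, (hess ℓ θ ω v u + score ℓ θ ω v * score ℓ θ ω u) * Z ω ∂(P θ) := by
  obtain ⟨D, hD, hDu⟩ := h.hasFDerivAt_integral (Q := fun θ ω => score ℓ θ ω u * Z ω)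
    (Q' := fun θ ω => Z ω • (hess ℓ θ ω).flip u)
    (C := c₁ * ‖u‖ * R) (C' := R * (c₂ * ‖u‖)) (fun θ => h.measurable_score_mul hZm θ u)
    (fun θ ω => (h.hasFDerivAt_score_apply θ u ω).mul_const (Z ω)) (h.abs_score_mul_le hZb · u)
    (fun θ ω => by
      rw [norm_smul]
      have h0 : 0 ≤ R := (abs_nonneg _).trans (hZb ω)
      have h1 := ((hess ℓ θ ω).flip).le_opNorm u
      rw [ContinuousLinearMap.opNorm_flip] at h1
      have h2 := h.norm_hess_le θ ω
      have := hZb ω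
      rw [Real.norm_eq_abs]
      have : ‖(hess ℓ θ ω).flip u‖ ≤ c₂ * ‖u‖ := h1.trans (by gcongr)
      gcongr) θ
  refine ⟨D, hD, fun v => ?_⟩
  rw [hDu]
  refine integral_congr_ae (Filter.Eventually.of_forall fun ω => ?_)
  simp; ring

/-- In finite dimension smoothness can be tested on directional derivatives, so scalar expectations
suffice and no operator-valued integral has to be shown continuous. -/
lemma contDiff_expectation (h : LikelihoodFamily m m₀ P ℓ c₁ c₂) (hZm : Measurable[m] Z)
    (hZb : ∀ ω, |Z ω| ≤ R) : ContDiff ℝ 2 (fun θ => ∫ ω, Z ω ∂(P θ)) := by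
  have h12 : (2 : WithTop ℕ∞) = 1 + 1 := by norm_num
  have h01 : (1 : WithTop ℕ∞) = 0 + 1 := by norm_num
  rw [h12, contDiff_succ_iff_fderiv_apply]
  refine ⟨fun θ => ?_, by simp, fun u => ?_⟩
  · obtain ⟨D, hD, -⟩ := h.hasFDerivAt_expectation hZm hZb θ
    exact hD.differentiableAt
  have e : (fun θ => fderiv ℝ (fun θ' => ∫ ω, Z ω ∂(P θ')) θ u)
      = fun θ => ∫ ω, score ℓ θ ω u * Z ω ∂(P θ) := by
    ext θ; exact h.fderiv_expectation hZm hZb θ u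
  rw [e, h01, contDiff_succ_iff_fderiv_apply]
  refine ⟨fun θ => ?_, by simp, fun v => contDiff_zero.2 ?_⟩
  · obtain ⟨D, hD, -⟩ := h.hasFDerivAt_score_expectation hZm hZb θ u
    exact hD.differentiableAt
  have e : (fun θ => fderiv ℝ (fun θ' => ∫ ω, score ℓ θ' ω u * Z ω ∂(P θ')) θ v)
      = fun θ => ∫ ω, (hess ℓ θ ω v u + score ℓ θ ω v * score ℓ θ ω u) * Z ω ∂(P θ) := by
    ext θ
    obtain ⟨D, hD, hDv⟩ := h.hasFDerivAt_score_expectation hZm hZb θ u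
    rw [hD.fderiv, hDv]
  rw [e]
  refine h.continuous_integral (C := (c₂ * ‖v‖ * ‖u‖ + c₁ * ‖v‖ * (c₁ * ‖u‖)) * R)
    (fun θ => ((h.measurable_hess θ v u).add
      ((h.measurable_score θ v).mul (h.measurable_score θ u))).mul hZm) (fun ω => ?_)
    (fun θ ω => ?_)
  · have h1 : Continuous (fun θ => score ℓ θ ω) := (h.contDiff ω).continuous_fderiv (by norm_num)
    have h2 : Continuous (fun θ => hess ℓ θ ω) :=
      (((h.contDiff ω).fderiv_right (m := 1) (by norm_num)).continuous_fderiv (by norm_num))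
    fun_prop
  · rw [abs_mul]
    have h0 : 0 ≤ R := (abs_nonneg _).trans (hZb ω)
    have h1 := h.abs_score_le θ u ω
    have h2 := h.abs_score_le θ v ω
    have h3 := h.abs_hess_le θ v u ω
    have h4 := hZb ω
    have h5 := h.c₁_nonneg
    have h6 := h.c₂_nonneg
    have : |hess ℓ θ ω v u + score ℓ θ ω v * score ℓ θ ω u|
        ≤ c₂ * ‖v‖ * ‖u‖ + c₁ * ‖v‖ * (c₁ * ‖u‖) := by
      refine (abs_add_le _ _).trans ?_
      rw [abs_mul]
      gcongr
    gcongr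

lemma fderiv_fderiv_expectation (h : LikelihoodFamily m m₀ P ℓ c₁ c₂) (hZm : Measurable[m] Z)
    (hZb : ∀ ω, |Z ω| ≤ R) (θ v u : E) :
    fderiv ℝ (fderiv ℝ (fun θ' => ∫ ω, Z ω ∂(P θ'))) θ v u
      = ∫ ω, (hess ℓ θ ω v u + score ℓ θ ω v * score ℓ θ ω u) * Z ω ∂(P θ) := by
  have h1 := ((((h.contDiff_expectation hZm hZb).fderiv_right (m := 1) (by norm_num)).differentiable
    (by norm_num) θ).hasFDerivAt).clm_apply (hasFDerivAt_const u θ)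
  obtain ⟨D, hD, hDv⟩ := h.hasFDerivAt_score_expectation hZm hZb θ u
  have e : (fun θ => fderiv ℝ (fun θ' => ∫ ω, Z ω ∂(P θ')) θ u)
      = fun θ => ∫ ω, score ℓ θ ω u * Z ω ∂(P θ) := by
    ext θ; exact h.fderiv_expectation hZm hZb θ u
  rw [e] at h1
  have h2 := congrArg (fun D : E →L[ℝ] ℝ => D v) (h1.unique hD)
  rw [← hDv, ← h2]
  simp

/-- The smooth part of the derivative of the Hessian of an expectation. -/
noncomputable def thirdTerm (ℓ : E → Ω → ℝ) (θ : E) (ω : Ω) (u v w : E) : ℝ :=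
  score ℓ θ ω w * hess ℓ θ ω u v + score ℓ θ ω u * hess ℓ θ ω w v
    + score ℓ θ ω v * hess ℓ θ ω w u + score ℓ θ ω w * (score ℓ θ ω u * score ℓ θ ω v)

/-- The Hessian of an expectation is Lipschitz if the Hessian of the log-likelihood is, with
a constant that involves the expectation of `thirdTerm`. -/
lemma abs_fderiv_fderiv_expectation_sub_le (h : LikelihoodFamily m m₀ P ℓ c₁ c₂)
    (hZm : Measurable[m] Z) (hZb : ∀ ω, |Z ω| ≤ R) {L₂ K : ℝ} (u v : E)
    (hL : ∀ ω θ θ', ‖hess ℓ θ ω - hess ℓ θ' ω‖ ≤ L₂ * ‖θ - θ'‖)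
    (hK : ∀ θ w, |∫ ω, thirdTerm ℓ θ ω u v w * Z ω ∂(P θ)| ≤ K * ‖w‖) (θ θ' : E) :
    |fderiv ℝ (fderiv ℝ (fun θ' => ∫ ω, Z ω ∂(P θ'))) θ u v
      - fderiv ℝ (fderiv ℝ (fun θ' => ∫ ω, Z ω ∂(P θ'))) θ' u v|
      ≤ (K + R * L₂ * ‖u‖ * ‖v‖) * ‖θ - θ'‖ := by
  refine abs_sub_le_of_local
    (φ := fun θ => fderiv ℝ (fderiv ℝ (fun θ' => ∫ ω, Z ω ∂(P θ'))) θ u v) (fun θ => ?_) θ θ'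
  have hsb := h.abs_score_le
  have hhb := h.abs_hess_le
  have hc1 := h.c₁_nonneg
  have hc2 := h.c₂_nonneg
  -- The comparison function `ψ` is the Hessian formula with `hess ℓ` frozen at `θ`, while scores
  -- and law still move. It is differentiable, and its derivative at `θ` is the expectation of
  -- `thirdTerm`.
  obtain ⟨D, hD, hDu⟩ := h.hasFDerivAt_integral
    (Q := fun θ' ω => (hess ℓ θ ω u v + score ℓ θ' ω u * score ℓ θ' ω v) * Z ω)
    (Q' := fun θ' ω => Z ω • (score ℓ θ' ω u • (hess ℓ θ' ω).flip v
      + score ℓ θ' ω v • (hess ℓ θ' ω).flip u))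
    (C := (c₂ * ‖u‖ * ‖v‖ + c₁ * ‖u‖ * (c₁ * ‖v‖)) * R)
    (C' := R * (c₁ * ‖u‖ * (c₂ * ‖v‖) + c₁ * ‖v‖ * (c₂ * ‖u‖)))
    (fun θ' => ((h.measurable_hess θ u v).add
      ((h.measurable_score θ' u).mul (h.measurable_score θ' v))).mul hZm)
    (fun θ' ω => (((h.hasFDerivAt_score_apply θ' u ω).mul
      (h.hasFDerivAt_score_apply θ' v ω)).const_add _).mul_const (Z ω))
    (fun θ' ω => by
      rw [abs_mul]
      have h0 : 0 ≤ R := (abs_nonneg _).trans (hZb ω)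
      have h1 := hsb θ' u ω
      have h2 := hsb θ' v ω
      have h3 := hhb θ u v ω
      have h4 := hZb ω
      have : |hess ℓ θ ω u v + score ℓ θ' ω u * score ℓ θ' ω v|
          ≤ c₂ * ‖u‖ * ‖v‖ + c₁ * ‖u‖ * (c₁ * ‖v‖) := by
        refine (abs_add_le _ _).trans ?_
        rw [abs_mul]
        gcongr
      gcongr)
    (fun θ' ω => by
      have h0 : 0 ≤ R := (abs_nonneg _).trans (hZb ω)
      have hf : ∀ x, ‖(hess ℓ θ' ω).flip x‖ ≤ c₂ * ‖x‖ := fun x => by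
        have h1 := ((hess ℓ θ' ω).flip).le_opNorm x
        rw [ContinuousLinearMap.opNorm_flip] at h1
        have h2 := h.norm_hess_le θ' ω
        exact h1.trans (by gcongr)
      rw [norm_smul]
      refine mul_le_mul (hZb ω) ?_ (norm_nonneg _) h0
      refine (norm_add_le _ _).trans ?_
      rw [norm_smul, norm_smul]
      have h1 := hsb θ' u ω
      have h2 := hsb θ' v ω
      rw [← Real.norm_eq_abs] at h1 h2
      gcongr
      · exact hf v
      · exact hf u) θ
  refine ⟨_, D, hD, fun w => ?_, fun θ' => ?_⟩
  · have e : D w = ∫ ω, thirdTerm ℓ θ ω u v w * Z ω ∂(P θ) := by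
      rw [hDu]
      refine integral_congr_ae (Filter.Eventually.of_forall fun ω => ?_)
      simp [thirdTerm]; ring
    rw [e]; exact hK θ w
  -- Here `φ θ = ψ θ`, so the error is `φ θ' - ψ θ'`: the expectation under `P θ'` of the change of
  -- `hess ℓ` between `θ` and `θ'`.
  · have := h.isProbabilityMeasure θ'
    have hb2 : ∀ θ₁ θ₂ ω, |(hess ℓ θ₁ ω u v + score ℓ θ₂ ω u * score ℓ θ₂ ω v) * Z ω|
        ≤ (c₂ * ‖u‖ * ‖v‖ + c₁ * ‖u‖ * (c₁ * ‖v‖)) * R := fun θ₁ θ₂ ω => by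
      rw [abs_mul]
      have h0 : 0 ≤ R := (abs_nonneg _).trans (hZb ω)
      have h1 := hsb θ₂ u ω
      have h2 := hsb θ₂ v ω
      have h3 := hhb θ₁ u v ω
      have h4 := hZb ω
      have : |hess ℓ θ₁ ω u v + score ℓ θ₂ ω u * score ℓ θ₂ ω v|
          ≤ c₂ * ‖u‖ * ‖v‖ + c₁ * ‖u‖ * (c₁ * ‖v‖) := by
        refine (abs_add_le _ _).trans ?_
        rw [abs_mul]
        gcongr
      gcongr
    have hi : ∀ θ₁ θ₂, Integrable
        (fun ω => (hess ℓ θ₁ ω u v + score ℓ θ₂ ω u * score ℓ θ₂ ω v) * Z ω) (P θ') :=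
      fun θ₁ θ₂ => Integrable.of_bound (((((h.measurable_hess θ₁ u v).add
        ((h.measurable_score θ₂ u).mul (h.measurable_score θ₂ v))).mul hZm).mono h.le
          le_rfl).aestronglyMeasurable) _ (Filter.Eventually.of_forall (hb2 θ₁ θ₂))
    rw [h.fderiv_fderiv_expectation hZm hZb, h.fderiv_fderiv_expectation hZm hZb]
    have e1 : ∀ a b c : ℝ, a - b - (c - b) = a - c := fun a b c => by ring
    rw [e1, ← integral_sub (hi θ' θ') (hi θ θ')]
    have h2 := norm_integral_le_of_norm_le_const (μ := P θ')
      (f := fun ω => (hess ℓ θ' ω u v + score ℓ θ' ω u * score ℓ θ' ω v) * Z ω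
        - (hess ℓ θ ω u v + score ℓ θ' ω u * score ℓ θ' ω v) * Z ω)
      (C := R * L₂ * ‖u‖ * ‖v‖ * ‖θ' - θ‖) (Filter.Eventually.of_forall fun ω => by
        have e2 : (hess ℓ θ' ω u v + score ℓ θ' ω u * score ℓ θ' ω v) * Z ω
          - (hess ℓ θ ω u v + score ℓ θ' ω u * score ℓ θ' ω v) * Z ω
          = Z ω * ((hess ℓ θ' ω - hess ℓ θ ω) u v) := by
            simp; ring
        have h0 : 0 ≤ R := (abs_nonneg _).trans (hZb ω)
        rw [e2, norm_mul]
        have h3 := (hess ℓ θ' ω - hess ℓ θ ω).le_opNorm₂ u v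
        have h4 := hL ω θ' θ
        calc ‖Z ω‖ * ‖(hess ℓ θ' ω - hess ℓ θ ω) u v‖
            ≤ R * (L₂ * ‖θ' - θ‖ * ‖u‖ * ‖v‖) := by
              refine mul_le_mul (hZb ω) (h3.trans ?_) (norm_nonneg _) h0
              gcongr
          _ = _ := by ring)
    simpa using h2

end LikelihoodFamily

end Calculus

/-! ### Bounded martingale differences and second moments -/

section Martingale

variable {Ω : Type*} {m₀ : MeasurableSpace Ω}

/-- Bounded martingale differences with respect to the increasing σ-algebras `𝒢`. -/
structure MartingaleDiff (μ : Measure[m₀] Ω) (𝒢 : ℕ → MeasurableSpace Ω) (f : ℕ → Ω → ℝ)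
    (c : ℝ) : Prop where
  mono : Monotone 𝒢
  le : ∀ k, 𝒢 k ≤ m₀
  measurable : ∀ k, Measurable[𝒢 (k + 1)] (f k)
  abs_le : ∀ k ω, |f k ω| ≤ c
  -- The vanishing conditional mean, tested against bounded functions of the past.
  integral_mul_eq_zero : ∀ k (Z : Ω → ℝ) (R : ℝ), Measurable[𝒢 k] Z → (∀ ω, |Z ω| ≤ R) →
    ∫ ω, f k ω * Z ω ∂μ = 0

namespace MartingaleDiff

variable {μ : Measure[m₀] Ω} {𝒢 : ℕ → MeasurableSpace Ω} {f : ℕ → Ω → ℝ} {c : ℝ}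

lemma measurable_sum (h : MartingaleDiff μ 𝒢 f c) (N : ℕ) :
    Measurable[𝒢 N] (fun ω => ∑ k ∈ Finset.range N, f k ω) :=
  Finset.measurable_fun_sum _ fun k hk => (h.measurable k).mono
    (h.mono (Finset.mem_range.1 hk)) le_rfl

lemma abs_sum_le (h : MartingaleDiff μ 𝒢 f c) (N : ℕ) (ω : Ω) :
    |∑ k ∈ Finset.range N, f k ω| ≤ N * c := by
  refine (Finset.abs_sum_le_sum_abs _ _).trans ?_
  simpa using Finset.sum_le_card_nsmul (Finset.range N) _ c (fun k _ => h.abs_le k ω)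

/-- Orthogonality: the partial sum is a function of the past, so the cross term with the next
difference vanishes. -/
lemma integral_sq_sum [IsProbabilityMeasure μ] (h : MartingaleDiff μ 𝒢 f c) (N : ℕ) :
    ∫ ω, (∑ k ∈ Finset.range N, f k ω) ^ 2 ∂μ = ∑ k ∈ Finset.range N, ∫ ω, f k ω ^ 2 ∂μ := by
  induction N with
  | zero => simp
  | succ N ih =>
    have hm := fun N => (h.measurable_sum N).mono (h.le N) le_rfl
    have hb := h.abs_sum_le
    have hfm := fun k => (h.measurable k).mono (h.le _) le_rfl
    have i1 : Integrable (fun ω => (∑ k ∈ Finset.range N, f k ω) ^ 2) μ :=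
      Integrable.of_bound ((hm N).pow_const 2).aestronglyMeasurable ((N * c) ^ 2)
        (Filter.Eventually.of_forall fun ω => by
          rw [Real.norm_eq_abs, abs_pow]
          gcongr
          exact hb N ω)
    have i2 : Integrable (fun ω => f N ω * ∑ k ∈ Finset.range N, f k ω) μ :=
      Integrable.of_bound ((hfm N).mul (hm N)).aestronglyMeasurable (c * (N * c))
        (Filter.Eventually.of_forall fun ω => by
          rw [Real.norm_eq_abs, abs_mul]
          have h0 := (abs_nonneg _).trans (h.abs_le 0 ω)
          gcongr
          · exact h.abs_le N ω
          · exact hb N ω)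
    have i3 : Integrable (fun ω => f N ω ^ 2) μ :=
      Integrable.of_bound ((hfm N).pow_const 2).aestronglyMeasurable (c ^ 2)
        (Filter.Eventually.of_forall fun ω => by
          rw [Real.norm_eq_abs, abs_pow]
          gcongr
          exact h.abs_le N ω)
    have e : ∀ ω, (∑ k ∈ Finset.range (N + 1), f k ω) ^ 2
        = (∑ k ∈ Finset.range N, f k ω) ^ 2 + 2 * (f N ω * ∑ k ∈ Finset.range N, f k ω)
          + f N ω ^ 2 := fun ω => by
      rw [Finset.sum_range_succ]; ring
    simp only [e]
    have h0 := h.integral_mul_eq_zero N _ _ (h.measurable_sum N) (hb N)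
    rw [integral_add (i1.fun_add (i2.const_mul 2)) i3, integral_add i1 (i2.const_mul 2),
      integral_const_mul, h0, Finset.sum_range_succ, ih]
    ring

lemma integral_sq_sum_le [IsProbabilityMeasure μ] (h : MartingaleDiff μ 𝒢 f c) {q : ℝ}
    (hq : ∀ k, ∫ ω, f k ω ^ 2 ∂μ ≤ q) (N : ℕ) :
    ∫ ω, (∑ k ∈ Finset.range N, f k ω) ^ 2 ∂μ ≤ N * q := by
  rw [h.integral_sq_sum]
  simpa using Finset.sum_le_card_nsmul (Finset.range N) _ q (fun k _ => hq k)

end MartingaleDiff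

/-- The Cauchy–Schwarz inequality for bounded functions. -/
lemma integral_abs_mul_le (μ : Measure[m₀] Ω) [IsProbabilityMeasure μ] {f g : Ω → ℝ} {a b p q : ℝ}
    (hfm : Measurable f) (hgm : Measurable g) (hf : ∀ ω, |f ω| ≤ a) (hg : ∀ ω, |g ω| ≤ b)
    (hp0 : 0 ≤ p) (hq0 : 0 ≤ q) (hp : ∫ ω, f ω ^ 2 ∂μ ≤ p ^ 2) (hq : ∫ ω, g ω ^ 2 ∂μ ≤ q ^ 2) :
    ∫ ω, |f ω * g ω| ∂μ ≤ p * q := by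
  have i1 : Integrable (fun ω => f ω ^ 2) μ :=
    Integrable.of_bound (hfm.pow_const 2).aestronglyMeasurable (a ^ 2)
      (Filter.Eventually.of_forall fun ω => by
        rw [Real.norm_eq_abs, abs_pow]; gcongr; exact hf ω)
  have i2 : Integrable (fun ω => g ω ^ 2) μ :=
    Integrable.of_bound (hgm.pow_const 2).aestronglyMeasurable (b ^ 2)
      (Filter.Eventually.of_forall fun ω => by
        rw [Real.norm_eq_abs, abs_pow]; gcongr; exact hg ω)
  have i3 : Integrable (fun ω => |f ω * g ω|) μ :=
    Integrable.of_bound (hfm.mul hgm).abs.aestronglyMeasurable (a * b)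
      (Filter.Eventually.of_forall fun ω => by
        rw [Real.norm_eq_abs, abs_abs, abs_mul]
        have h0 := (abs_nonneg _).trans (hf ω)
        gcongr
        · exact hf ω
        · exact hg ω)
  -- The quadratic `s ↦ 𝔼 (s |f| + |g|)²` is nonnegative, hence its discriminant is not positive.
  have hd : discrim (∫ ω, f ω ^ 2 ∂μ) (2 * ∫ ω, |f ω * g ω| ∂μ) (∫ ω, g ω ^ 2 ∂μ) ≤ 0 := by
    refine discrim_le_zero fun s => ?_
    have e : ∀ ω, (s * |f ω| + |g ω|) ^ 2
        = s * s * f ω ^ 2 + 2 * s * |f ω * g ω| + g ω ^ 2 := fun ω => by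
      rw [abs_mul, ← sq_abs (f ω), ← sq_abs (g ω)]; ring
    have h1 : 0 ≤ ∫ ω, (s * |f ω| + |g ω|) ^ 2 ∂μ := integral_nonneg fun ω => sq_nonneg _
    simp only [e] at h1
    rw [integral_add ((i1.const_mul _).fun_add (i3.const_mul _)) i2,
      integral_add (i1.const_mul _) (i3.const_mul _), integral_const_mul, integral_const_mul] at h1
    linarith
  rw [discrim] at hd
  have h1 : (∫ ω, |f ω * g ω| ∂μ) ^ 2 ≤ (p * q) ^ 2 := by
    have h2 : (∫ ω, f ω ^ 2 ∂μ) * (∫ ω, g ω ^ 2 ∂μ) ≤ p ^ 2 * q ^ 2 :=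
      mul_le_mul hp hq (integral_nonneg fun ω => sq_nonneg _) (sq_nonneg p)
    nlinarith
  exact le_of_sq_le_sq h1 (mul_nonneg hp0 hq0)

lemma abs_integral_mul_le_of_abs_le (μ : Measure[m₀] Ω) [IsProbabilityMeasure μ] {f Z : Ω → ℝ}
    {a R : ℝ} (hfm : Measurable f) (hf : ∀ ω, |f ω| ≤ a) (hZ : ∀ ω, |Z ω| ≤ R) :
    |∫ ω, f ω * Z ω ∂μ| ≤ (∫ ω, |f ω| ∂μ) * R := by
  have i : Integrable (fun ω => |f ω|) μ :=
    Integrable.of_bound hfm.abs.aestronglyMeasurable a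
      (Filter.Eventually.of_forall fun ω => by rw [Real.norm_eq_abs, abs_abs]; exact hf ω)
  refine le_of_le_of_eq ?_ (integral_mul_const R fun ω => |f ω|)
  rw [← Real.norm_eq_abs]
  refine norm_integral_le_of_norm_le (i.mul_const R) (Filter.Eventually.of_forall fun ω => ?_)
  rw [norm_mul]
  exact mul_le_mul_of_nonneg_left (hZ ω) (norm_nonneg _)

end Martingale

/-! ### Scores along a trajectory are martingale differences -/

section Trajectory

variable {S A : Type*} [MeasurableSpace S] [MeasurableSpace A] {d : ℕ}

/-- The σ-algebra generated by the first `N` state-action pairs. -/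
@[reducible]
def past (X : Type*) [MeasurableSpace X] : ℕ → MeasurableSpace (ℕ → X)
  | 0 => ⊥
  -- `piLE t` includes time `t` and thus describes `t + 1` pairs; the shift makes room for the empty
  -- past.
  | t + 1 => Filtration.piLE (X := fun _ => X) t

lemma past_mono (X : Type*) [MeasurableSpace X] : Monotone (past X) :=
  monotone_nat_of_le_succ fun N => by
    cases N with
    | zero => exact bot_le
    | succ t => exact Filtration.mono _ (Nat.le_succ t)

lemma past_le (X : Type*) [MeasurableSpace X] (N : ℕ) : past X N ≤ MeasurableSpace.pi := by
  cases N with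
  | zero => exact bot_le
  | succ t => exact Filtration.le _ t

lemma measurable_eval_past (X : Type*) [MeasurableSpace X] {k N : ℕ} (hk : k < N) :
    Measurable[past X N] (fun x : ℕ → X => x k) := by
  obtain ⟨t, rfl⟩ : ∃ t, N = t + 1 := ⟨N - 1, by omega⟩
  rw [past, Filtration.piLE_eq_comap_frestrictLe]
  have h1 : Measurable fun y : Finset.Iic t → X => y ⟨k, Finset.mem_Iic.2 (by omega)⟩ :=
    measurable_pi_apply _
  exact h1.comp (comap_measurable _)

variable {pol : Policy S A d} {Mg Mh : ℝ}

lemma BoundedScore.likelihoodFamily_past (h : BoundedScore pol Mg Mh) (mdp : MDP S A) (N : ℕ) :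
    LikelihoodFamily (past (S × A) N) MeasurableSpace.pi (trajLaw mdp pol) (pol.logLik N)
      (N * Mg) (N * Mh) := by
  cases N with
  | succ t => exact h.likelihoodFamily mdp t
  | zero =>
    have h0 := h.smoothFamily_logLik 0 0 (by simp)
    refine ⟨⟨h0.contDiff, fun θ => ?_, h0.c₁_nonneg, h0.c₂_nonneg, h0.norm_fderiv_le,
      h0.norm_fderiv₂_le⟩, bot_le, fun θ => inferInstance, fun θ θ' Z hZ => ?_⟩
    · have e : pol.logLik 0 θ = fun _ => 0 := by ext; simp [Policy.logLik]
      rw [e]; exact measurable_const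
    · have : Nonempty (ℕ → S × A) := nonempty_of_isProbabilityMeasure (trajLaw mdp pol θ)
      -- With no pairs observed `Z` is a constant, and all the laws have mass one.
      obtain ⟨c, rfl⟩ := stronglyMeasurable_bot_iff.1 hZ
      simp [Policy.logLik]

lemma BoundedScore.logLik_succ_family (h : BoundedScore pol Mg Mh) (N : ℕ) :
    SmoothFamily (past (S × A) (N + 1)) (fun θ (x : ℕ → S × A) => pol.logDens θ (x N)) Mg Mh :=
  h.smoothFamily.comp (measurable_eval_past _ (Nat.lt_succ_self N))

lemma Policy.logLik_succ (pol : Policy S A d) (N : ℕ) :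
    pol.logLik (N + 1) = fun θ x => pol.logLik N θ x + pol.logDens θ (x N) := by
  ext θ x; simp [Policy.logLik, Finset.sum_range_succ]

lemma BoundedScore.score_logLik_succ (h : BoundedScore pol Mg Mh) (N : ℕ) (θ : Param d)
    (x : ℕ → S × A) : score (pol.logLik (N + 1)) θ x
      = score (pol.logLik N) θ x + score pol.logDens θ (x N) := by
  rw [pol.logLik_succ]
  exact ((h.smoothFamily_logLik N N (by omega)).mono (Filtration.le _ N)).score_add
    ((h.logLik_succ_family N).mono (past_le _ _)) θ x

lemma BoundedScore.hess_logLik_succ (h : BoundedScore pol Mg Mh) (N : ℕ) (θ : Param d)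
    (x : ℕ → S × A) : hess (pol.logLik (N + 1)) θ x
      = hess (pol.logLik N) θ x + hess pol.logDens θ (x N) := by
  rw [pol.logLik_succ]
  exact ((h.smoothFamily_logLik N N (by omega)).mono (Filtration.le _ N)).hess_add
    ((h.logLik_succ_family N).mono (past_le _ _)) θ x

lemma BoundedScore.score_logLik (h : BoundedScore pol Mg Mh) (N : ℕ) (θ : Param d)
    (x : ℕ → S × A) : score (pol.logLik N) θ x
      = ∑ k ∈ Finset.range N, score pol.logDens θ (x k) := by
  induction N with
  | zero =>
    have e : (fun θ => pol.logLik 0 θ x) = fun _ => 0 := by ext; simp [Policy.logLik]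
    rw [score, e]; simp
  | succ N ih => rw [h.score_logLik_succ, ih, Finset.sum_range_succ]

lemma BoundedScore.hess_logLik (h : BoundedScore pol Mg Mh) (N : ℕ) (θ : Param d)
    (x : ℕ → S × A) : hess (pol.logLik N) θ x
      = ∑ k ∈ Finset.range N, hess pol.logDens θ (x k) := by
  induction N with
  | zero =>
    have e : (fun θ => pol.logLik 0 θ x) = fun _ => 0 := by ext; simp [Policy.logLik]
    have e2 : fderiv ℝ (fun _ : Param d => (0 : ℝ)) = fun _ => 0 := by ext1; simp
    rw [hess, e, e2, fderiv_fun_const]; simp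
  | succ N ih => rw [h.hess_logLik_succ, ih, Finset.sum_range_succ]

/-- `∂_u ∂_v π / π` at the `k`-th state-action pair. -/
noncomputable def secondScore (pol : Policy S A d) (θ u v : Param d) (y : S × A) : ℝ :=
  hess pol.logDens θ y u v + score pol.logDens θ y u * score pol.logDens θ y v

/-- For `Z` depending on the first `k` pairs, the derivative of its expectation can be written with
the likelihood of `k` or of `k + 1` factors. The two formulas differ by the score at the `k`-th pair
times `Z`, whose expectation is therefore zero. -/
lemma BoundedScore.martingaleDiff_score (h : BoundedScore pol Mg Mh) (mdp : MDP S A)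
    (θ u : Param d) :
    MartingaleDiff (trajLaw mdp pol θ) (past (S × A)) (fun k x => score pol.logDens θ (x k) u)
      (Mg * ‖u‖) where
  mono := past_mono _
  le := past_le _
  measurable k := (h.smoothFamily.measurable_score θ u).comp
    (measurable_eval_past _ (Nat.lt_succ_self k))
  abs_le k x := h.smoothFamily.abs_score_le θ u (x k)
  integral_mul_eq_zero k Z R hZ hR := by
    have f1 := h.likelihoodFamily_past mdp k
    have f2 := h.likelihoodFamily_past mdp (k + 1)
    have hZ' : Measurable[past (S × A) (k + 1)] Z := hZ.mono (past_mono _ (Nat.le_succ k)) le_rfl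
    have e1 := f1.fderiv_expectation hZ hR θ u
    have e2 := f2.fderiv_expectation hZ' hR θ u
    rw [e1] at e2
    have i1 : Integrable (fun x => score (pol.logLik k) θ x u * Z x) (trajLaw mdp pol θ) :=
      Integrable.of_bound ((f1.measurable_score_mul hZ θ u).mono f1.le le_rfl).aestronglyMeasurable
        _ (Filter.Eventually.of_forall (f1.abs_score_mul_le hR θ u))
    have i2 : Integrable (fun x => score (pol.logLik (k + 1)) θ x u * Z x) (trajLaw mdp pol θ) :=
      Integrable.of_bound ((f2.measurable_score_mul hZ' θ u).mono f2.le le_rfl).aestronglyMeasurable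
        _ (Filter.Eventually.of_forall (f2.abs_score_mul_le hR θ u))
    have e3 : ∀ x, score pol.logDens θ (x k) u * Z x
        = score (pol.logLik (k + 1)) θ x u * Z x - score (pol.logLik k) θ x u * Z x := fun x => by
      rw [h.score_logLik_succ]; simp; ring
    simp only [e3]
    rw [integral_sub i2 i1, e2, sub_self]

lemma BoundedScore.measurable_secondScore (h : BoundedScore pol Mg Mh) (θ u v : Param d) :
    Measurable (secondScore pol θ u v) :=
  (h.smoothFamily.measurable_hess θ u v).add
    ((h.smoothFamily.measurable_score θ u).mul (h.smoothFamily.measurable_score θ v))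

/-- The same comparison of likelihoods with `k` and `k + 1` factors, now for second derivatives. The
mixed products of the new score with the past score vanish by `martingaleDiff_score`. -/
lemma BoundedScore.martingaleDiff_secondScore (h : BoundedScore pol Mg Mh) (mdp : MDP S A)
    (θ u v : Param d) :
    MartingaleDiff (trajLaw mdp pol θ) (past (S × A)) (fun k x => secondScore pol θ u v (x k))
      ((Mh + Mg ^ 2) * ‖u‖ * ‖v‖) where
  mono := past_mono _
  le := past_le _
  measurable k := (h.measurable_secondScore θ u v).comp
    (measurable_eval_past _ (Nat.lt_succ_self k))
  abs_le k x := by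
    have h1 := h.smoothFamily.abs_score_le θ u (x k)
    have h2 := h.smoothFamily.abs_score_le θ v (x k)
    have h3 := h.smoothFamily.abs_hess_le θ u v (x k)
    have := h.Mg_pos.le
    calc |secondScore pol θ u v (x k)| ≤ Mh * ‖u‖ * ‖v‖ + (Mg * ‖u‖) * (Mg * ‖v‖) := by
          refine (abs_add_le _ _).trans ?_
          rw [abs_mul]
          gcongr
      _ = _ := by ring
  integral_mul_eq_zero k Z R hZ hR := by
    have f1 := h.likelihoodFamily_past mdp k
    have f2 := h.likelihoodFamily_past mdp (k + 1)
    have hZ' : Measurable[past (S × A) (k + 1)] Z := hZ.mono (past_mono _ (Nat.le_succ k)) le_rfl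
    have e1 := f1.fderiv_fderiv_expectation hZ hR θ u v
    have e2 := f2.fderiv_fderiv_expectation hZ' hR θ u v
    rw [e1] at e2
    have int : ∀ N, k ≤ N → Integrable (fun x => (hess (pol.logLik N) θ x u v
        + score (pol.logLik N) θ x u * score (pol.logLik N) θ x v) * Z x)
        (trajLaw mdp pol θ) := fun N hN => by
      have f := h.likelihoodFamily_past mdp N
      have hZ' : Measurable[past (S × A) N] Z := hZ.mono (past_mono _ hN) le_rfl
      refine Integrable.of_bound (((((f.measurable_hess θ u v).add
        ((f.measurable_score θ u).mul (f.measurable_score θ v))).mul hZ').mono f.le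
        le_rfl).aestronglyMeasurable) ((N * Mh * ‖u‖ * ‖v‖ + N * Mg * ‖u‖ * (N * Mg * ‖v‖)) * R)
        (Filter.Eventually.of_forall fun x => ?_)
      rw [norm_mul, Real.norm_eq_abs, Real.norm_eq_abs]
      have h0 : 0 ≤ R := (abs_nonneg _).trans (hR x)
      have h1 := f.abs_score_le θ u x
      have h2 := f.abs_score_le θ v x
      have h3 := f.abs_hess_le θ u v x
      have h4 := hR x
      have h5 := h.Mg_pos.le
      have h6 := h.Mh_pos.le
      have : |hess (pol.logLik N) θ x u v
          + score (pol.logLik N) θ x u * score (pol.logLik N) θ x v|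
          ≤ N * Mh * ‖u‖ * ‖v‖ + N * Mg * ‖u‖ * (N * Mg * ‖v‖) := by
        refine (abs_add_le _ _).trans ?_
        rw [abs_mul]
        gcongr
      gcongr
    -- The past score is itself a function of the first `k` pairs, so it may be absorbed into the
    -- test function `Z`.
    have crossInt : ∀ u v, Integrable (fun x => score pol.logDens θ (x k) u
        * (score (pol.logLik k) θ x v * Z x)) (trajLaw mdp pol θ) := fun u v => by
      have g := h.martingaleDiff_score mdp θ u
      refine Integrable.of_bound ((((g.measurable k).mono (g.le _) le_rfl).mul
        ((f1.measurable_score_mul hZ θ v).mono f1.le le_rfl)).aestronglyMeasurable)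
        (Mg * ‖u‖ * (k * Mg * ‖v‖ * R)) (Filter.Eventually.of_forall fun x => ?_)
      rw [norm_mul]
      have h1 := g.abs_le k x
      have h2 := f1.abs_score_mul_le hR θ v x
      have h5 := h.Mg_pos.le
      exact mul_le_mul h1 h2 (norm_nonneg _) (by positivity)
    have cross : ∀ u v, ∫ x, score pol.logDens θ (x k) u
        * (score (pol.logLik k) θ x v * Z x) ∂(trajLaw mdp pol θ) = 0 := fun u v =>
      (h.martingaleDiff_score mdp θ u).integral_mul_eq_zero k _ _
        (f1.measurable_score_mul hZ θ v) (f1.abs_score_mul_le hR θ v)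
    have e3 : ∀ x, secondScore pol θ u v (x k) * Z x
        = ((hess (pol.logLik (k + 1)) θ x u v
          + score (pol.logLik (k + 1)) θ x u * score (pol.logLik (k + 1)) θ x v) * Z x
          + (-1) * ((hess (pol.logLik k) θ x u v
          + score (pol.logLik k) θ x u * score (pol.logLik k) θ x v) * Z x))
          + (-1) * (score pol.logDens θ (x k) u * (score (pol.logLik k) θ x v * Z x)
            + score pol.logDens θ (x k) v * (score (pol.logLik k) θ x u * Z x)) := fun x => by
      rw [h.score_logLik_succ, h.hess_logLik_succ, secondScore]; simp; ring
    simp only [e3]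
    rw [integral_add ((int (k + 1) (Nat.le_succ k)).fun_add ((int k le_rfl).const_mul (-1)))
      (((crossInt u v).fun_add (crossInt v u)).const_mul (-1)),
      integral_add (int (k + 1) (Nat.le_succ k)) ((int k le_rfl).const_mul (-1)),
      integral_const_mul, integral_const_mul,
      integral_add (crossInt u v) (crossInt v u), cross, cross, e2]
    ring

end Trajectory

/-! ### Moment bounds for sums of scores -/

section Moments

/-- The mean is the best constant approximation in `L²`: a centred `f` satisfies `𝔼 f² ≤ 𝔼 (f - c)²`
for every `c`. -/
lemma integral_sq_le_of_centered {Ω : Type*} {m₀ : MeasurableSpace Ω} (μ : Measure Ω)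
    [IsProbabilityMeasure μ] {f : Ω → ℝ} {a c K : ℝ} (hfm : Measurable f) (hf : ∀ ω, |f ω| ≤ a)
    (h0 : ∫ ω, f ω ∂μ = 0) (hK : ∀ ω, |f ω - c| ≤ K) : ∫ ω, f ω ^ 2 ∂μ ≤ K ^ 2 := by
  have i1 : Integrable f μ := Integrable.of_bound hfm.aestronglyMeasurable a
    (Filter.Eventually.of_forall hf)
  have i2 : Integrable (fun ω => f ω ^ 2) μ :=
    Integrable.of_bound (hfm.pow_const 2).aestronglyMeasurable (a ^ 2)
      (Filter.Eventually.of_forall fun ω => by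
        rw [Real.norm_eq_abs, abs_pow]; gcongr; exact hf ω)
  have i3 : Integrable (fun ω => 2 * c * f ω + K ^ 2) μ := (i1.const_mul _).add (integrable_const _)
  have h1 : ∫ ω, f ω ^ 2 ∂μ ≤ ∫ ω, (2 * c * f ω + K ^ 2) ∂μ := by
    refine integral_mono i2 i3 fun ω => ?_
    have := sq_le_sq' (abs_le.1 (hK ω)).1 (abs_le.1 (hK ω)).2
    simp only
    nlinarith [sq_nonneg c]
  rw [integral_add (i1.const_mul _) (integrable_const _), integral_const_mul, h0] at h1
  simpa using h1

variable {d : ℕ}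

/-- A rank-one form is within `M² / 2` of a multiple of the inner product. -/
lemma abs_mul_sub_inner_le {E : Type*} [NormedAddCommGroup E] [InnerProductSpace ℝ E]
    [CompleteSpace E] (a : E →L[ℝ] ℝ) {M : ℝ} (ha : ‖a‖ ≤ M) (u v : E) :
    |a u * a v - M ^ 2 / 2 * inner ℝ u v| ≤ M ^ 2 / 2 * ‖u‖ * ‖v‖ := by
  set w := (InnerProductSpace.toDual ℝ E).symm a with hw
  have hau : ∀ x, a x = inner ℝ w x := fun x => by simp [hw]
  have hwn : ‖w‖ ≤ M := by simpa [hw] using ha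
  have hM : 0 ≤ M := (norm_nonneg _).trans hwn
  have e : a u * a v - M ^ 2 / 2 * inner ℝ u v = inner ℝ (a u • w - (M ^ 2 / 2) • u) v := by
    rw [inner_sub_left, real_inner_smul_left, real_inner_smul_left, hau v]
  rw [e]
  refine (abs_real_inner_le_norm _ _).trans (mul_le_mul_of_nonneg_right ?_ (norm_nonneg v))
  refine le_of_sq_le_sq ?_ (by positivity)
  -- The squared norm equals `(a u)² (‖w‖² - M²) + (M²/2)² ‖u‖²`, whose first summand is not
  -- positive.
  rw [norm_sub_sq_real, norm_smul, norm_smul, real_inner_smul_left, real_inner_smul_right, ← hau u,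
    mul_pow, Real.norm_eq_abs, sq_abs, Real.norm_of_nonneg (by positivity)]
  have : ‖w‖ ^ 2 ≤ M ^ 2 := by gcongr
  nlinarith [mul_le_mul_of_nonneg_left this (sq_nonneg (a u))]

variable {S A : Type*} [MeasurableSpace S] [MeasurableSpace A] {pol : Policy S A d} {Mg Mh : ℝ}

/-- Orthogonality gives growth `√N` in `L²`, where the pointwise bound grows like `N`. -/
lemma BoundedScore.integral_score_sq_le (h : BoundedScore pol Mg Mh) (mdp : MDP S A) (N : ℕ)
    (θ u : Param d) : ∫ x, score (pol.logLik N) θ x u ^ 2 ∂(trajLaw mdp pol θ)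
      ≤ (√N * (Mg * ‖u‖)) ^ 2 := by
  have g := h.martingaleDiff_score mdp θ u
  have e : ∀ x, score (pol.logLik N) θ x u
      = ∑ k ∈ Finset.range N, score pol.logDens θ (x k) u := fun x => by
    rw [h.score_logLik, sum_apply]
  simp only [e]
  rw [mul_pow, Real.sq_sqrt (Nat.cast_nonneg N)]
  refine g.integral_sq_sum_le (fun k => ?_) N
  refine integral_sq_le_of_centered _ (c := 0) ((g.measurable k).mono (g.le _) le_rfl)
    (g.abs_le k) ?_ (by simpa using g.abs_le k)
  simpa using g.integral_mul_eq_zero k (fun _ => 1) 1 measurable_const (by simp)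

/-- Each second score is centred, so its second moment may be estimated after subtracting `Mg² / 2`
times the inner product. This halves the contribution of the rank-one form; the gain is what makes
the case `N = 2` of `integral_abs_thirdTerm_le` work with the constant `4`. -/
lemma BoundedScore.integral_secondScore_sq_le (h : BoundedScore pol Mg Mh) (mdp : MDP S A) (N : ℕ)
    (θ u v : Param d) :
    ∫ x, (∑ k ∈ Finset.range N, secondScore pol θ u v (x k)) ^ 2 ∂(trajLaw mdp pol θ)
      ≤ (√N * ((Mh + Mg ^ 2 / 2) * ‖u‖ * ‖v‖)) ^ 2 := by
  have g := h.martingaleDiff_secondScore mdp θ u v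
  rw [mul_pow, Real.sq_sqrt (Nat.cast_nonneg N)]
  refine g.integral_sq_sum_le (fun k => ?_) N
  refine integral_sq_le_of_centered _ (c := Mg ^ 2 / 2 * inner ℝ u v)
    ((g.measurable k).mono (g.le _) le_rfl) (g.abs_le k) ?_ (fun x => ?_)
  · simpa using g.integral_mul_eq_zero k (fun _ => 1) 1 measurable_const (by simp)
  · have h1 := h.smoothFamily.abs_hess_le θ u v (x k)
    have h2 := abs_mul_sub_inner_le _ (h.smoothFamily.norm_score_le θ (x k)) u v
    rw [secondScore, add_sub_assoc]
    refine (abs_add_le _ _).trans ((add_le_add h1 h2).trans_eq ?_)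
    ring

lemma BoundedScore.integral_abs_score_mul_score_le (h : BoundedScore pol Mg Mh) (mdp : MDP S A)
    (N : ℕ) (θ u v : Param d) :
    ∫ x, |score (pol.logLik N) θ x u * score (pol.logLik N) θ x v| ∂(trajLaw mdp pol θ)
      ≤ N * Mg ^ 2 * ‖u‖ * ‖v‖ := by
  have f := h.likelihoodFamily_past mdp N
  have := h.Mg_pos.le
  refine (integral_abs_mul_le _ ((f.measurable_score θ u).mono f.le le_rfl)
    ((f.measurable_score θ v).mono f.le le_rfl) (f.abs_score_le θ u) (f.abs_score_le θ v)
    (by positivity) (by positivity) (h.integral_score_sq_le mdp N θ u)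
    (h.integral_score_sq_le mdp N θ v)).trans_eq ?_
  have : √(N : ℝ) * √N = N := Real.mul_self_sqrt (Nat.cast_nonneg N)
  linear_combination Mg ^ 2 * ‖u‖ * ‖v‖ * this

lemma BoundedScore.integral_abs_score_le (h : BoundedScore pol Mg Mh) (mdp : MDP S A)
    (N : ℕ) (θ u : Param d) :
    ∫ x, |score (pol.logLik N) θ x u| ∂(trajLaw mdp pol θ) ≤ √N * (Mg * ‖u‖) := by
  have f := h.likelihoodFamily_past mdp N
  have := h.Mg_pos.le
  simpa using integral_abs_mul_le (trajLaw mdp pol θ) (g := fun _ => 1) (b := 1) (q := 1)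
    ((f.measurable_score θ u).mono f.le le_rfl) measurable_const (f.abs_score_le θ u) (by simp)
    (by positivity) (by positivity) (h.integral_score_sq_le mdp N θ u) (by simp)

/-- The sum of the rank-one forms of the scores. -/
lemma BoundedScore.hess_logLik_eq (h : BoundedScore pol Mg Mh) (N : ℕ) (θ u v : Param d)
    (x : ℕ → S × A) : hess (pol.logLik N) θ x u v
      = (∑ k ∈ Finset.range N, secondScore pol θ u v (x k))
        - ∑ k ∈ Finset.range N, score pol.logDens θ (x k) u * score pol.logDens θ (x k) v := by
  rw [h.hess_logLik, sum_apply, sum_apply, ← Finset.sum_sub_distrib]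
  exact Finset.sum_congr rfl fun k _ => by simp [secondScore]

/-- By `hess_logLik_eq` the Hessian is a martingale sum minus a sum of rank-one forms.
Cauchy–Schwarz against the score gives order `√N · √N` for the first part and `√N · N` for the
second. -/
lemma BoundedScore.integral_abs_score_mul_hess_le (h : BoundedScore pol Mg Mh) (mdp : MDP S A)
    (N : ℕ) (θ u v w : Param d) :
    ∫ x, |score (pol.logLik N) θ x w * hess (pol.logLik N) θ x u v| ∂(trajLaw mdp pol θ)
      ≤ (N * Mg * (Mh + Mg ^ 2 / 2) + √N * N * Mg ^ 3) * ‖u‖ * ‖v‖ * ‖w‖ := by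
  have f := h.likelihoodFamily_past mdp N
  have hMg := h.Mg_pos.le
  have hMh := h.Mh_pos.le
  have hAm := (f.measurable_score θ w).mono f.le le_rfl
  have gB := h.martingaleDiff_secondScore mdp θ u v
  let B : (ℕ → S × A) → ℝ := fun x => ∑ k ∈ Finset.range N, secondScore pol θ u v (x k)
  let V : (ℕ → S × A) → ℝ := fun x =>
    ∑ k ∈ Finset.range N, score pol.logDens θ (x k) u * score pol.logDens θ (x k) v
  have hBm : Measurable B := (gB.measurable_sum N).mono (gB.le N) le_rfl
  have hVm : Measurable V := Finset.measurable_fun_sum _ fun k _ =>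
    ((h.smoothFamily.measurable_score θ u).comp (measurable_pi_apply k)).mul
      ((h.smoothFamily.measurable_score θ v).comp (measurable_pi_apply k))
  have hVb : ∀ x, |V x| ≤ N * Mg ^ 2 * ‖u‖ * ‖v‖ := fun x => by
    refine (Finset.abs_sum_le_sum_abs _ _).trans ?_
    have := Finset.sum_le_card_nsmul (Finset.range N)
      (fun k => |score pol.logDens θ (x k) u * score pol.logDens θ (x k) v|)
      (Mg * ‖u‖ * (Mg * ‖v‖)) (fun k _ => by
        rw [abs_mul]
        exact mul_le_mul (h.smoothFamily.abs_score_le θ u (x k))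
          (h.smoothFamily.abs_score_le θ v (x k)) (abs_nonneg _) (by positivity))
    refine this.trans_eq ?_
    simp; ring
  have hBb := gB.abs_sum_le N
  have hAb := f.abs_score_le θ w
  have h1 := integral_abs_mul_le (trajLaw mdp pol θ) hAm hBm hAb hBb
    (p := √N * (Mg * ‖w‖)) (q := √N * ((Mh + Mg ^ 2 / 2) * ‖u‖ * ‖v‖))
    (by positivity) (by positivity) (h.integral_score_sq_le mdp N θ w)
    (h.integral_secondScore_sq_le mdp N θ u v)
  have h2 := integral_abs_mul_le (trajLaw mdp pol θ) hAm hVm hAb hVb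
    (p := √N * (Mg * ‖w‖)) (q := N * Mg ^ 2 * ‖u‖ * ‖v‖)
    (by positivity) (by positivity) (h.integral_score_sq_le mdp N θ w) (by
      have : ∫ x, V x ^ 2 ∂(trajLaw mdp pol θ)
          ≤ ∫ x, (N * Mg ^ 2 * ‖u‖ * ‖v‖) ^ 2 ∂(trajLaw mdp pol θ) :=
        integral_mono_of_nonneg (Filter.Eventually.of_forall fun x => sq_nonneg _)
          (integrable_const _) (Filter.Eventually.of_forall fun x =>
            sq_le_sq' (abs_le.1 (hVb x)).1 (abs_le.1 (hVb x)).2)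
      simpa using this)
  have bd : ∀ {g : (ℕ → S × A) → ℝ} {b : ℝ}, Measurable g → (∀ x, |g x| ≤ b) →
      Integrable (fun x => |score (pol.logLik N) θ x w * g x|) (trajLaw mdp pol θ) :=
    fun hg hb => Integrable.of_bound (hAm.mul hg).abs.aestronglyMeasurable _
      (Filter.Eventually.of_forall fun x => by
        rw [Real.norm_eq_abs, abs_abs, abs_mul]
        exact mul_le_mul (hAb x) (hb x) (abs_nonneg _) ((abs_nonneg _).trans (hAb x)))
  have h3 : ∫ x, |score (pol.logLik N) θ x w * hess (pol.logLik N) θ x u v| ∂(trajLaw mdp pol θ)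
      ≤ ∫ x, (|score (pol.logLik N) θ x w * B x| + |score (pol.logLik N) θ x w * V x|)
        ∂(trajLaw mdp pol θ) := by
    refine integral_mono (bd ((f.measurable_hess θ u v).mono f.le le_rfl)
      (f.abs_hess_le θ u v)) ((bd hBm hBb).add (bd hVm hVb)) fun x => ?_
    simp only
    rw [h.hess_logLik_eq, mul_sub]
    exact abs_sub _ _
  rw [integral_add (bd hBm hBb) (bd hVm hVb)] at h3
  refine h3.trans ((add_le_add h1 h2).trans_eq ?_)
  have : √(N : ℝ) * √N = N := Real.mul_self_sqrt (Nat.cast_nonneg N)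
  linear_combination Mg * (Mh + Mg ^ 2 / 2) * ‖u‖ * ‖v‖ * ‖w‖ * this

/-- The bound on `thirdTerm` for a likelihood with `N` factors. -/
lemma BoundedScore.integral_abs_thirdTerm_le (h : BoundedScore pol Mg Mh) (mdp : MDP S A)
    (N : ℕ) (θ u v w : Param d) :
    ∫ x, |LikelihoodFamily.thirdTerm (pol.logLik N) θ x u v w| ∂(trajLaw mdp pol θ)
      ≤ (3 * N * Mg * Mh + 4 * N ^ 2 * Mg ^ 3) * ‖u‖ * ‖v‖ * ‖w‖ := by
  have f := h.likelihoodFamily_past mdp N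
  have hMg := h.Mg_pos.le
  have hMh := h.Mh_pos.le
  have hsm := fun u => (f.measurable_score θ u).mono f.le le_rfl
  have hhm := fun u v => (f.measurable_hess θ u v).mono f.le le_rfl
  have sh : ∀ u v w, Integrable
      (fun x => |score (pol.logLik N) θ x w * hess (pol.logLik N) θ x u v|) (trajLaw mdp pol θ) :=
    fun u v w => Integrable.of_bound ((hsm w).mul (hhm u v)).abs.aestronglyMeasurable
      (N * Mg * ‖w‖ * (N * Mh * ‖u‖ * ‖v‖))
      (Filter.Eventually.of_forall fun x => by
        rw [Real.norm_eq_abs, abs_abs, abs_mul]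
        exact mul_le_mul (f.abs_score_le θ w x) (f.abs_hess_le θ u v x) (abs_nonneg _)
          (by positivity))
  have ss : Integrable
      (fun x => |score (pol.logLik N) θ x u * score (pol.logLik N) θ x v|) (trajLaw mdp pol θ) :=
    Integrable.of_bound ((hsm u).mul (hsm v)).abs.aestronglyMeasurable
      (N * Mg * ‖u‖ * (N * Mg * ‖v‖))
      (Filter.Eventually.of_forall fun x => by
        rw [Real.norm_eq_abs, abs_abs, abs_mul]
        exact mul_le_mul (f.abs_score_le θ u x) (f.abs_score_le θ v x) (abs_nonneg _)
          (by positivity))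
  have hpt : ∀ x, |LikelihoodFamily.thirdTerm (pol.logLik N) θ x u v w|
      ≤ (|score (pol.logLik N) θ x w * hess (pol.logLik N) θ x u v|
        + |score (pol.logLik N) θ x u * hess (pol.logLik N) θ x w v|
        + |score (pol.logLik N) θ x v * hess (pol.logLik N) θ x w u|)
        + N * Mg * ‖w‖ * |score (pol.logLik N) θ x u * score (pol.logLik N) θ x v| := fun x => by
    rw [LikelihoodFamily.thirdTerm]
    refine (abs_add_le _ _).trans (add_le_add ((abs_add_le _ _).trans
      (add_le_add (abs_add_le _ _) le_rfl)) ?_)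
    rw [abs_mul (score (pol.logLik N) θ x w)]
    exact mul_le_mul_of_nonneg_right (f.abs_score_le θ w x) (abs_nonneg _)
  -- For `N ≤ 1` the moment bounds lose too much in the constants, whereas the pointwise bounds are
  -- sharp enough; from `N = 2` on, orthogonality wins.
  rcases Nat.lt_or_ge N 2 with hN | hN
  · have hN1 : (N : ℝ) ≤ 1 := by exact_mod_cast Nat.lt_succ_iff.1 hN
    have hN0 : (0 : ℝ) ≤ N := Nat.cast_nonneg N
    have hcub : (N : ℝ) ^ 3 ≤ N ^ 2 := pow_le_pow_of_le_one hN0 hN1 (by norm_num)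
    have hsq : (N : ℝ) ^ 2 ≤ N := by nlinarith
    have hb : ∀ x, |LikelihoodFamily.thirdTerm (pol.logLik N) θ x u v w|
        ≤ (3 * N ^ 2 * Mg * Mh + N ^ 3 * Mg ^ 3) * ‖u‖ * ‖v‖ * ‖w‖ := fun x => by
      have h3 : ∀ u v w, |score (pol.logLik N) θ x w * hess (pol.logLik N) θ x u v|
          ≤ N * Mg * ‖w‖ * (N * Mh * ‖u‖ * ‖v‖) := fun u v w => by
        rw [abs_mul]
        exact mul_le_mul (f.abs_score_le θ w x) (f.abs_hess_le θ u v x) (abs_nonneg _)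
          (by positivity)
      have h4 : |score (pol.logLik N) θ x u * score (pol.logLik N) θ x v|
          ≤ N * Mg * ‖u‖ * (N * Mg * ‖v‖) := by
        rw [abs_mul]
        exact mul_le_mul (f.abs_score_le θ u x) (f.abs_score_le θ v x) (abs_nonneg _)
          (by positivity)
      have h5 := mul_le_mul_of_nonneg_left h4 (by positivity : 0 ≤ N * Mg * ‖w‖)
      refine (hpt x).trans ?_
      have := add_le_add (add_le_add (add_le_add (h3 u v w) (h3 w v u)) (h3 w u v)) h5
      refine this.trans_eq ?_
      ring
    have : ∫ x, |LikelihoodFamily.thirdTerm (pol.logLik N) θ x u v w| ∂(trajLaw mdp pol θ)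
        ≤ ∫ x, (3 * N ^ 2 * Mg * Mh + N ^ 3 * Mg ^ 3) * ‖u‖ * ‖v‖ * ‖w‖ ∂(trajLaw mdp pol θ) :=
      integral_mono_of_nonneg (Filter.Eventually.of_forall fun x => abs_nonneg _)
        (integrable_const _) (Filter.Eventually.of_forall hb)
    simp only [integral_const, probReal_univ, smul_eq_mul, one_mul] at this
    refine this.trans ?_
    have h6 : (N : ℝ) ^ 3 ≤ 4 * N ^ 2 := by nlinarith [sq_nonneg (N : ℝ)]
    gcongr
  · have hint : ∫ x, |LikelihoodFamily.thirdTerm (pol.logLik N) θ x u v w| ∂(trajLaw mdp pol θ)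
        ≤ ∫ x, ((|score (pol.logLik N) θ x w * hess (pol.logLik N) θ x u v|
        + |score (pol.logLik N) θ x u * hess (pol.logLik N) θ x w v|
        + |score (pol.logLik N) θ x v * hess (pol.logLik N) θ x w u|)
        + N * Mg * ‖w‖ * |score (pol.logLik N) θ x u * score (pol.logLik N) θ x v|)
          ∂(trajLaw mdp pol θ) :=
      integral_mono_of_nonneg (Filter.Eventually.of_forall fun x => abs_nonneg _)
        ((((sh u v w).fun_add (sh w v u)).fun_add (sh w u v)).fun_add (ss.const_mul _))
        (Filter.Eventually.of_forall hpt)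
    rw [integral_add (((sh u v w).fun_add (sh w v u)).fun_add (sh w u v)) (ss.const_mul _),
      integral_add ((sh u v w).fun_add (sh w v u)) (sh w u v), integral_add (sh u v w) (sh w v u),
      integral_const_mul] at hint
    have b1 := h.integral_abs_score_mul_hess_le mdp N θ u v w
    have b2 := h.integral_abs_score_mul_hess_le mdp N θ w v u
    have b3 := h.integral_abs_score_mul_hess_le mdp N θ w u v
    have b4 := mul_le_mul_of_nonneg_left (h.integral_abs_score_mul_score_le mdp N θ u v)
      (by positivity : 0 ≤ N * Mg * ‖w‖)
    have hs : √(N : ℝ) * √N = N := Real.mul_self_sqrt (Nat.cast_nonneg N)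
    -- With `x = √N`, the estimate `3 x + 3/2 ≤ 3 x²` holds from `x = 1.4` on. Together with the
    -- `N²` from the product of three scores it gives the coefficient `4 N²`.
    have hs1 : (1.4 : ℝ) ≤ √N := by
      refine Real.le_sqrt_of_sq_le ?_
      have : (2 : ℝ) ≤ N := by exact_mod_cast hN
      norm_num; linarith
    have key : 3 * (√N * N) + 3 / 2 * N ≤ 3 * (N : ℝ) ^ 2 := by
      have h7 : 3 * √(N : ℝ) + 3 / 2 ≤ 3 * N := by nlinarith
      nlinarith [(Nat.cast_nonneg N : (0 : ℝ) ≤ N)]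
    have hX : 0 ≤ Mg ^ 3 * ‖u‖ * ‖v‖ * ‖w‖ := by positivity
    nlinarith [mul_le_mul_of_nonneg_right key hX]

end Moments

/-! ### Termwise differentiation of series -/

section Series

lemma norm_tsum_sub_tsum_le {F : Type*} [NormedAddCommGroup F] [CompleteSpace F] {f g : ℕ → F}
    {u v : ℕ → ℝ} {c : ℝ} (hf : ∀ n, ‖f n‖ ≤ u n) (hg : ∀ n, ‖g n‖ ≤ u n)
    (hfg : ∀ n, ‖f n - g n‖ ≤ v n * c) (hu : Summable u) (hv : Summable v) :
    ‖∑' n, f n - ∑' n, g n‖ ≤ (∑' n, v n) * c := by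
  rw [← (hu.of_norm_bounded hf).tsum_sub (hu.of_norm_bounded hg), ← tsum_mul_right]
  exact tsum_of_norm_bounded (hv.mul_right _).hasSum hfg

lemma norm_sum_range_sub_le {F : Type*} [SeminormedAddCommGroup F] {f g : ℕ → F} {c : ℝ} (N : ℕ)
    (h : ∀ n, ‖f n - g n‖ ≤ c) :
    ‖∑ n ∈ Finset.range N, f n - ∑ n ∈ Finset.range N, g n‖ ≤ N * c := by
  rw [← Finset.sum_sub_distrib]
  refine (norm_sum_le _ _).trans ?_
  simpa using Finset.sum_le_card_nsmul (Finset.range N) (fun k => ‖f k - g k‖) c (fun k _ => h k)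

lemma norm_smul_sub_smul_le {F : Type*} [SeminormedAddCommGroup F] [NormedSpace ℝ F] {f g : F}
    {a c : ℝ} (ha : 0 ≤ a) (h : ‖f - g‖ ≤ c) : ‖a • f - a • g‖ ≤ a * c := by
  rw [← smul_sub, norm_smul, Real.norm_of_nonneg ha]
  exact mul_le_mul_of_nonneg_left h ha

variable {E : Type*} [NormedAddCommGroup E] [NormedSpace ℝ E]

lemma differentiable_fderiv_of_contDiff {f : E → ℝ} (hf : ContDiff ℝ 2 f) :
    Differentiable ℝ (fderiv ℝ f) :=
  (hf.fderiv_right (m := 1) (by norm_num)).differentiable (by norm_num)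

/-- Termwise differentiation, twice, of a series of functions. -/
lemma fderiv_fderiv_tsum {f : ℕ → E → ℝ} (hf : ∀ n, ContDiff ℝ 2 (f n)) {u₀ u₁ u₂ : ℕ → ℝ}
    (h₀ : ∀ n x, |f n x| ≤ u₀ n) (h₁ : ∀ n x, ‖fderiv ℝ (f n) x‖ ≤ u₁ n)
    (h₂ : ∀ n x, ‖fderiv ℝ (fderiv ℝ (f n)) x‖ ≤ u₂ n)
    (s₀ : Summable u₀) (s₁ : Summable u₁) (s₂ : Summable u₂) :
    (∀ x, HasFDerivAt (fun y => ∑' n, f n y) (∑' n, fderiv ℝ (f n) x) x) ∧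
    (∀ x, HasFDerivAt (fderiv ℝ (fun y => ∑' n, f n y))
      (∑' n, fderiv ℝ (fderiv ℝ (f n)) x) x) := by
  have d1 : ∀ x, HasFDerivAt (fun y => ∑' n, f n y) (∑' n, fderiv ℝ (f n) x) x := fun x =>
    hasFDerivAt_tsum s₁ (fun n x => ((hf n).differentiable (by norm_num) x).hasFDerivAt) h₁
      (x₀ := 0) (Summable.of_norm_bounded s₀ fun n => h₀ n 0) x
  refine ⟨d1, fun x => ?_⟩
  have e : fderiv ℝ (fun y => ∑' n, f n y) = fun x => ∑' n, fderiv ℝ (f n) x := by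
    ext1 x; exact (d1 x).fderiv
  rw [e]
  exact hasFDerivAt_tsum s₂
    (fun n x => (differentiable_fderiv_of_contDiff (hf n) x).hasFDerivAt) h₂
      (x₀ := 0) (Summable.of_norm_bounded s₁ fun n => h₁ n 0) x

lemma norm_fderiv_fderiv_tsum_sub_le {f : ℕ → E → ℝ} (hf : ∀ n, ContDiff ℝ 2 (f n))
    {u₀ u₁ u₂ u₃ : ℕ → ℝ}
    (h₀ : ∀ n x, |f n x| ≤ u₀ n) (h₁ : ∀ n x, ‖fderiv ℝ (f n) x‖ ≤ u₁ n)
    (h₂ : ∀ n x, ‖fderiv ℝ (fderiv ℝ (f n)) x‖ ≤ u₂ n)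
    (h₃ : ∀ n x y, ‖fderiv ℝ (fderiv ℝ (f n)) x - fderiv ℝ (fderiv ℝ (f n)) y‖ ≤ u₃ n * ‖x - y‖)
    (s₀ : Summable u₀) (s₁ : Summable u₁) (s₂ : Summable u₂) (s₃ : Summable u₃) (x y : E) :
    ‖fderiv ℝ (fderiv ℝ (fun y => ∑' n, f n y)) x - fderiv ℝ (fderiv ℝ (fun y => ∑' n, f n y)) y‖
      ≤ (∑' n, u₃ n) * ‖x - y‖ := by
  obtain ⟨-, d2⟩ := fderiv_fderiv_tsum hf h₀ h₁ h₂ s₀ s₁ s₂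
  rw [(d2 x).fderiv, (d2 y).fderiv]
  exact norm_tsum_sub_tsum_le (F := E →L[ℝ] E →L[ℝ] ℝ) (fun n => h₂ n x) (fun n => h₂ n y)
    (fun n => h₃ n x y) s₂ s₃

end Series

/-! ### Derivatives of the expected reward at a fixed time -/

section Expectation

variable {S A : Type*} [MeasurableSpace S] [MeasurableSpace A] {d : ℕ} {pol : Policy S A d}
  {Mg Mh : ℝ}

/-- The expected reward at time `t`. -/
noncomputable def expReward (mdp : MDP S A) (pol : Policy S A d) (t : ℕ) (θ : Param d) : ℝ :=
  ∫ x, mdp.r (x t).1 (x t).2 ∂(trajLaw mdp pol θ)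

lemma measurable_reward_past (mdp : MDP S A) {t N : ℕ} (h : t < N) :
    Measurable[past (S × A) N] (fun x : ℕ → S × A => mdp.r (x t).1 (x t).2) :=
  mdp.measurable_r.comp (measurable_eval_past _ h)

lemma measurable_reward (mdp : MDP S A) (t : ℕ) :
    Measurable (fun x : ℕ → S × A => mdp.r (x t).1 (x t).2) :=
  mdp.measurable_r.comp (measurable_pi_apply t)

lemma abs_reward_le (mdp : MDP S A) (t : ℕ) (x : ℕ → S × A) :
    |mdp.r (x t).1 (x t).2| ≤ mdp.rmax := mdp.abs_r_le _ _

lemma abs_expReward_le (mdp : MDP S A) (pol : Policy S A d) (t : ℕ) (θ : Param d) :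
    |expReward mdp pol t θ| ≤ mdp.rmax := by
  have := norm_integral_le_of_norm_le_const (μ := trajLaw mdp pol θ)
    (f := fun x => mdp.r (x t).1 (x t).2) (Filter.Eventually.of_forall (abs_reward_le mdp t))
  simpa [expReward] using this

namespace BoundedScore

lemma contDiff_expReward (h : BoundedScore pol Mg Mh) (mdp : MDP S A) (t : ℕ) :
    ContDiff ℝ 2 (expReward mdp pol t) :=
  (h.likelihoodFamily_past mdp (t + 1)).contDiff_expectation
    (measurable_reward_past mdp (Nat.lt_succ_self t)) (abs_reward_le mdp t)

lemma fderiv_expReward (h : BoundedScore pol Mg Mh) (mdp : MDP S A) (t : ℕ) (θ u : Param d) :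
    fderiv ℝ (expReward mdp pol t) θ u
      = ∫ x, score (pol.logLik (t + 1)) θ x u * mdp.r (x t).1 (x t).2 ∂(trajLaw mdp pol θ) :=
  (h.likelihoodFamily_past mdp (t + 1)).fderiv_expectation
    (measurable_reward_past mdp (Nat.lt_succ_self t)) (abs_reward_le mdp t) θ u

lemma norm_fderiv_expReward_le (h : BoundedScore pol Mg Mh) (mdp : MDP S A) (t : ℕ)
    (θ : Param d) : ‖fderiv ℝ (expReward mdp pol t) θ‖ ≤ mdp.rmax * Mg * √((t : ℝ) + 1) := by
  have f := h.likelihoodFamily_past mdp (t + 1)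
  have h1 := h.Mg_pos.le
  have h2 := mdp.rmax_pos.le
  refine ContinuousLinearMap.opNorm_le_bound _ (by positivity) fun u => ?_
  rw [h.fderiv_expReward]
  refine (abs_integral_mul_le_of_abs_le _ ((f.measurable_score θ u).mono f.le le_rfl)
    (f.abs_score_le θ u) (abs_reward_le mdp t)).trans ?_
  have := mul_le_mul_of_nonneg_right (h.integral_abs_score_le mdp (t + 1) θ u) h2
  refine this.trans_eq ?_
  push_cast; ring

lemma norm_fderiv_fderiv_expReward_le (h : BoundedScore pol Mg Mh) (mdp : MDP S A) (t : ℕ)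
    (θ : Param d) : ‖fderiv ℝ (fderiv ℝ (expReward mdp pol t)) θ‖
      ≤ mdp.rmax * (Mg ^ 2 + Mh) * ((t : ℝ) + 1) := by
  have f := h.likelihoodFamily_past mdp (t + 1)
  have h1 := h.Mg_pos.le
  have h2 := mdp.rmax_pos.le
  have h3 := h.Mh_pos.le
  refine ContinuousLinearMap.opNorm_le_bound₂ _ (by positivity) fun u v => ?_
  have e := f.fderiv_fderiv_expectation (measurable_reward_past mdp (Nat.lt_succ_self t))
    (abs_reward_le mdp t) θ u v
  have e' : fderiv ℝ (fderiv ℝ (expReward mdp pol t)) θ u v = _ := e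
  rw [e']
  have hm := (((f.measurable_hess θ u v).add ((f.measurable_score θ u).mul
    (f.measurable_score θ v))).mono f.le le_rfl)
  have hss : Measurable fun x => score (pol.logLik (t + 1)) θ x u
      * score (pol.logLik (t + 1)) θ x v :=
    ((f.measurable_score θ u).mul (f.measurable_score θ v)).mono f.le le_rfl
  set N : ℝ := ((t + 1 : ℕ) : ℝ) with hN
  have hN0 : 0 ≤ N := Nat.cast_nonneg _
  have hssb : ∀ x, |score (pol.logLik (t + 1)) θ x u * score (pol.logLik (t + 1)) θ x v|
      ≤ N * Mg * ‖u‖ * (N * Mg * ‖v‖) := fun x => by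
    rw [abs_mul]
    exact mul_le_mul (f.abs_score_le θ u x) (f.abs_score_le θ v x) (abs_nonneg _) (by positivity)
  refine (abs_integral_mul_le_of_abs_le _ hm (a := N * Mh * ‖u‖ * ‖v‖ + N * Mg * ‖u‖ * (N * Mg * ‖v‖))
    (fun x => (abs_add_le _ _).trans (add_le_add (f.abs_hess_le θ u v x) (hssb x)))
    (abs_reward_le mdp t)).trans ?_
  have hi : ∫ x, |hess (pol.logLik (t + 1)) θ x u v
      + score (pol.logLik (t + 1)) θ x u * score (pol.logLik (t + 1)) θ x v| ∂(trajLaw mdp pol θ)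
      ≤ ∫ x, (N * Mh * ‖u‖ * ‖v‖ + |score (pol.logLik (t + 1)) θ x u
        * score (pol.logLik (t + 1)) θ x v|) ∂(trajLaw mdp pol θ) := by
    refine integral_mono_of_nonneg (Filter.Eventually.of_forall fun x => abs_nonneg _)
      ((integrable_const _).add (Integrable.of_bound hss.abs.aestronglyMeasurable
        (N * Mg * ‖u‖ * (N * Mg * ‖v‖))
        (Filter.Eventually.of_forall fun x => by rw [Real.norm_eq_abs, abs_abs]; exact hssb x)))
      (Filter.Eventually.of_forall fun x =>
        (abs_add_le _ _).trans (add_le_add (f.abs_hess_le θ u v x) le_rfl))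
  rw [integral_add (integrable_const _) (Integrable.of_bound hss.abs.aestronglyMeasurable
        (N * Mg * ‖u‖ * (N * Mg * ‖v‖))
        (Filter.Eventually.of_forall fun x => by rw [Real.norm_eq_abs, abs_abs]; exact hssb x))]
    at hi
  have hb := h.integral_abs_score_mul_score_le mdp (t + 1) θ u v
  simp only [integral_const, probReal_univ, smul_eq_mul, one_mul] at hi
  have hfin : ∫ x, |hess (pol.logLik (t + 1)) θ x u v
      + score (pol.logLik (t + 1)) θ x u * score (pol.logLik (t + 1)) θ x v| ∂(trajLaw mdp pol θ)
      ≤ N * Mh * ‖u‖ * ‖v‖ + N * Mg ^ 2 * ‖u‖ * ‖v‖ := by linarith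
  refine (mul_le_mul_of_nonneg_right hfin h2).trans_eq ?_
  rw [hN]; push_cast; ring

lemma norm_hess_logLik_sub_le {l₂ : ℝ} (h : BoundedScore pol Mg Mh)
    (hl : LipschitzScoreHessian pol l₂) (N : ℕ) (x : ℕ → S × A) (θ θ' : Param d) :
    ‖hess (pol.logLik N) θ x - hess (pol.logLik N) θ' x‖ ≤ N * l₂ * ‖θ - θ'‖ := by
  rw [h.hess_logLik, h.hess_logLik, mul_assoc]
  exact norm_sum_range_sub_le (F := Param d →L[ℝ] Param d →L[ℝ] ℝ) N
    (fun k => hl.lipschitz (x k).1 (x k).2 θ θ')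

/-- The frozen-Hessian estimate for a likelihood with `t + 1` factors: the factors contribute `l₂`
each, the differentiable part contributes the mean of `thirdTerm`. -/
lemma norm_fderiv_fderiv_expReward_sub_le {l₂ : ℝ} (h : BoundedScore pol Mg Mh)
    (hl : LipschitzScoreHessian pol l₂) (mdp : MDP S A) (t : ℕ) (θ θ' : Param d) :
    ‖fderiv ℝ (fderiv ℝ (expReward mdp pol t)) θ - fderiv ℝ (fderiv ℝ (expReward mdp pol t)) θ'‖
      ≤ (mdp.rmax * (l₂ + 3 * Mg * Mh) * ((t : ℝ) + 1)
        + 4 * mdp.rmax * Mg ^ 3 * ((t : ℝ) + 1) ^ 2) * ‖θ - θ'‖ := by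
  have f := h.likelihoodFamily_past mdp (t + 1)
  have h1 := h.Mg_pos.le
  have h2 := mdp.rmax_pos.le
  have h3 := h.Mh_pos.le
  have h4 := hl.l₂_pos.le
  refine ContinuousLinearMap.opNorm_le_bound₂ _ (by positivity) fun u v => ?_
  have hK : ∀ θ w, |∫ x, LikelihoodFamily.thirdTerm (pol.logLik (t + 1)) θ x u v w
      * mdp.r (x t).1 (x t).2 ∂(trajLaw mdp pol θ)|
      ≤ (3 * ((t + 1 : ℕ) : ℝ) * Mg * Mh + 4 * ((t + 1 : ℕ) : ℝ) ^ 2 * Mg ^ 3) * ‖u‖ * ‖v‖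
        * mdp.rmax * ‖w‖ := fun θ w => by
    have hm : Measurable fun x => LikelihoodFamily.thirdTerm (pol.logLik (t + 1)) θ x u v w := by
      have hs := fun u => (f.measurable_score θ u).mono f.le le_rfl
      have hh := fun u v => (f.measurable_hess θ u v).mono f.le le_rfl
      exact ((((hs w).mul (hh u v)).add ((hs u).mul (hh w v))).add ((hs v).mul (hh w u))).add
        ((hs w).mul ((hs u).mul (hs v)))
    set N : ℝ := ((t + 1 : ℕ) : ℝ) with hN
    have hN0 : 0 ≤ N := Nat.cast_nonneg _
    have hb : ∀ x, |LikelihoodFamily.thirdTerm (pol.logLik (t + 1)) θ x u v w|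
        ≤ N * Mg * ‖w‖ * (N * Mh * ‖u‖ * ‖v‖) + N * Mg * ‖u‖ * (N * Mh * ‖w‖ * ‖v‖)
          + N * Mg * ‖v‖ * (N * Mh * ‖w‖ * ‖u‖)
          + N * Mg * ‖w‖ * (N * Mg * ‖u‖ * (N * Mg * ‖v‖)) := fun x => by
      have b := fun u => f.abs_score_le θ u x
      have c := fun u v => f.abs_hess_le θ u v x
      rw [LikelihoodFamily.thirdTerm]
      refine (abs_add_le _ _).trans (add_le_add ((abs_add_le _ _).trans
        (add_le_add ((abs_add_le _ _).trans (add_le_add ?_ ?_)) ?_)) ?_)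
      · rw [abs_mul]; exact mul_le_mul (b w) (c u v) (abs_nonneg _) (by positivity)
      · rw [abs_mul]; exact mul_le_mul (b u) (c w v) (abs_nonneg _) (by positivity)
      · rw [abs_mul]; exact mul_le_mul (b v) (c w u) (abs_nonneg _) (by positivity)
      · rw [abs_mul, abs_mul]
        exact mul_le_mul (b w) (mul_le_mul (b u) (b v) (abs_nonneg _) (by positivity))
          (by positivity) (by positivity)
    refine (abs_integral_mul_le_of_abs_le _ hm hb (abs_reward_le mdp t)).trans ?_
    refine (mul_le_mul_of_nonneg_right (h.integral_abs_thirdTerm_le mdp (t + 1) θ u v w)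
      h2).trans_eq ?_
    ring
  have := f.abs_fderiv_fderiv_expectation_sub_le (measurable_reward_past mdp (Nat.lt_succ_self t))
    (abs_reward_le mdp t) u v (fun x θ θ' => h.norm_hess_logLik_sub_le hl (t + 1) x θ θ') hK θ θ'
  rw [sub_apply, sub_apply]
  refine le_trans (le_of_eq rfl) (this.trans_eq ?_)
  push_cast; ring

end BoundedScore

/-! ### The discounted return: smoothness and truncation -/

section Return

variable (mdp : MDP S A)

lemma hasSum_geom : HasSum (fun n : ℕ => mdp.γ ^ n) (1 / (1 - mdp.γ)) := by
  rw [one_div]; exact hasSum_geometric_of_lt_one mdp.γ_pos.le mdp.γ_lt_one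

lemma hasSum_geom_mul : HasSum (fun n : ℕ => mdp.γ ^ n * ((n : ℝ) + 1)) (1 / (1 - mdp.γ) ^ 2) := by
  have := hasSum_choose_mul_geometric_of_norm_lt_one 1 (r := mdp.γ)
    (by rw [Real.norm_of_nonneg mdp.γ_pos.le]; exact mdp.γ_lt_one)
  convert! this using 2 with n
  simp; ring

/-- Uses `(n + 1)² = 2 · C(n + 2, 2) - (n + 1)` and the binomial series. -/
lemma hasSum_geom_mul_sq : HasSum (fun n : ℕ => mdp.γ ^ n * ((n : ℝ) + 1) ^ 2)
    ((1 + mdp.γ) / (1 - mdp.γ) ^ 3) := by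
  have h0 : 1 - mdp.γ ≠ 0 := (sub_pos.2 mdp.γ_lt_one).ne'
  have := (hasSum_choose_mul_geometric_of_norm_lt_one 2 (r := mdp.γ)
    (by rw [Real.norm_of_nonneg mdp.γ_pos.le]; exact mdp.γ_lt_one)).mul_left 2
  convert! this.sub (hasSum_geom_mul mdp) using 1
  · ext n
    have h1 : (((n + 2).choose 2 : ℕ) : ℝ) = ((n : ℝ) + 2) * (n + 1) / 2 := by
      rw [Nat.cast_choose_two]; push_cast; ring
    rw [h1]; ring
  · field_simp; ring

lemma J_eq_tsum (pol : Policy S A d) (θ : Param d) :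
    J mdp pol θ = ∑' t, mdp.γ ^ t * expReward mdp pol t θ := by
  have hγ := mdp.γ_pos.le
  have hr := mdp.rmax_pos.le
  rw [J, ← integral_tsum_of_summable_integral_norm]
  · refine tsum_congr fun t => ?_
    rw [integral_const_mul]; rfl
  · intro t
    exact (Integrable.of_bound (measurable_reward mdp t).aestronglyMeasurable mdp.rmax
      (Filter.Eventually.of_forall (abs_reward_le mdp t))).const_mul _
  · refine Summable.of_nonneg_of_le (fun t => integral_nonneg fun x => norm_nonneg _) (fun t => ?_)
      ((hasSum_geom mdp).summable.mul_right mdp.rmax)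
    have : ∫ x, ‖mdp.γ ^ t * mdp.r (x t).1 (x t).2‖ ∂(trajLaw mdp pol θ)
        ≤ ∫ x : ℕ → S × A, mdp.γ ^ t * mdp.rmax ∂(trajLaw mdp pol θ) := by
      refine integral_mono_of_nonneg (Filter.Eventually.of_forall fun x => norm_nonneg _)
        (integrable_const _) (Filter.Eventually.of_forall fun x => ?_)
      simp only [norm_mul, norm_pow, Real.norm_of_nonneg hγ]
      exact mul_le_mul_of_nonneg_left (abs_reward_le mdp t x) (by positivity)
    simpa using this

lemma abs_J_le (pol : Policy S A d) (θ : Param d) : |J mdp pol θ| ≤ mdp.rmax / (1 - mdp.γ) := by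
  rw [J_eq_tsum]
  have := tsum_of_norm_bounded (f := fun t => mdp.γ ^ t * expReward mdp pol t θ)
    ((hasSum_geom mdp).mul_right mdp.rmax) (fun t => by
      rw [norm_mul, norm_pow, Real.norm_of_nonneg mdp.γ_pos.le]
      exact mul_le_mul_of_nonneg_left (abs_expReward_le mdp pol t θ)
        (pow_nonneg mdp.γ_pos.le t))
  refine this.trans_eq ?_
  ring

variable {mdp}

/-- The discounted expected reward at time `t`. -/
noncomputable def discReward (mdp : MDP S A) (pol : Policy S A d) (t : ℕ) (θ : Param d) : ℝ :=
  mdp.γ ^ t * expReward mdp pol t θ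

lemma J_eq (mdp : MDP S A) (pol : Policy S A d) :
    J mdp pol = fun θ => ∑' t, discReward mdp pol t θ := by
  ext θ; exact J_eq_tsum mdp pol θ

lemma abs_discReward_le (mdp : MDP S A) (pol : Policy S A d) (t : ℕ) (θ : Param d) :
    |discReward mdp pol t θ| ≤ mdp.γ ^ t * mdp.rmax := by
  rw [discReward, abs_mul, abs_of_nonneg (pow_nonneg mdp.γ_pos.le t)]
  exact mul_le_mul_of_nonneg_left (abs_expReward_le mdp pol t θ) (pow_nonneg mdp.γ_pos.le t)

namespace BoundedScore

lemma contDiff_discReward (h : BoundedScore pol Mg Mh) (mdp : MDP S A) (t : ℕ) :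
    ContDiff ℝ 2 (discReward mdp pol t) := contDiff_const.mul (h.contDiff_expReward mdp t)

lemma fderiv_discReward (h : BoundedScore pol Mg Mh) (mdp : MDP S A) (t : ℕ) :
    fderiv ℝ (discReward mdp pol t) = fun θ => mdp.γ ^ t • fderiv ℝ (expReward mdp pol t) θ := by
  ext1 θ
  exact fderiv_const_mul ((h.contDiff_expReward mdp t).differentiable (by norm_num) θ) _

lemma fderiv_fderiv_discReward (h : BoundedScore pol Mg Mh) (mdp : MDP S A) (t : ℕ) (θ : Param d) :
    fderiv ℝ (fderiv ℝ (discReward mdp pol t)) θ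
      = mdp.γ ^ t • fderiv ℝ (fderiv ℝ (expReward mdp pol t)) θ := by
  rw [h.fderiv_discReward]
  exact fderiv_fun_const_smul (differentiable_fderiv_of_contDiff (h.contDiff_expReward mdp t) θ) _

lemma norm_fderiv_discReward_le (h : BoundedScore pol Mg Mh) (mdp : MDP S A) (t : ℕ)
    (θ : Param d) :
    ‖fderiv ℝ (discReward mdp pol t) θ‖ ≤ mdp.γ ^ t * √((t : ℝ) + 1) * (mdp.rmax * Mg) := by
  rw [h.fderiv_discReward, norm_smul, Real.norm_of_nonneg (pow_nonneg mdp.γ_pos.le t), mul_assoc]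
  refine mul_le_mul_of_nonneg_left ?_ (pow_nonneg mdp.γ_pos.le t)
  refine (h.norm_fderiv_expReward_le mdp t θ).trans_eq (by ring)

/-- Weaker than the bound with the square root, but with an explicit sum; it serves where only
summability or a crude bound matters. -/
lemma norm_fderiv_discReward_le' (h : BoundedScore pol Mg Mh) (mdp : MDP S A) (t : ℕ)
    (θ : Param d) :
    ‖fderiv ℝ (discReward mdp pol t) θ‖ ≤ mdp.γ ^ t * ((t : ℝ) + 1) * (mdp.rmax * Mg) := by
  have h1 := h.Mg_pos.le
  have h2 := mdp.rmax_pos.le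
  have h3 := pow_nonneg mdp.γ_pos.le t
  refine (h.norm_fderiv_discReward_le mdp t θ).trans ?_
  gcongr
  refine Real.sqrt_le_iff.2 ⟨by positivity, ?_⟩
  nlinarith [(Nat.cast_nonneg t : (0 : ℝ) ≤ t)]

lemma norm_fderiv_fderiv_discReward_le (h : BoundedScore pol Mg Mh) (mdp : MDP S A) (t : ℕ)
    (θ : Param d) : ‖fderiv ℝ (fderiv ℝ (discReward mdp pol t)) θ‖
      ≤ mdp.γ ^ t * ((t : ℝ) + 1) * (mdp.rmax * (Mg ^ 2 + Mh)) := by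
  rw [h.fderiv_fderiv_discReward]
  refine (ContinuousLinearMap.opNorm_smul_le _ _).trans ?_
  rw [Real.norm_of_nonneg (pow_nonneg mdp.γ_pos.le t), mul_assoc]
  refine mul_le_mul_of_nonneg_left ?_ (pow_nonneg mdp.γ_pos.le t)
  refine (h.norm_fderiv_fderiv_expReward_le mdp t θ).trans_eq (by ring)

lemma hasFDerivAt_J (h : BoundedScore pol Mg Mh) (mdp : MDP S A) :
    (∀ θ, HasFDerivAt (J mdp pol) (∑' t, fderiv ℝ (discReward mdp pol t) θ) θ) ∧
    (∀ θ, HasFDerivAt (fderiv ℝ (J mdp pol))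
      (∑' t, fderiv ℝ (fderiv ℝ (discReward mdp pol t)) θ) θ) := by
  rw [J_eq]
  exact fderiv_fderiv_tsum (h.contDiff_discReward mdp) (abs_discReward_le mdp pol)
    (h.norm_fderiv_discReward_le' mdp) (h.norm_fderiv_fderiv_discReward_le mdp)
    ((hasSum_geom mdp).summable.mul_right _) ((hasSum_geom_mul mdp).summable.mul_right _)
    ((hasSum_geom_mul mdp).summable.mul_right _)

/-- `J` is `L_g`-smooth. -/
lemma norm_fderiv_fderiv_J_le (h : BoundedScore pol Mg Mh) (mdp : MDP S A) (θ : Param d) :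
    ‖fderiv ℝ (fderiv ℝ (J mdp pol)) θ‖ ≤ Lg mdp Mg Mh := by
  rw [((h.hasFDerivAt_J mdp).2 θ).fderiv]
  refine le_of_le_of_eq (tsum_of_norm_bounded (E := Param d →L[ℝ] Param d →L[ℝ] ℝ)
    ((hasSum_geom_mul mdp).mul_right _) fun t => h.norm_fderiv_fderiv_discReward_le mdp t θ) ?_
  rw [Lg]; ring

/-- The Hessian of `J` is Lipschitz with the explicit constant `hessConst`. -/
theorem hessianLipschitz_J {l₂ : ℝ} (h : BoundedScore pol Mg Mh)
    (hl : LipschitzScoreHessian pol l₂) (mdp : MDP S A) :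
    HessianLipschitz (J mdp pol) (hessConst mdp Mg Mh l₂) := by
  have hlip : ∀ θ θ', ‖fderiv ℝ (fderiv ℝ (J mdp pol)) θ - fderiv ℝ (fderiv ℝ (J mdp pol)) θ'‖
      ≤ hessConst mdp Mg Mh l₂ * ‖θ - θ'‖ := fun θ θ' => by
    have s := ((hasSum_geom_mul mdp).mul_right (mdp.rmax * (l₂ + 3 * Mg * Mh))).add
      ((hasSum_geom_mul_sq mdp).mul_right (4 * mdp.rmax * Mg ^ 3))
    rw [J_eq]
    refine (norm_fderiv_fderiv_tsum_sub_le (h.contDiff_discReward mdp) (abs_discReward_le mdp pol)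
      (h.norm_fderiv_discReward_le' mdp) (h.norm_fderiv_fderiv_discReward_le mdp)
      (fun t θ θ' => ?_)
      ((hasSum_geom mdp).summable.mul_right _) ((hasSum_geom_mul mdp).summable.mul_right _)
      ((hasSum_geom_mul mdp).summable.mul_right _) s.summable θ θ').trans_eq ?_
    · rw [h.fderiv_fderiv_discReward, h.fderiv_fderiv_discReward]
      refine le_of_le_of_eq (norm_smul_sub_smul_le (F := Param d →L[ℝ] Param d →L[ℝ] ℝ)
        (pow_nonneg mdp.γ_pos.le t) (h.norm_fderiv_fderiv_expReward_sub_le hl mdp t θ θ')) ?_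
      ring
    · rw [s.tsum_eq, hessConst]; ring
  refine ⟨?_, hlip⟩
  have h12 : (2 : WithTop ℕ∞) = 1 + 1 := by norm_num
  rw [h12, contDiff_succ_iff_fderiv]
  refine ⟨fun θ => ((h.hasFDerivAt_J mdp).1 θ).differentiableAt, by simp, ?_⟩
  rw [contDiff_one_iff_fderiv]
  refine ⟨fun θ => ((h.hasFDerivAt_J mdp).2 θ).differentiableAt, ?_⟩
  exact (LipschitzWith.of_dist_le' (K := hessConst mdp Mg Mh l₂) fun θ θ' => by
    rw [dist_eq_norm, dist_eq_norm]; exact hlip θ θ').continuous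

lemma norm_fderiv_J_le (h : BoundedScore pol Mg Mh) (mdp : MDP S A) (θ : Param d) :
    ‖fderiv ℝ (J mdp pol) θ‖ ≤ mdp.rmax * Mg / (1 - mdp.γ) ^ 2 := by
  rw [((h.hasFDerivAt_J mdp).1 θ).fderiv]
  refine (tsum_of_norm_bounded ((hasSum_geom_mul mdp).mul_right _)
    fun t => h.norm_fderiv_discReward_le' mdp t θ).trans_eq ?_
  ring

/-- The bias of the gradient of the return truncated at the horizon `H`. -/
lemma norm_fderiv_J_sub_le (h : BoundedScore pol Mg Mh) (mdp : MDP S A) (H : ℕ) (θ : Param d) :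
    ‖fderiv ℝ (J mdp pol) θ - ∑ t ∈ Finset.range H, fderiv ℝ (discReward mdp pol t) θ‖
      ≤ Dg mdp Mg H * mdp.γ ^ H := by
  have h1 := h.Mg_pos.le
  have h2 := mdp.rmax_pos.le
  have hγ := mdp.γ_pos.le
  have hγ1 : 0 < 1 - mdp.γ := sub_pos.2 mdp.γ_lt_one
  have sm : Summable fun t => fderiv ℝ (discReward mdp pol t) θ :=
    Summable.of_norm_bounded ((hasSum_geom_mul mdp).summable.mul_right _)
      fun t => h.norm_fderiv_discReward_le' mdp t θ
  rw [((h.hasFDerivAt_J mdp).1 θ).fderiv, ← sm.sum_add_tsum_nat_add H, add_sub_cancel_left]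
  -- `c²` is the mean of `t + H + 1` under the normalized geometric weights. The bound `√x ≤ (c² +
  -- x) / (2c)` then acts as Jensen's inequality and the tail sums to exactly `Dg mdp Mg H * γ ^ H`.
  set c := √(1 / (1 - mdp.γ) + H) with hc
  have hc0 : 0 < 1 / (1 - mdp.γ) + H := by positivity
  have hcpos : 0 < c := Real.sqrt_pos.2 hc0
  have hcsq : c ^ 2 = 1 / (1 - mdp.γ) + H := Real.sq_sqrt hc0.le
  have s : HasSum (fun t : ℕ => (mdp.γ ^ t * (c / 2 + H / (2 * c))
      + mdp.γ ^ t * ((t : ℝ) + 1) * (1 / (2 * c))) * (mdp.γ ^ H * (mdp.rmax * Mg)))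
      ((1 / (1 - mdp.γ) * (c / 2 + H / (2 * c)) + 1 / (1 - mdp.γ) ^ 2 * (1 / (2 * c)))
        * (mdp.γ ^ H * (mdp.rmax * Mg))) :=
    (((hasSum_geom mdp).mul_right _).add ((hasSum_geom_mul mdp).mul_right _)).mul_right _
  refine (tsum_of_norm_bounded s fun t => ?_).trans_eq ?_
  · refine (h.norm_fderiv_discReward_le mdp (t + H) θ).trans ?_
    have hs : √(((t + H : ℕ) : ℝ) + 1) ≤ c / 2 + H / (2 * c) + ((t : ℝ) + 1) * (1 / (2 * c)) := by
      have e : c / 2 + H / (2 * c) + ((t : ℝ) + 1) * (1 / (2 * c))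
          = (c ^ 2 + (((t + H : ℕ) : ℝ) + 1)) / (2 * c) := by
        push_cast; field_simp; ring
      rw [e, le_div_iff₀ (by positivity)]
      have hx : (0 : ℝ) ≤ ((t + H : ℕ) : ℝ) + 1 := by positivity
      nlinarith [sq_nonneg (√(((t + H : ℕ) : ℝ) + 1) - c), Real.sq_sqrt hx]
    have := mul_le_mul_of_nonneg_left hs
      (by positivity : 0 ≤ mdp.γ ^ (t + H) * (mdp.rmax * Mg))
    rw [pow_add] at this ⊢
    linarith
  · have e : 1 / (1 - mdp.γ) ^ 2 * (1 / (2 * c)) = 1 / (1 - mdp.γ) * ((c ^ 2 - H) / (2 * c)) := by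
      rw [hcsq]; field_simp; ring
    rw [e, Dg, ← hc]; field_simp; ring

end BoundedScore

end Return

end Expectation

/-! ### Mean and variance of the stochastic gradient -/

section StochasticGradient

variable {S A : Type*} [MeasurableSpace S] [MeasurableSpace A] {d : ℕ} {pol : Policy S A d}
  {Mg Mh : ℝ}

/-- The vector representing a linear form. -/
noncomputable def rep (φ : Param d →L[ℝ] ℝ) : Param d :=
  (InnerProductSpace.toDual ℝ (Param d)).symm φ

@[simp] lemma inner_rep (φ : Param d →L[ℝ] ℝ) (u : Param d) : inner ℝ (rep φ) u = φ u := by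
  simp [rep]

@[simp] lemma norm_rep (φ : Param d →L[ℝ] ℝ) : ‖rep φ‖ = ‖φ‖ := by simp [rep]

lemma rep_sub (φ ψ : Param d →L[ℝ] ℝ) : rep (φ - ψ) = rep φ - rep ψ := by simp [rep]

lemma rep_sum {ι : Type*} (s : Finset ι) (φ : ι → Param d →L[ℝ] ℝ) :
    rep (∑ i ∈ s, φ i) = ∑ i ∈ s, rep (φ i) := by simp [rep]

lemma continuous_rep : Continuous (rep : (Param d →L[ℝ] ℝ) → Param d) :=
  (InnerProductSpace.toDual ℝ (Param d)).symm.continuous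

lemma gradient_eq_rep (f : Param d → ℝ) (θ : Param d) : gradient f θ = rep (fderiv ℝ f θ) := rfl

lemma norm_sq_rep (φ : Param d →L[ℝ] ℝ) :
    ‖rep φ‖ ^ 2 = ∑ i, φ (EuclideanSpace.basisFun (Fin d) ℝ i) ^ 2 := by
  rw [← (EuclideanSpace.basisFun (Fin d) ℝ).sum_sq_norm_inner_left]
  refine Finset.sum_congr rfl fun i _ => ?_
  rw [inner_rep, Real.norm_eq_abs, sq_abs]

/-- The stochastic gradient regrouped by rewards. -/
lemma BoundedScore.stochGrad_eq (h : BoundedScore pol Mg Mh) (mdp : MDP S A) (H : ℕ)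
    (x : ℕ → S × A) (θ : Param d) :
    stochGrad mdp pol H (fun t => x t) θ
      = ∑ k ∈ Finset.range H, (mdp.γ ^ k * mdp.r (x k).1 (x k).2)
        • rep (score (pol.logLik (k + 1)) θ x) := by
  have e : ∀ t : Fin H, gradient (fun θ' => Real.log (pol.dens θ' (x t).1 (x t).2)) θ
      = rep (score pol.logDens θ (x t)) := fun t => rfl
  rw [stochGrad, Finset.sum_range (fun k => (mdp.γ ^ k * mdp.r (x k).1 (x k).2)
        • rep (score (pol.logLik (k + 1)) θ x))]
  simp only [e, Finset.sum_smul]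
  -- Exchanging summations, the reward at time `k` collects the scores of all times up to `k`, that
  -- is the score of a likelihood with `k + 1` factors.
  rw [Finset.sum_comm' (t' := Finset.univ) (s' := fun k => Finset.Iic k)
    (by simp)]
  refine Finset.sum_congr rfl fun k _ => ?_
  rw [h.score_logLik, rep_sum, Finset.smul_sum]
  refine Finset.sum_nbij (fun t : Fin H => (t : ℕ)) (fun t ht => ?_) (fun a _ b _ hab => ?_)
    (fun j hj => ?_) (fun _ _ => rfl)
  · have : t ≤ k := by simpa using ht
    exact Finset.mem_range.2 (Nat.lt_succ_of_le this)
  · exact Fin.ext hab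
  · have hj' : j < (k : ℕ) + 1 := by simpa using hj
    exact ⟨⟨j, by omega⟩, by simp [Fin.le_def]; omega, rfl⟩

lemma norm_sum_smul_rep_le {mdp : MDP S A} {c : ℕ → ℝ} {v : ℕ → Param d} (H : ℕ)
    (hc : ∀ k, |c k| ≤ mdp.γ ^ k * mdp.rmax) :
    ‖∑ k ∈ Finset.range H, c k • v k‖ ≤ mdp.rmax * ∑ k ∈ Finset.range H, mdp.γ ^ k * ‖v k‖ := by
  refine (norm_sum_le _ _).trans ?_
  rw [Finset.mul_sum]
  refine Finset.sum_le_sum fun k _ => ?_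
  rw [norm_smul]
  refine (mul_le_mul_of_nonneg_right (hc k) (norm_nonneg _)).trans_eq (by ring)

lemma abs_disc_reward_le (mdp : MDP S A) (k : ℕ) (y : S × A) :
    |mdp.γ ^ k * mdp.r y.1 y.2| ≤ mdp.γ ^ k * mdp.rmax := by
  rw [abs_mul, abs_of_nonneg (pow_nonneg mdp.γ_pos.le k)]
  exact mul_le_mul_of_nonneg_left (mdp.abs_r_le _ _) (pow_nonneg mdp.γ_pos.le k)

/-- A crude sure bound, needed for integrability only. -/
lemma BoundedScore.norm_stochGrad_le (h : BoundedScore pol Mg Mh) (mdp : MDP S A) (H : ℕ)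
    (τ : Fin H → S × A) (θ : Param d) :
    ‖stochGrad mdp pol H τ θ‖ ≤ mdp.rmax * (H * Mg * H) := by
  have hγ := mdp.γ_pos.le
  have hr := mdp.rmax_pos.le
  have hMg := h.Mg_pos.le
  rw [stochGrad]
  refine (norm_sum_le _ _).trans ?_
  have h1 : ∀ t : Fin H, ‖(∑ k ∈ Finset.Ici t, mdp.γ ^ (k : ℕ) * mdp.r (τ k).1 (τ k).2) •
      gradient (fun θ' => Real.log (pol.dens θ' (τ t).1 (τ t).2)) θ‖ ≤ mdp.rmax * (H * Mg) := by
    intro t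
    rw [norm_smul, gradient_eq_rep, norm_rep]
    have h2 : ‖∑ k ∈ Finset.Ici t, mdp.γ ^ (k : ℕ) * mdp.r (τ k).1 (τ k).2‖ ≤ H * mdp.rmax := by
      refine (norm_sum_le_of_le _ (fun (k : Fin H) _ => (abs_disc_reward_le mdp (k : ℕ) (τ k)).trans
        (mul_le_of_le_one_left hr (pow_le_one₀ hγ mdp.γ_lt_one.le)))).trans ?_
      rw [Finset.sum_const, nsmul_eq_mul]
      refine mul_le_mul_of_nonneg_right ?_ hr
      exact_mod_cast (Finset.card_le_univ _).trans_eq (Fintype.card_fin H)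
    refine (mul_le_mul h2 (h.norm_grad_le (τ t).1 (τ t).2 θ) (norm_nonneg _)
      (by positivity)).trans_eq (by ring)
  refine (Finset.sum_le_card_nsmul _ _ _ fun t _ => h1 t).trans_eq ?_
  simp; ring

/-- A Carathéodory function, continuous in the parameter and measurable in the pair, is jointly
measurable. This is needed because gradients are evaluated at random points. -/
lemma BoundedScore.measurable_score_uncurry (h : BoundedScore pol Mg Mh) :
    Measurable (Function.uncurry fun (θ : Param d) (y : S × A) => rep (score pol.logDens θ y)) := by
  refine measurable_uncurry_of_continuous_of_measurable (fun y => ?_) (fun θ => ?_)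
  · exact continuous_rep.comp ((h.smoothFamily.contDiff y).continuous_fderiv (by norm_num))
  · exact (continuous_rep.comp_stronglyMeasurable
      (stronglyMeasurable_clm fun u => h.smoothFamily.measurable_score θ u)).measurable

lemma BoundedScore.measurable_stochGrad (h : BoundedScore pol Mg Mh) (mdp : MDP S A) (H : ℕ) :
    Measurable fun p : Param d × (Fin H → S × A) => stochGrad mdp pol H p.2 p.1 := by
  unfold stochGrad
  refine Finset.measurable_fun_sum _ fun t _ => Measurable.fun_smul ?_ ?_
  · refine Finset.measurable_fun_sum _ fun k _ => ?_
    have h1 : Measurable fun p : Param d × (Fin H → S × A) => p.2 k := by fun_prop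
    exact (mdp.measurable_r.comp h1).const_mul _
  · have h1 : Measurable fun p : Param d × (Fin H → S × A) => (p.1, p.2 t) := by fun_prop
    exact h.measurable_score_uncurry.comp h1

lemma BoundedScore.measurable_stochGrad_left (h : BoundedScore pol Mg Mh) (mdp : MDP S A) (H : ℕ)
    (θ : Param d) : Measurable fun τ : Fin H → S × A => stochGrad mdp pol H τ θ :=
  Measurable.of_uncurry_left (f := fun (θ : Param d) (τ : Fin H → S × A) =>
    stochGrad mdp pol H τ θ) (h.measurable_stochGrad mdp H)

lemma integral_finTrajLaw (mdp : MDP S A) (pol : Policy S A d) (θ : Param d) (H : ℕ)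
    {f : (Fin H → S × A) → ℝ} (hf : Measurable f) :
    ∫ τ, f τ ∂(finTrajLaw mdp pol θ H) = ∫ x, f (fun t => x t) ∂(trajLaw mdp pol θ) := by
  rw [finTrajLaw, integral_map
    (measurable_pi_lambda _ fun _ => measurable_pi_apply _).aemeasurable hf.aestronglyMeasurable]

/-- The gradient of the expected return truncated at the horizon `H`. -/
noncomputable def truncGrad (mdp : MDP S A) (pol : Policy S A d) (H : ℕ) (θ : Param d) : Param d :=
  rep (∑ t ∈ Finset.range H, fderiv ℝ (discReward mdp pol t) θ)

lemma BoundedScore.continuous_truncGrad (h : BoundedScore pol Mg Mh) (mdp : MDP S A) (H : ℕ) :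
    Continuous (truncGrad mdp pol H) :=
  continuous_rep.comp (continuous_finsetSum _ fun t _ =>
    (h.contDiff_discReward mdp t).continuous_fderiv (by norm_num))

lemma BoundedScore.norm_truncGrad_sub_le (h : BoundedScore pol Mg Mh) (mdp : MDP S A) (H : ℕ)
    (θ : Param d) : ‖truncGrad mdp pol H θ - gradient (J mdp pol) θ‖ ≤ Dg mdp Mg H * mdp.γ ^ H := by
  rw [gradient_eq_rep, truncGrad, ← rep_sub, norm_rep, norm_sub_rev]
  exact h.norm_fderiv_J_sub_le mdp H θ

/-- The stochastic gradient is an unbiased estimator of the truncated gradient. -/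
lemma BoundedScore.integral_inner_stochGrad (h : BoundedScore pol Mg Mh) (mdp : MDP S A) (H : ℕ)
    (θ u : Param d) :
    ∫ τ, inner ℝ (stochGrad mdp pol H τ θ) u ∂(finTrajLaw mdp pol θ H)
      = inner ℝ (truncGrad mdp pol H θ) u := by
  have hm : Measurable fun τ : Fin H → S × A => inner ℝ (stochGrad mdp pol H τ θ) u :=
    (h.measurable_stochGrad_left mdp H θ).inner_const
  rw [integral_finTrajLaw mdp pol θ H hm, truncGrad, inner_rep, sum_apply]
  have e : ∀ x : ℕ → S × A, inner ℝ (stochGrad mdp pol H (fun t => x t) θ) u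
      = ∑ k ∈ Finset.range H, mdp.γ ^ k * (score (pol.logLik (k + 1)) θ x u
        * mdp.r (x k).1 (x k).2) := fun x => by
    rw [h.stochGrad_eq, sum_inner]
    refine Finset.sum_congr rfl fun k _ => ?_
    rw [real_inner_smul_left, inner_rep]; ring
  simp only [e]
  rw [integral_finsetSum]
  · refine Finset.sum_congr rfl fun k _ => ?_
    rw [integral_const_mul, h.fderiv_discReward, smul_apply, h.fderiv_expReward,
      smul_eq_mul]
  · intro k _
    have f := h.likelihoodFamily_past mdp (k + 1)
    refine (Integrable.of_bound (((f.measurable_score θ u).mono f.le le_rfl).fun_mul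
      (measurable_reward mdp k)).aestronglyMeasurable (((k + 1 : ℕ) * Mg * ‖u‖) * mdp.rmax)
      (Filter.Eventually.of_forall fun x => ?_)).const_mul _
    rw [norm_mul]
    exact mul_le_mul (f.abs_score_le θ u x) (abs_reward_le mdp k x) (norm_nonneg _)
      ((abs_nonneg _).trans (f.abs_score_le θ u x))

lemma BoundedScore.measurable_rep_score_logLik (h : BoundedScore pol Mg Mh) (mdp : MDP S A) (N : ℕ)
    (θ : Param d) : Measurable fun x => rep (score (pol.logLik N) θ x) := by
  have f := h.likelihoodFamily_past mdp N
  exact (continuous_rep.comp_stronglyMeasurable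
    (stronglyMeasurable_clm fun u => (f.measurable_score θ u).mono f.le le_rfl)).measurable

lemma BoundedScore.integrable_norm_score_sq (h : BoundedScore pol Mg Mh) (mdp : MDP S A) (N : ℕ)
    (θ : Param d) :
    Integrable (fun x => ‖rep (score (pol.logLik N) θ x)‖ ^ 2) (trajLaw mdp pol θ) := by
  have f := h.likelihoodFamily_past mdp N
  refine Integrable.of_bound ((h.measurable_rep_score_logLik mdp N θ).norm.pow_const
    2).aestronglyMeasurable ((N * Mg) ^ 2) (Filter.Eventually.of_forall fun x => ?_)
  rw [norm_pow, norm_norm, norm_rep]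
  gcongr
  exact f.norm_score_le θ x

/-- Orthogonality is applied in each coordinate of an orthonormal basis, and coordinates are summed
before the score is bounded; bounding each coordinate separately would cost a factor of the
dimension. -/
lemma BoundedScore.integral_norm_score_sq_le (h : BoundedScore pol Mg Mh) (mdp : MDP S A) (N : ℕ)
    (θ : Param d) :
    ∫ x, ‖rep (score (pol.logLik N) θ x)‖ ^ 2 ∂(trajLaw mdp pol θ) ≤ N * Mg ^ 2 := by
  set b := EuclideanSpace.basisFun (Fin d) ℝ
  have hi : ∀ k i, Integrable (fun x : ℕ → S × A => score pol.logDens θ (x k) (b i) ^ 2)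
      (trajLaw mdp pol θ) := fun k i => by
    have g := h.martingaleDiff_score mdp θ (b i)
    refine Integrable.of_bound ((((g.measurable k).mono (g.le _) le_rfl).pow_const
      2).aestronglyMeasurable) ((Mg * ‖b i‖) ^ 2) (Filter.Eventually.of_forall fun x => ?_)
    rw [norm_pow]
    gcongr
    exact g.abs_le k x
  have hI : ∀ i, Integrable (fun x => score (pol.logLik N) θ x (b i) ^ 2)
      (trajLaw mdp pol θ) := fun i => by
    have f := h.likelihoodFamily_past mdp N
    refine Integrable.of_bound ((((f.measurable_score θ (b i)).mono f.le le_rfl).pow_const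
      2).aestronglyMeasurable) ((N * Mg * ‖b i‖) ^ 2) (Filter.Eventually.of_forall fun x => ?_)
    rw [norm_pow]
    gcongr
    exact f.abs_score_le θ (b i) x
  simp only [norm_sq_rep]
  rw [integral_finsetSum _ fun i _ => hI i]
  have e1 : ∀ i, ∫ x, score (pol.logLik N) θ x (b i) ^ 2 ∂(trajLaw mdp pol θ)
      = ∑ k ∈ Finset.range N, ∫ x, score pol.logDens θ (x k) (b i) ^ 2 ∂(trajLaw mdp pol θ) :=
    fun i => by
      rw [← (h.martingaleDiff_score mdp θ (b i)).integral_sq_sum N]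
      simp only [h.score_logLik, sum_apply]
  have e2 : ∑ i, ∫ x, score (pol.logLik N) θ x (b i) ^ 2 ∂(trajLaw mdp pol θ)
      = ∑ k ∈ Finset.range N, ∫ x, ‖rep (score pol.logDens θ (x k))‖ ^ 2
        ∂(trajLaw mdp pol θ) := by
    simp only [e1, norm_sq_rep]
    rw [Finset.sum_comm]
    refine Finset.sum_congr rfl fun k _ => ?_
    rw [integral_finsetSum _ fun i _ => hi k i]
  rw [e2]
  have hk : ∀ k, ∫ x, ‖rep (score pol.logDens θ (x k))‖ ^ 2 ∂(trajLaw mdp pol θ) ≤ Mg ^ 2 :=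
    fun k => by
      have : ∫ x, ‖rep (score pol.logDens θ (x k))‖ ^ 2 ∂(trajLaw mdp pol θ)
          ≤ ∫ x, Mg ^ 2 ∂(trajLaw mdp pol θ) :=
        integral_mono_of_nonneg (Filter.Eventually.of_forall fun x => sq_nonneg _)
          (integrable_const _) (Filter.Eventually.of_forall fun x => by
            simp only [norm_rep]
            have := h.smoothFamily.norm_score_le θ (x k)
            gcongr)
      simpa using this
  simpa using Finset.sum_le_card_nsmul (Finset.range N) _ _ fun k _ => hk k

/-- Cauchy–Schwarz with weights `γ ^ k` splits the square into `∑ γ ^ k` and `∑ γ ^ k ‖score‖²`, of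
size `1 / (1 - γ)` and, in mean, `Mg² / (1 - γ)²`. -/
lemma BoundedScore.integral_norm_stochGrad_sq_le (h : BoundedScore pol Mg Mh) (mdp : MDP S A)
    (H : ℕ) (θ : Param d) :
    ∫ τ, ‖stochGrad mdp pol H τ θ‖ ^ 2 ∂(finTrajLaw mdp pol θ H) ≤ sigmaSq mdp Mg := by
  have hγ := mdp.γ_pos.le
  have hγ1 : 0 < 1 - mdp.γ := sub_pos.2 mdp.γ_lt_one
  have hm : Measurable fun τ : Fin H → S × A => ‖stochGrad mdp pol H τ θ‖ ^ 2 :=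
    (h.measurable_stochGrad_left mdp H θ).norm.pow_const 2
  rw [integral_finTrajLaw mdp pol θ H hm]
  have hg : ∑ k ∈ Finset.range H, mdp.γ ^ k ≤ 1 / (1 - mdp.γ) :=
    sum_le_hasSum _ (fun k _ => pow_nonneg hγ k) (hasSum_geom mdp)
  have hpt : ∀ x : ℕ → S × A, ‖stochGrad mdp pol H (fun t => x t) θ‖ ^ 2
      ≤ mdp.rmax ^ 2 * (1 / (1 - mdp.γ) * ∑ k ∈ Finset.range H,
        mdp.γ ^ k * ‖rep (score (pol.logLik (k + 1)) θ x)‖ ^ 2) := fun x => by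
    rw [h.stochGrad_eq]
    have h1 := norm_sum_smul_rep_le (mdp := mdp) H
      (c := fun k => mdp.γ ^ k * mdp.r (x k).1 (x k).2)
      (v := fun k => rep (score (pol.logLik (k + 1)) θ x)) fun k => abs_disc_reward_le mdp k (x k)
    have h2 := Finset.sum_sq_le_sum_mul_sum_of_sq_le_mul (Finset.range H)
      (r := fun k => mdp.γ ^ k * ‖rep (score (pol.logLik (k + 1)) θ x)‖)
      (f := fun k => mdp.γ ^ k)
      (g := fun k => mdp.γ ^ k * ‖rep (score (pol.logLik (k + 1)) θ x)‖ ^ 2)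
      (fun k _ => pow_nonneg hγ k) (fun k _ => mul_nonneg (pow_nonneg hγ k) (sq_nonneg _))
      (fun k _ => by
        apply le_of_eq; ring)
    refine (pow_le_pow_left₀ (norm_nonneg _) h1 2).trans ?_
    rw [mul_pow]
    refine mul_le_mul_of_nonneg_left (h2.trans ?_) (sq_nonneg _)
    exact mul_le_mul_of_nonneg_right hg (Finset.sum_nonneg fun k _ =>
      mul_nonneg (pow_nonneg hγ k) (sq_nonneg _))
  have hint := fun k => (h.integrable_norm_score_sq mdp (k + 1) θ).const_mul (mdp.γ ^ k)
  have h3 := integral_mono_of_nonneg (μ := trajLaw mdp pol θ)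
    (Filter.Eventually.of_forall fun x : ℕ → S × A => sq_nonneg _)
    (((integrable_finsetSum (Finset.range H) fun k _ => hint k).const_mul _).const_mul _)
    (Filter.Eventually.of_forall hpt)
  refine h3.trans ?_
  rw [integral_const_mul, integral_const_mul, integral_finsetSum _ fun k _ => hint k]
  have h4 : ∑ k ∈ Finset.range H, ∫ x, mdp.γ ^ k * ‖rep (score (pol.logLik (k + 1)) θ x)‖ ^ 2
      ∂(trajLaw mdp pol θ) ≤ 1 / (1 - mdp.γ) ^ 2 * Mg ^ 2 := by
    have h5 : ∀ k ∈ Finset.range H,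
        ∫ x, mdp.γ ^ k * ‖rep (score (pol.logLik (k + 1)) θ x)‖ ^ 2 ∂(trajLaw mdp pol θ)
        ≤ mdp.γ ^ k * ((k : ℝ) + 1) * Mg ^ 2 := fun k _ => by
      rw [integral_const_mul, mul_assoc]
      refine mul_le_mul_of_nonneg_left ?_ (pow_nonneg hγ k)
      exact_mod_cast h.integral_norm_score_sq_le mdp (k + 1) θ
    refine (Finset.sum_le_sum h5).trans ?_
    rw [← Finset.sum_mul]
    refine mul_le_mul_of_nonneg_right ?_ (sq_nonneg _)
    exact sum_le_hasSum _ (fun k _ => by positivity) (hasSum_geom_mul mdp)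
  refine (mul_le_mul_of_nonneg_left (mul_le_mul_of_nonneg_left h4 (by positivity))
    (sq_nonneg _)).trans_eq ?_
  rw [sigmaSq]; field_simp

/-- The variance bound of the stochastic gradient. -/
lemma BoundedScore.integral_norm_stochGrad_sub_sq_le (h : BoundedScore pol Mg Mh) (mdp : MDP S A)
    (H : ℕ) (θ : Param d) :
    ∫ τ, ‖stochGrad mdp pol H τ θ - truncGrad mdp pol H θ‖ ^ 2 ∂(finTrajLaw mdp pol θ H)
      ≤ sigmaSq mdp Mg := by
  have hm : Measurable fun τ : Fin H → S × A => stochGrad mdp pol H τ θ :=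
    h.measurable_stochGrad_left mdp H θ
  have i1 : Integrable (fun τ => ‖stochGrad mdp pol H τ θ‖ ^ 2) (finTrajLaw mdp pol θ H) :=
    Integrable.of_bound (hm.norm.pow_const 2).aestronglyMeasurable
      ((mdp.rmax * (H * Mg * H)) ^ 2) (Filter.Eventually.of_forall fun τ => by
        rw [norm_pow, norm_norm]
        gcongr
        exact h.norm_stochGrad_le mdp H τ θ)
  have i2 : ∀ v, Integrable (fun τ => inner ℝ (stochGrad mdp pol H τ θ) v)
      (finTrajLaw mdp pol θ H) := fun v => by
    have hm2 : AEStronglyMeasurable (fun τ : Fin H → S × A => inner ℝ (stochGrad mdp pol H τ θ) v)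
        (finTrajLaw mdp pol θ H) := (Measurable.inner_const hm).aestronglyMeasurable
    have hb : ∀ τ, ‖inner ℝ (stochGrad mdp pol H τ θ) v‖ ≤ mdp.rmax * (H * Mg * H) * ‖v‖ :=
      fun τ => (norm_inner_le_norm _ _).trans
        (mul_le_mul_of_nonneg_right (h.norm_stochGrad_le mdp H τ θ) (norm_nonneg _))
    have := Integrable.of_bound hm2 (mdp.rmax * (H * Mg * H) * ‖v‖) (ae_of_all _ hb)
    exact this
  -- `truncGrad` is the mean of the stochastic gradient, so subtracting it can only decrease the
  -- second moment.
  have e : ∀ τ, ‖stochGrad mdp pol H τ θ - truncGrad mdp pol H θ‖ ^ 2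
      = (‖stochGrad mdp pol H τ θ‖ ^ 2
        + (-2) * inner ℝ (stochGrad mdp pol H τ θ) (truncGrad mdp pol H θ))
        + ‖truncGrad mdp pol H θ‖ ^ 2 := fun τ => by rw [norm_sub_sq_real]; ring
  simp only [e]
  rw [integral_add (i1.fun_add ((i2 _).const_mul (-2))) (integrable_const _),
    integral_add i1 ((i2 _).const_mul (-2)), integral_const_mul, h.integral_inner_stochGrad,
    real_inner_self_eq_norm_sq]
  have := h.integral_norm_stochGrad_sq_le mdp H θ
  simp only [integral_const, probReal_univ, smul_eq_mul, one_mul]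
  nlinarith [sq_nonneg ‖truncGrad mdp pol H θ‖]

end StochasticGradient

/-! ### Selecting from a conditionally i.i.d. family -/

section ConditionalProduct

lemma measurable_selection {Ω ι T : Type*} {m : MeasurableSpace Ω} [MeasurableSpace T]
    [MeasurableSpace ι] [Countable ι] [MeasurableSingletonClass ι] {I : Ω → ι} {f : ι → Ω → T}
    (hI : Measurable I) (hf : ∀ i, Measurable (f i)) : Measurable fun ω => f (I ω) ω :=
  (measurable_from_prod_countable_right (f := fun p : ι × Ω => f p.1 p.2) hf).comp
    (hI.prodMk measurable_id)

variable {Ω Ω' T T' : Type*} {mΩ : MeasurableSpace Ω} {mΩ' : MeasurableSpace Ω'}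
  [MeasurableSpace T] [MeasurableSpace T'] {μ : Measure Ω} [IsProbabilityMeasure μ] {Y : Ω → Ω'}
  {τ : Ω → T}
  {τ' : Ω → T'} {K : Kernel Ω' T} {K' : Kernel Ω' T'} [IsMarkovKernel K] [IsMarkovKernel K']

/-- Conditionally independent variables with conditional laws `K` and `K'`, from the values on
rectangles. -/
lemma map_eq_compProd_prod (hY : Measurable Y) (hτ : Measurable τ) (hτ' : Measurable τ')
    (h : ∀ A B B', MeasurableSet A → MeasurableSet B → MeasurableSet B' →
      μ.real (Y ⁻¹' A ∩ (τ ⁻¹' B ∩ τ' ⁻¹' B'))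
        = ∫ ω in Y ⁻¹' A, (K (Y ω)).real B * (K' (Y ω)).real B' ∂μ) :
    μ.map (fun ω => (Y ω, τ ω, τ' ω)) = (μ.map Y) ⊗ₘ (K ×ₖ K') := by
  have hm : Measurable fun ω => (Y ω, τ ω, τ' ω) := hY.prodMk (hτ.prodMk hτ')
  have : IsProbabilityMeasure (μ.map fun ω => (Y ω, τ ω, τ' ω)) :=
    Measure.isProbabilityMeasure_map hm.aemeasurable
  have : IsProbabilityMeasure (μ.map Y) := Measure.isProbabilityMeasure_map hY.aemeasurable
  refine Measure.ext_prod₃ fun {A B B'} hA hB hB' => ?_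
  rw [Measure.map_apply hm (hA.prod (hB.prod hB')),
    Measure.compProd_apply_prod hA (hB.prod hB')]
  simp only [Kernel.prod_apply_prod]
  have hK : Measurable fun y => K y B * K' y B' :=
    (K.measurable_coe hB).fun_mul (K'.measurable_coe hB')
  rw [setLIntegral_map hA hK hY]
  have e : (fun ω => (Y ω, τ ω, τ' ω)) ⁻¹' A ×ˢ B ×ˢ B' = Y ⁻¹' A ∩ (τ ⁻¹' B ∩ τ' ⁻¹' B') := rfl
  rw [e, ← ENNReal.ofReal_toReal (measure_ne_top μ (Y ⁻¹' A ∩ (τ ⁻¹' B ∩ τ' ⁻¹' B')))]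
  change ENNReal.ofReal (μ.real _) = _
  have hreal : Measurable fun ω => (K (Y ω)).real B * (K' (Y ω)).real B' :=
    (((K.measurable_coe hB).comp hY).ennreal_toReal).fun_mul
      (((K'.measurable_coe hB').comp hY).ennreal_toReal)
  rw [h A B B' hA hB hB', ofReal_integral_eq_lintegral_ofReal]
  · refine lintegral_congr fun ω => ?_
    rw [ENNReal.ofReal_mul measureReal_nonneg, ofReal_measureReal, ofReal_measureReal]
  · refine Integrable.of_bound hreal.aestronglyMeasurable 1 (ae_of_all _ fun ω => ?_)
    rw [Real.norm_of_nonneg (by positivity)]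
    exact mul_le_one₀ measureReal_le_one measureReal_nonneg measureReal_le_one
  · exact ae_of_all _ fun ω => by positivity

lemma integral_eq_of_map_eq_compProd_prod (hY : Measurable Y) (hτ : Measurable τ)
    (hτ' : Measurable τ') (h : μ.map (fun ω => (Y ω, τ ω, τ' ω)) = (μ.map Y) ⊗ₘ (K ×ₖ K'))
    {F : Ω' × T × T' → ℝ} (hF : Measurable F) {C : ℝ} (hC : ∀ p, ‖F p‖ ≤ C) :
    ∫ ω, F (Y ω, τ ω, τ' ω) ∂μ
      = ∫ ω, ∫ x, ∫ y, F (Y ω, x, y) ∂(K' (Y ω)) ∂(K (Y ω)) ∂μ := by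
  have hm : Measurable fun ω => (Y ω, τ ω, τ' ω) := hY.prodMk (hτ.prodMk hτ')
  have : IsProbabilityMeasure (μ.map Y) := Measure.isProbabilityMeasure_map hY.aemeasurable
  have hFi : Integrable F ((μ.map Y) ⊗ₘ (K ×ₖ K')) :=
    Integrable.of_bound hF.aestronglyMeasurable C (ae_of_all _ hC)
  rw [← integral_map (φ := fun ω => (Y ω, τ ω, τ' ω)) hm.aemeasurable hF.aestronglyMeasurable, h,
    Measure.integral_compProd hFi]
  have hFm : AEStronglyMeasurable (fun a => ∫ b, F (a, b) ∂(K ×ₖ K') a) (μ.map Y) :=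
    hFi.integral_compProd.aestronglyMeasurable
  rw [integral_map hY.aemeasurable hFm]
  refine integral_congr_ae (ae_of_all _ fun ω => ?_)
  simp only [Kernel.prod_apply]
  exact integral_prod _ (Integrable.of_bound (hF.comp measurable_prodMk_left).aestronglyMeasurable C
    (ae_of_all _ fun p => hC _))

/-- Two distinct members of a conditionally i.i.d. family, selected by the conditioning
information, are conditionally i.i.d. -/
lemma integral_selection {ι : Type*} [Countable ι] [MeasurableSpace ι] [MeasurableSingletonClass ι]
    {m : MeasurableSpace Ω} (hm : m ≤ mΩ) {K : @Kernel Ω T m _} [IsMarkovKernel K]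
    {f : ι → Ω → T} (hf : ∀ i, Measurable[mΩ] (f i)) {I I' : Ω → ι} (hI : Measurable[m] I)
    (hI' : Measurable[m] I') (hII' : ∀ ω, I ω ≠ I' ω)
    (h : ∀ p p' E B B', p ≠ p' → MeasurableSet[m] E → MeasurableSet B → MeasurableSet B' →
      ∫ ω in E, (f p ⁻¹' B ∩ f p' ⁻¹' B').indicator (fun _ => (1 : ℝ)) ω ∂μ
        = ∫ ω in E, (K ω).real B * (K ω).real B' ∂μ)
    {F : Ω × T × T → ℝ} (hF : Measurable[@Prod.instMeasurableSpace _ _ m _] F) {C : ℝ}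
    (hC : ∀ p, ‖F p‖ ≤ C) :
    ∫ ω, F (ω, f (I ω) ω, f (I' ω) ω) ∂μ = ∫ ω, ∫ x, ∫ y, F (ω, x, y) ∂(K ω) ∂(K ω) ∂μ := by
  have hY : @Measurable Ω Ω mΩ m id := measurable_id'' hm
  have h1 : Measurable[mΩ] fun ω => f (I ω) ω :=
    measurable_selection (m := mΩ) (hI.mono hm le_rfl) hf
  have h2 : Measurable[mΩ] fun ω => f (I' ω) ω :=
    measurable_selection (m := mΩ) (hI'.mono hm le_rfl) hf
  refine integral_eq_of_map_eq_compProd_prod (Y := id) (K := K) (K' := K) hY h1 h2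
    (map_eq_compProd_prod hY h1 h2 fun E B B' hE hB hB' => ?_) hF hC
  -- `E` is cut into countably many pieces according to the value of `(I, I')`. Each piece lies in
  -- `m` because the selection does, and on it the two members are fixed and distinct, so the
  -- hypothesis applies.
  have hpm : ∀ p : ι × ι, MeasurableSet[m] (E ∩ (fun ω => (I ω, I' ω)) ⁻¹' {p}) := fun p =>
    MeasurableSet.inter hE ((hI.prodMk hI') (measurableSet_singleton p))
  have hcover : E = ⋃ p : ι × ι, E ∩ (fun ω => (I ω, I' ω)) ⁻¹' {p} := by
    ext ω; simp
  have hdisj : Pairwise (Function.onFun Disjoint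
      fun p : ι × ι => E ∩ (fun ω => (I ω, I' ω)) ⁻¹' {p}) := fun p p' hpp' => by
    refine Set.disjoint_left.2 fun ω h3 h4 => hpp' ?_
    rw [← h3.2, ← h4.2]
  have hi1 : Integrable (((fun ω => f (I ω) ω) ⁻¹' B ∩ (fun ω => f (I' ω) ω) ⁻¹' B').indicator
      fun _ => (1 : ℝ)) μ := (integrable_const 1).indicator ((h1 hB).inter (h2 hB'))
  have hi2 : Integrable (fun ω => (K ω).real B * (K ω).real B') μ := by
    have hr : Measurable[m] fun ω => (K ω).real B * (K ω).real B' :=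
      (K.measurable_coe hB).ennreal_toReal.fun_mul (K.measurable_coe hB').ennreal_toReal
    refine Integrable.of_bound (hr.mono hm le_rfl).aestronglyMeasurable 1 (ae_of_all _ fun ω => ?_)
    rw [Real.norm_of_nonneg (by positivity)]
    exact mul_le_one₀ measureReal_le_one measureReal_nonneg measureReal_le_one
  have e1 : μ.real (id ⁻¹' E ∩ ((fun ω => f (I ω) ω) ⁻¹' B ∩ (fun ω => f (I' ω) ω) ⁻¹' B'))
      = ∫ ω in E, ((fun ω => f (I ω) ω) ⁻¹' B ∩ (fun ω => f (I' ω) ω) ⁻¹' B').indicator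
        (fun _ => (1 : ℝ)) ω ∂μ := by
    rw [integral_indicator_const _ ((h1 hB).inter (h2 hB')), smul_eq_mul, mul_one,
      measureReal_restrict_apply ((h1 hB).inter (h2 hB')), Set.inter_comm]
    rfl
  rw [e1, Set.preimage_id]
  simp only [id]
  conv_lhs => rw [hcover]
  conv_rhs => rw [hcover]
  rw [integral_iUnion (fun p => hm _ (hpm p)) hdisj hi1.integrableOn,
    integral_iUnion (fun p => hm _ (hpm p)) hdisj hi2.integrableOn]
  refine tsum_congr fun p => ?_
  by_cases hp : p.1 = p.2
  · have : E ∩ (fun ω => (I ω, I' ω)) ⁻¹' {p} = ∅ := by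
      refine Set.eq_empty_of_forall_notMem fun ω hω => hII' ω ?_
      have h3 : (I ω, I' ω) = p := hω.2
      rw [← h3] at hp
      exact hp
    rw [this]; simp
  · rw [← h p.1 p.2 _ B B' hp (hpm p) hB hB']
    refine setIntegral_congr_fun (hm _ (hpm p)) fun ω hω => ?_
    have h3 : (I ω, I' ω) = p := hω.2
    have e2 : I ω = p.1 := by rw [← h3]
    have e3 : I' ω = p.2 := by rw [← h3]
    have e4 : ω ∈ (fun ω => f (I ω) ω) ⁻¹' B ∩ (fun ω => f (I' ω) ω) ⁻¹' B'
        ↔ ω ∈ f p.1 ⁻¹' B ∩ f p.2 ⁻¹' B' := by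
      simp only [Set.mem_inter_iff, Set.mem_preimage, e2, e3]
    by_cases h4 : ω ∈ f p.1 ⁻¹' B ∩ f p.2 ⁻¹' B'
    · rw [Set.indicator_of_mem h4, Set.indicator_of_mem (e4.2 h4)]
    · rw [Set.indicator_of_notMem h4, Set.indicator_of_notMem fun h5 => h4 (e4.1 h5)]

end ConditionalProduct

/-! ### The trajectory law as a kernel in the parameter -/

section TrajectoryKernel

variable {S A : Type*} [MeasurableSpace S] [MeasurableSpace A] {d : ℕ} {pol : Policy S A d}
  {Mg Mh : ℝ}

/-- The probability of a fixed event on the first `H` pairs is even continuous in the parameter, by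
the change of measure. -/
lemma BoundedScore.measurable_finTrajLaw (h : BoundedScore pol Mg Mh) (mdp : MDP S A) (H : ℕ) :
    Measurable fun θ => finTrajLaw mdp pol θ H := by
  refine Measure.measurable_of_measurable_coe _ fun B hB => ?_
  have f := h.likelihoodFamily_past mdp H
  have hm : Measurable[past (S × A) H] fun x : ℕ → S × A => fun t : Fin H => x t :=
    @measurable_pi_lambda _ _ _ (past (S × A) H) _ _ fun t => measurable_eval_past (S × A) t.2
  have e : ∀ θ, finTrajLaw mdp pol θ H B = ENNReal.ofReal
      (∫ x, ((fun x : ℕ → S × A => fun t : Fin H => x t) ⁻¹' B).indicator (fun _ => (1 : ℝ)) x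
        ∂(trajLaw mdp pol θ)) := fun θ => by
    rw [integral_indicator_const _ (f.le _ (hm hB)), smul_eq_mul, mul_one, ofReal_measureReal,
      finTrajLaw, Measure.map_apply (hm.mono f.le le_rfl) hB]
  simp only [e]
  refine (Continuous.measurable ?_).ennreal_ofReal
  refine f.continuous_integral (Q := fun _ => ((fun x : ℕ → S × A => fun t : Fin H => x t) ⁻¹'
    B).indicator (fun _ => (1 : ℝ))) (C := 1) (fun _ => ?_) (fun _ => continuous_const) ?_
  · exact (measurable_const.indicator (hm hB))
  · intro _ x
    by_cases hx : x ∈ (fun x : ℕ → S × A => fun t : Fin H => x t) ⁻¹' B <;> simp [hx]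

/-- The law of the trajectories as a kernel from the parameters. -/
noncomputable def BoundedScore.trajKernel (h : BoundedScore pol Mg Mh) (mdp : MDP S A) (H : ℕ) :
    Kernel (Param d) (Fin H → S × A) :=
  ⟨fun θ => finTrajLaw mdp pol θ H, h.measurable_finTrajLaw mdp H⟩

instance (h : BoundedScore pol Mg Mh) (mdp : MDP S A) (H : ℕ) :
    IsMarkovKernel (h.trajKernel mdp H) :=
  ⟨fun θ => inferInstanceAs (IsProbabilityMeasure (finTrajLaw mdp pol θ H))⟩

end TrajectoryKernel

lemma measurable_normalize {Ω : Type*} {m : MeasurableSpace Ω} {d : ℕ} {v : Ω → Param d}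
    (hv : Measurable v) : Measurable fun ω => ‖v ω‖⁻¹ • v ω :=
  hv.norm.inv.fun_smul hv

lemma BoundedScore.measurable_sum_stochGrad {S A Ω : Type*} [MeasurableSpace S] [MeasurableSpace A]
    {m : MeasurableSpace Ω} {d : ℕ} {pol : Policy S A d} {Mg Mh : ℝ} (h : BoundedScore pol Mg Mh)
    (mdp : MDP S A) (H N : ℕ) (c : ℝ) {τ : ℕ → Ω → Fin H → S × A} {q : Ω → Param d}
    (hτ : ∀ j, Measurable (τ j)) (hq : Measurable q) :
    Measurable fun ω => ∑ j ∈ Finset.range N, c • stochGrad mdp pol H (τ j ω) (q ω) := by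
  refine Finset.measurable_fun_sum _ fun j _ => Measurable.fun_const_smul ?_ _
  exact (h.measurable_stochGrad mdp H).comp (f := fun ω => (q ω, τ j ω)) (hq.prodMk (hτ j))

/-! ### Measurability of an execution and the order of arrivals -/

namespace Execution

section

variable {S A Ω : Type*} [MeasurableSpace S] [MeasurableSpace A] [mΩ : MeasurableSpace Ω]
  {μ : Measure Ω} {d : ℕ} {mdp : MDP S A} {pol : Policy S A d} {n : ℕ} {hdot : Fin n → ℝ} {κ : ℝ}
  {θ₀ : Param d} {η α : ℝ} {Minit M H : ℕ} {Mg Mh : ℝ}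
  (X : Execution μ mdp pol hdot κ θ₀ η α Minit M H)

/-- The agent and the index of the `j`-th gradient to arrive in call `t`. -/
def arrival (t j : ℕ) (ω : Ω) : Fin n × ℕ :=
  (X.order t j ω, delivered (fun l => X.order t l ω) j (X.order t j ω))

/-- The trajectory of the `j`-th gradient to arrive in call `t`. -/
def arrivalTraj (t j : ℕ) (ω : Ω) : Fin H → S × A :=
  X.traj t (X.arrival t j ω).1 (X.arrival t j ω).2 ω

/-- The batch size of call `t`. -/
def size (_ : Execution μ mdp pol hdot κ θ₀ η α Minit M H) (t : ℕ) : ℕ :=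
  if t = 0 then Minit else M

lemma g_eq_sum (t : ℕ) (ω : Ω) : X.g t ω = ∑ j ∈ Finset.range (X.size t),
    (1 / X.size t : ℝ) • stochGrad mdp pol H (X.arrivalTraj t j ω) (X.query t ω) := by
  rw [X.g_eq]; rfl

/-- Between two arrivals from the same agent its count of delivered gradients has increased, so no
trajectory is used twice. -/
lemma arrival_injective (t : ℕ) (ω : Ω) : Function.Injective fun j => X.arrival t j ω := by
  have key : ∀ i j, i < j → X.arrival t i ω ≠ X.arrival t j ω := fun i j hij he => by
    obtain ⟨h1, h2⟩ := Prod.ext_iff.1 he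
    simp only [arrival] at h1 h2
    rw [h1] at h2
    refine absurd h2 (ne_of_lt ?_)
    refine Finset.card_lt_card (Finset.ssubset_iff_of_subset ?_ |>.2 ⟨i, ?_, ?_⟩)
    · intro l hl
      simp only [Finset.mem_filter, Finset.mem_range] at hl ⊢
      exact ⟨hl.1.trans hij, hl.2⟩
    · simpa using ⟨hij, h1⟩
    · simp
  intro i j he
  rcases lt_trichotomy i j with hij | hij | hij
  · exact absurd he (key i j hij)
  · exact hij
  · exact absurd he.symm (key j i hij)

/-- The identity of the `j`-th arriving gradient depends on finitely many entries of the order, all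
known when the call starts. Here the independence of the order from the trajectories of the call
enters. -/
lemma measurable_arrival (t j : ℕ) : Measurable[X.ℱ t] (X.arrival t j) := by
  have h1 : Measurable[X.ℱ t] fun ω => fun l : Fin (j + 1) => X.order t l ω :=
    @measurable_pi_lambda _ _ _ (X.ℱ t) _ _ fun l => X.measurable_order t l
  have h2 : Measurable fun f : Fin (j + 1) → Fin n => (f (Fin.last j),
      delivered (fun l => if hl : l < j + 1 then f ⟨l, hl⟩ else f (Fin.last j)) j
        (f (Fin.last j))) := measurable_of_countable _
  convert h2.comp h1 using 1
  funext ω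
  simp only [Function.comp, arrival, Fin.val_last, Prod.mk.injEq, true_and, delivered]
  congr 1
  refine Finset.filter_congr fun l hl => ?_
  have : l < j + 1 := by have := Finset.mem_range.1 hl; omega
  simp [this]

lemma measurable_arrivalTraj (t j : ℕ) : Measurable[X.ℱ (t + 1)] (X.arrivalTraj t j) := by
  have h1 : Measurable[X.ℱ (t + 1)] (X.arrival t j) :=
    (X.measurable_arrival t j).mono (X.ℱ.mono (Nat.le_succ t)) le_rfl
  exact measurable_selection (f := fun p : Fin n × ℕ => X.traj t p.1 p.2) h1
    fun p => X.measurable_traj t p.1 p.2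

lemma measurable_g_of_query (h : BoundedScore pol Mg Mh) (t : ℕ)
    (hq : Measurable[X.ℱ t] (X.query t)) : Measurable[X.ℱ (t + 1)] (X.g t) := by
  have hq' : Measurable[X.ℱ (t + 1)] (X.query t) := hq.mono (X.ℱ.mono (Nat.le_succ t)) le_rfl
  have h1 := fun j => X.measurable_arrivalTraj t j
  rw [show X.g t = fun ω => _ from funext fun ω => X.g_eq_sum t ω]
  exact h.measurable_sum_stochGrad mdp H _ _ h1 hq'

/-- The three processes determine one another, hence a joint induction. The direction `dir t` uses
the trajectories of call `t` and is known one index later than `θ t` and `query t`. -/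
lemma measurable_aux (h : BoundedScore pol Mg Mh) (t : ℕ) :
    Measurable[X.ℱ t] (X.θ t) ∧ Measurable[X.ℱ t] (X.query t) ∧
      Measurable[X.ℱ (t + 1)] (X.dir t) := by
  induction t with
  | zero =>
    have h1 : Measurable[X.ℱ 0] (X.θ 0) := by
      rw [show X.θ 0 = fun _ => θ₀ from funext X.θ_zero]; exact measurable_const
    have h2 : Measurable[X.ℱ 0] (X.query 0) := by
      rw [show X.query 0 = fun _ => θ₀ from funext X.query_zero]; exact measurable_const
    refine ⟨h1, h2, ?_⟩
    rw [show X.dir 0 = X.g 0 from funext X.dir_zero]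
    exact X.measurable_g_of_query h 0 h2
  | succ t ih =>
    obtain ⟨h1, h2, h3⟩ := ih
    have h1' : Measurable[X.ℱ (t + 1)] (X.θ t) := h1.mono (X.ℱ.mono (Nat.le_succ t)) le_rfl
    have h4 : Measurable[X.ℱ (t + 1)] (X.θ (t + 1)) := by
      rw [show X.θ (t + 1) = fun ω => _ from funext (X.θ_succ t)]
      exact h1'.fun_add ((measurable_normalize h3).fun_const_smul α)
    have h5 : Measurable[X.ℱ (t + 1)] (X.query (t + 1)) := by
      rw [show X.query (t + 1) = fun ω => _ from funext (X.query_succ t)]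
      exact h4.fun_add ((h4.fun_sub h1').fun_const_smul _)
    refine ⟨h4, h5, ?_⟩
    have h6 := X.measurable_g_of_query h (t + 1) h5
    have h3' : Measurable[X.ℱ (t + 1 + 1)] (X.dir t) := h3.mono (X.ℱ.mono (Nat.le_succ _)) le_rfl
    rw [show X.dir (t + 1) = fun ω => _ from funext (X.dir_succ t)]
    exact (h3'.fun_const_smul _).fun_add (h6.fun_const_smul _)

lemma measurable_query (h : BoundedScore pol Mg Mh) (t : ℕ) : Measurable[X.ℱ t] (X.query t) :=
  (X.measurable_aux h t).2.1

lemma setIntegral_traj_pair [IsProbabilityMeasure μ] (t : ℕ) {p p' : Fin n × ℕ} (hp : p ≠ p')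
    {E : Set Ω} (hE : MeasurableSet[X.ℱ t] E) {B B' : Set (Fin H → S × A)}
    (hB : MeasurableSet B) (hB' : MeasurableSet B') :
    ∫ ω in E, (X.traj t p.1 p.2 ⁻¹' B ∩ X.traj t p'.1 p'.2 ⁻¹' B').indicator (fun _ => (1 : ℝ)) ω ∂μ
      = ∫ ω in E, (finTrajLaw mdp pol (X.query t ω) H).real B
        * (finTrajLaw mdp pol (X.query t ω) H).real B' ∂μ := by
  classical
  have h1 := X.condLaw_traj t {p, p'} (fun q => if q = p then B else B') fun q => by
    split_ifs <;> assumption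
  have e : (⋂ q ∈ ({p, p'} : Finset (Fin n × ℕ)),
      X.traj t q.1 q.2 ⁻¹' (if q = p then B else B'))
      = X.traj t p.1 p.2 ⁻¹' B ∩ X.traj t p'.1 p'.2 ⁻¹' B' := by
    ext ω; simp [hp.symm]
  rw [e] at h1
  simp only [Finset.prod_pair hp, if_true, hp.symm, if_false] at h1
  have hm : ∀ q : Fin n × ℕ, Measurable (X.traj t q.1 q.2) := fun q =>
    (X.measurable_traj t q.1 q.2).mono (X.ℱ.le _) le_rfl
  rw [← setIntegral_condExp (X.ℱ.le t) ((integrable_const (1 : ℝ)).indicator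
    ((hm p hB).inter (hm p' hB'))) hE]
  exact integral_congr_ae (ae_restrict_of_ae h1)

end

end Execution

/-! ### The error of one stochastic gradient -/

section SampleError

variable {S A : Type*} [MeasurableSpace S] [MeasurableSpace A] {d : ℕ} {pol : Policy S A d}
  {Mg Mh : ℝ}

/-- The error of a single stochastic gradient. -/
noncomputable def sampleError (mdp : MDP S A) (pol : Policy S A d) (H : ℕ)
    (p : Param d × (Fin H → S × A)) : Param d :=
  stochGrad mdp pol H p.2 p.1 - truncGrad mdp pol H p.1

lemma BoundedScore.measurable_sampleError (h : BoundedScore pol Mg Mh) (mdp : MDP S A) (H : ℕ) :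
    Measurable (sampleError mdp pol H) :=
  (h.measurable_stochGrad mdp H).fun_sub
    ((h.continuous_truncGrad mdp H).measurable.comp measurable_fst)

lemma BoundedScore.norm_truncGrad_le (h : BoundedScore pol Mg Mh) (mdp : MDP S A) (H : ℕ)
    (θ : Param d) : ‖truncGrad mdp pol H θ‖ ≤ mdp.rmax * (H * Mg * H) := by
  have h1 := h.integral_inner_stochGrad mdp H θ (truncGrad mdp pol H θ)
  have h2 : ‖∫ τ, inner ℝ (stochGrad mdp pol H τ θ) (truncGrad mdp pol H θ)
      ∂(finTrajLaw mdp pol θ H)‖ ≤ mdp.rmax * (H * Mg * H) * ‖truncGrad mdp pol H θ‖ := by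
    refine (norm_integral_le_of_norm_le_const (C := mdp.rmax * (H * Mg * H) *
      ‖truncGrad mdp pol H θ‖) (ae_of_all _ fun τ => ?_)).trans_eq (by simp)
    exact (norm_inner_le_norm _ _).trans
      (mul_le_mul_of_nonneg_right (h.norm_stochGrad_le mdp H τ θ) (norm_nonneg _))
  rw [h1, real_inner_self_eq_norm_sq, Real.norm_of_nonneg (sq_nonneg _), sq] at h2
  rcases (norm_nonneg (truncGrad mdp pol H θ)).eq_or_lt with h3 | h3
  · rw [← h3]
    have := mdp.rmax_pos.le
    have := h.Mg_pos.le
    positivity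
  · exact le_of_mul_le_mul_right h2 h3

lemma BoundedScore.norm_sampleError_le (h : BoundedScore pol Mg Mh) (mdp : MDP S A) (H : ℕ)
    (p : Param d × (Fin H → S × A)) :
    ‖sampleError mdp pol H p‖ ≤ 2 * (mdp.rmax * (H * Mg * H)) := by
  refine (norm_sub_le _ _).trans ?_
  linarith [h.norm_stochGrad_le mdp H p.2 p.1, h.norm_truncGrad_le mdp H p.1]

lemma BoundedScore.integral_inner_sampleError (h : BoundedScore pol Mg Mh) (mdp : MDP S A) (H : ℕ)
    (θ u : Param d) :
    ∫ τ, inner ℝ (sampleError mdp pol H (θ, τ)) u ∂(finTrajLaw mdp pol θ H) = 0 := by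
  have hm : Measurable fun τ : Fin H → S × A => inner ℝ (stochGrad mdp pol H τ θ) u :=
    Measurable.inner_const (h.measurable_stochGrad_left mdp H θ)
  have hi : Integrable (fun τ => inner ℝ (stochGrad mdp pol H τ θ) u)
      (finTrajLaw mdp pol θ H) :=
    Integrable.of_bound hm.aestronglyMeasurable (mdp.rmax * (H * Mg * H) * ‖u‖)
      (ae_of_all _ fun τ => (norm_inner_le_norm _ _).trans
        (mul_le_mul_of_nonneg_right (h.norm_stochGrad_le mdp H τ θ) (norm_nonneg _)))
  simp only [sampleError, inner_sub_left]
  rw [integral_sub hi (integrable_const _), h.integral_inner_stochGrad]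
  simp

end SampleError

/-! ### The error of an aggregated batch -/

namespace Execution

section

variable {S A Ω : Type*} [MeasurableSpace S] [MeasurableSpace A] [mΩ : MeasurableSpace Ω]
  {μ : Measure Ω} {d : ℕ} {mdp : MDP S A} {pol : Policy S A d} {n : ℕ}
  {hdot : Fin n → ℝ} {κ : ℝ} {θ₀ : Param d} {η α : ℝ} {Minit M H : ℕ} {Mg Mh : ℝ}
  (X : Execution μ mdp pol hdot κ θ₀ η α Minit M H)

/-- Two gradients of a batch are computed from conditionally i.i.d. trajectories. -/
lemma integral_arrivalTraj [IsProbabilityMeasure μ] (h : BoundedScore pol Mg Mh) (t : ℕ)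
    {j j' : ℕ} (hjj' : j ≠ j') {F : Ω × (Fin H → S × A) × (Fin H → S × A) → ℝ}
    (hF : Measurable[@Prod.instMeasurableSpace _ _ (X.ℱ t) _] F) {C : ℝ} (hC : ∀ p, ‖F p‖ ≤ C) :
    ∫ ω, F (ω, X.arrivalTraj t j ω, X.arrivalTraj t j' ω) ∂μ
      = ∫ ω, ∫ x, ∫ y, F (ω, x, y) ∂(finTrajLaw mdp pol (X.query t ω) H)
        ∂(finTrajLaw mdp pol (X.query t ω) H) ∂μ := by
  have hq := X.measurable_query h t
  have := integral_selection (μ := μ) (X.ℱ.le t)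
    (K := (h.trajKernel mdp H).comap (X.query t) hq)
    (f := fun p : Fin n × ℕ => X.traj t p.1 p.2)
    (fun p => (X.measurable_traj t p.1 p.2).mono (X.ℱ.le _) le_rfl)
    (X.measurable_arrival t j) (X.measurable_arrival t j')
    (fun ω => fun he => hjj' (X.arrival_injective t ω he))
    (fun p p' E B B' hp hE hB hB' => X.setIntegral_traj_pair t hp hE hB hB') hF hC
  exact this

lemma integral_inner_sampleError_left [IsProbabilityMeasure μ] (h : BoundedScore pol Mg Mh)
    (t j : ℕ) {V : Ω → Param d}
    (hV : Measurable[X.ℱ t] V) {C : ℝ} (hC : ∀ ω, ‖V ω‖ ≤ C) :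
    ∫ ω, inner ℝ (sampleError mdp pol H (X.query t ω, X.arrivalTraj t j ω)) (V ω) ∂μ = 0 := by
  have hq := X.measurable_query h t
  have hF : Measurable[@Prod.instMeasurableSpace _ _ (X.ℱ t) _]
      fun p : Ω × (Fin H → S × A) × (Fin H → S × A) =>
        inner ℝ (sampleError mdp pol H (X.query t p.1, p.2.1)) (V p.1) := by
    refine Measurable.inner ((h.measurable_sampleError mdp H).comp ?_) ?_
    · exact (hq.comp (@measurable_fst _ _ (X.ℱ t) _)).prodMk
        (measurable_fst.comp (@measurable_snd _ _ (X.ℱ t) _))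
    · exact hV.comp (@measurable_fst _ _ (X.ℱ t) _)
  -- The second trajectory, at index `j + 1`, is a dummy: the integrand ignores it.
  rw [X.integral_arrivalTraj h t (Nat.succ_ne_self j).symm hF
    (C := 2 * (mdp.rmax * (H * Mg * H)) * C) fun p => (norm_inner_le_norm _ _).trans
      (mul_le_mul (h.norm_sampleError_le mdp H _) (hC _) (norm_nonneg _)
        ((norm_nonneg _).trans (h.norm_sampleError_le mdp H (X.query t p.1, p.2.1))))]
  simp [h.integral_inner_sampleError]

lemma integral_inner_sampleError_pair [IsProbabilityMeasure μ] (h : BoundedScore pol Mg Mh)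
    (t : ℕ) {j j' : ℕ}
    (hjj' : j ≠ j') :
    ∫ ω, inner ℝ (sampleError mdp pol H (X.query t ω, X.arrivalTraj t j ω))
      (sampleError mdp pol H (X.query t ω, X.arrivalTraj t j' ω)) ∂μ = 0 := by
  have hq := X.measurable_query h t
  have hF : Measurable[@Prod.instMeasurableSpace _ _ (X.ℱ t) _]
      fun p : Ω × (Fin H → S × A) × (Fin H → S × A) =>
        inner ℝ (sampleError mdp pol H (X.query t p.1, p.2.1))
          (sampleError mdp pol H (X.query t p.1, p.2.2)) := by
    refine Measurable.inner ((h.measurable_sampleError mdp H).comp ?_)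
      ((h.measurable_sampleError mdp H).comp ?_)
    · exact (hq.comp (@measurable_fst _ _ (X.ℱ t) _)).prodMk
        (measurable_fst.comp (@measurable_snd _ _ (X.ℱ t) _))
    · exact (hq.comp (@measurable_fst _ _ (X.ℱ t) _)).prodMk
        (measurable_snd.comp (@measurable_snd _ _ (X.ℱ t) _))
  rw [X.integral_arrivalTraj h t hjj' hF
    (C := 2 * (mdp.rmax * (H * Mg * H)) * (2 * (mdp.rmax * (H * Mg * H))))
      fun p => (norm_inner_le_norm _ _).trans
      (mul_le_mul (h.norm_sampleError_le mdp H _) (h.norm_sampleError_le mdp H _) (norm_nonneg _)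
        ((norm_nonneg _).trans (h.norm_sampleError_le mdp H (X.query t p.1, p.2.1))))]
  have e : ∀ ω x, ∫ y, inner ℝ (sampleError mdp pol H (X.query t ω, x))
      (sampleError mdp pol H (X.query t ω, y)) ∂(finTrajLaw mdp pol (X.query t ω) H) = 0 :=
    fun ω x => by
      simp only [real_inner_comm (sampleError mdp pol H (X.query t ω, _))
        (sampleError mdp pol H (X.query t ω, x))]
      exact h.integral_inner_sampleError mdp H _ _
  simp [e]

lemma integral_norm_sampleError_sq_le [IsProbabilityMeasure μ] (h : BoundedScore pol Mg Mh)
    (t j : ℕ) :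
    ∫ ω, ‖sampleError mdp pol H (X.query t ω, X.arrivalTraj t j ω)‖ ^ 2 ∂μ ≤ sigmaSq mdp Mg := by
  have hq := X.measurable_query h t
  have hF : Measurable[@Prod.instMeasurableSpace _ _ (X.ℱ t) _]
      fun p : Ω × (Fin H → S × A) × (Fin H → S × A) =>
        ‖sampleError mdp pol H (X.query t p.1, p.2.1)‖ ^ 2 := by
    refine ((h.measurable_sampleError mdp H).norm.pow_const 2).comp ?_
    exact (hq.comp (@measurable_fst _ _ (X.ℱ t) _)).prodMk
        (measurable_fst.comp (@measurable_snd _ _ (X.ℱ t) _))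
  rw [X.integral_arrivalTraj h t (Nat.succ_ne_self j).symm hF
    (C := (2 * (mdp.rmax * (H * Mg * H))) ^ 2) fun p => by
      rw [norm_pow, norm_norm]
      exact pow_le_pow_left₀ (norm_nonneg _) (h.norm_sampleError_le mdp H _) 2]
  simp only [integral_const, probReal_univ, smul_eq_mul, one_mul]
  have : ∫ ω, ∫ x, ‖sampleError mdp pol H (X.query t ω, x)‖ ^ 2
      ∂(finTrajLaw mdp pol (X.query t ω) H) ∂μ ≤ ∫ _, sigmaSq mdp Mg ∂μ :=
    integral_mono_of_nonneg (ae_of_all _ fun ω => integral_nonneg fun x => sq_nonneg _)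
      (integrable_const _) (ae_of_all _ fun ω => h.integral_norm_stochGrad_sub_sq_le mdp H _)
  simpa using this

/-- The error of the gradient aggregated in call `t`. -/
noncomputable def noise (t : ℕ) (ω : Ω) : Param d :=
  X.g t ω - truncGrad mdp pol H (X.query t ω)

lemma noise_eq (t : ℕ) (hB : 0 < X.size t) (ω : Ω) : X.noise t ω = (1 / X.size t : ℝ) •
    ∑ j ∈ Finset.range (X.size t), sampleError mdp pol H (X.query t ω, X.arrivalTraj t j ω) := by
  have : (X.size t : ℝ) ≠ 0 := by exact_mod_cast hB.ne'
  rw [noise, X.g_eq_sum]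
  simp only [sampleError, Finset.sum_sub_distrib, ← Finset.smul_sum, smul_sub, Finset.sum_const,
    Finset.card_range]
  rw [← Nat.cast_smul_eq_nsmul ℝ, smul_smul, one_div_mul_cancel this, one_smul]

lemma measurable_noise (h : BoundedScore pol Mg Mh) (t : ℕ) :
    Measurable[X.ℱ (t + 1)] (X.noise t) := by
  have hq := X.measurable_query h t
  exact (X.measurable_g_of_query h t hq).fun_sub ((h.continuous_truncGrad mdp H).measurable.comp
    (hq.mono (X.ℱ.mono (Nat.le_succ t)) le_rfl))

lemma norm_noise_le (h : BoundedScore pol Mg Mh) (t : ℕ) (hB : 0 < X.size t) (ω : Ω) :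
    ‖X.noise t ω‖ ≤ 2 * (mdp.rmax * (H * Mg * H)) := by
  have : (0 : ℝ) < X.size t := by exact_mod_cast hB
  rw [X.noise_eq t hB, norm_smul, Real.norm_of_nonneg (by positivity)]
  refine (mul_le_mul_of_nonneg_left (norm_sum_le_of_le _ fun j _ =>
    h.norm_sampleError_le mdp H _) (by positivity)).trans_eq ?_
  rw [Finset.sum_const, Finset.card_range, nsmul_eq_mul]
  field_simp

lemma measurable_sampleError_arrival (h : BoundedScore pol Mg Mh) (t j : ℕ) :
    Measurable fun ω => sampleError mdp pol H (X.query t ω, X.arrivalTraj t j ω) :=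
  (h.measurable_sampleError mdp H).comp
    (((X.measurable_query h t).mono (X.ℱ.le _) le_rfl).prodMk
      ((X.measurable_arrivalTraj t j).mono (X.ℱ.le _) le_rfl))

lemma integral_inner_noise [IsProbabilityMeasure μ] (h : BoundedScore pol Mg Mh) (t : ℕ)
    (hB : 0 < X.size t)
    {V : Ω → Param d} (hV : Measurable[X.ℱ t] V) {C : ℝ} (hC : ∀ ω, ‖V ω‖ ≤ C) :
    ∫ ω, inner ℝ (X.noise t ω) (V ω) ∂μ = 0 := by
  simp only [X.noise_eq t hB, real_inner_smul_left, sum_inner]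
  rw [integral_const_mul, integral_finsetSum]
  · simp [X.integral_inner_sampleError_left h t _ hV hC]
  · intro j _
    refine Integrable.of_bound (Measurable.aestronglyMeasurable ?_)
      (2 * (mdp.rmax * (H * Mg * H)) * C) (ae_of_all _ fun ω => (norm_inner_le_norm _ _).trans
      (mul_le_mul (h.norm_sampleError_le mdp H _) (hC _) (norm_nonneg _)
        ((norm_nonneg _).trans (h.norm_sampleError_le mdp H (X.query t ω, X.arrivalTraj t j ω)))))
    exact (X.measurable_sampleError_arrival h t j).inner (hV.mono (X.ℱ.le t) le_rfl)

/-- Distinct sample errors of a batch are uncorrelated, so averaging divides the variance by the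
batch size. -/
lemma integral_norm_noise_sq_le [IsProbabilityMeasure μ] (h : BoundedScore pol Mg Mh) (t : ℕ)
    (hB : 0 < X.size t) :
    ∫ ω, ‖X.noise t ω‖ ^ 2 ∂μ ≤ sigmaSq mdp Mg / X.size t := by
  have hB' : (0 : ℝ) < X.size t := by exact_mod_cast hB
  have hi : ∀ j j', Integrable (fun ω =>
      inner ℝ (sampleError mdp pol H (X.query t ω, X.arrivalTraj t j ω))
        (sampleError mdp pol H (X.query t ω, X.arrivalTraj t j' ω))) μ := fun j j' => by
    refine Integrable.of_bound (Measurable.aestronglyMeasurable ?_)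
      (2 * (mdp.rmax * (H * Mg * H)) * (2 * (mdp.rmax * (H * Mg * H)))) (ae_of_all _ fun ω =>
      (norm_inner_le_norm _ _).trans
      (mul_le_mul (h.norm_sampleError_le mdp H _) (h.norm_sampleError_le mdp H _) (norm_nonneg _)
        ((norm_nonneg _).trans (h.norm_sampleError_le mdp H (X.query t ω, X.arrivalTraj t j ω)))))
    exact (X.measurable_sampleError_arrival h t j).inner (X.measurable_sampleError_arrival h t j')
  have e : ∀ ω, ‖X.noise t ω‖ ^ 2 = (1 / X.size t : ℝ) ^ 2 *
      ∑ j ∈ Finset.range (X.size t), ∑ j' ∈ Finset.range (X.size t),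
        inner ℝ (sampleError mdp pol H (X.query t ω, X.arrivalTraj t j ω))
          (sampleError mdp pol H (X.query t ω, X.arrivalTraj t j' ω)) := fun ω => by
    rw [X.noise_eq t hB, norm_smul, mul_pow, Real.norm_eq_abs, sq_abs,
      ← real_inner_self_eq_norm_sq, sum_inner]
    simp only [inner_sum]
  simp only [e]
  rw [integral_const_mul, integral_finsetSum _ fun j _ => integrable_finsetSum _ fun j' _ => hi j j']
  have e2 : ∀ j ∈ Finset.range (X.size t), ∫ ω, ∑ j' ∈ Finset.range (X.size t),
        inner ℝ (sampleError mdp pol H (X.query t ω, X.arrivalTraj t j ω))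
          (sampleError mdp pol H (X.query t ω, X.arrivalTraj t j' ω)) ∂μ ≤ sigmaSq mdp Mg :=
    fun j hj => by
      rw [integral_finsetSum _ fun j' _ => hi j j', Finset.sum_eq_single_of_mem j hj
        fun j' _ hne => X.integral_inner_sampleError_pair h t hne.symm]
      simp only [real_inner_self_eq_norm_sq]
      exact X.integral_norm_sampleError_sq_le h t j
  refine (mul_le_mul_of_nonneg_left (Finset.sum_le_card_nsmul _ _ _ e2) (sq_nonneg _)).trans_eq ?_
  rw [Finset.card_range, nsmul_eq_mul]
  field_simp

end

end Execution

/-! ### Taylor estimates and gradient transport -/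

section Taylor

variable {E F : Type*} [NormedAddCommGroup E] [NormedSpace ℝ E] [NormedAddCommGroup F]
  [NormedSpace ℝ F]

/-- The mean value inequality for `f - D y` on the segment; the constant `L` in place of `L / 2` is
good enough here. -/
lemma norm_taylor_le {f : E → F} {D : E → E →L[ℝ] F} {L : ℝ} (hL0 : 0 ≤ L)
    (hf : ∀ x, HasFDerivAt f (D x) x) (hL : ∀ x y, ‖D x - D y‖ ≤ L * ‖x - y‖) (x y : E) :
    ‖f x - f y - D y (x - y)‖ ≤ L * ‖x - y‖ ^ 2 := by
  have h := (convex_segment (𝕜 := ℝ) y x).norm_image_sub_le_of_norm_hasFDerivWithin_le' (f := f)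
    (f' := D) (φ := D y) (C := L * ‖x - y‖) (fun z _ => (hf z).hasFDerivWithinAt)
    (fun z hz => (hL z y).trans (mul_le_mul_of_nonneg_left ?_ hL0)) (left_mem_segment ℝ y x)
    (right_mem_segment ℝ y x)
  · refine h.trans_eq (by ring)
  · obtain ⟨t, ht, rfl⟩ := (segment_eq_image' ℝ y x) ▸ hz
    rw [add_sub_cancel_left, norm_smul, Real.norm_of_nonneg ht.1]
    exact mul_le_of_le_one_left (norm_nonneg _) ht.2

lemma norm_sub_le_of_norm_fderiv_le {f : E → F} {D : E → E →L[ℝ] F} {L : ℝ}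
    (hf : ∀ x, HasFDerivAt f (D x) x) (hL : ∀ x, ‖D x‖ ≤ L) (x y : E) :
    ‖f x - f y‖ ≤ L * ‖x - y‖ :=
  convex_univ.norm_image_sub_le_of_norm_hasFDerivWithin_le
    (fun z _ => (hf z).hasFDerivWithinAt) (fun z _ => hL z) (Set.mem_univ y) (Set.mem_univ x)

/-- The effect of implicit gradient transport: the first order errors of the two gradients
cancel. -/
lemma norm_transport_le {f : E → F} {D : E → E →L[ℝ] F} {L : ℝ} (hL0 : 0 ≤ L)
    (hf : ∀ x, HasFDerivAt f (D x) x) (hL : ∀ x y, ‖D x - D y‖ ≤ L * ‖x - y‖) {η a : ℝ}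
    (hη : 0 < η) (hη1 : η ≤ 1) {x y : E} (hxy : ‖y - x‖ ≤ a) :
    ‖(1 - η) • (f x - f y) + η • (f (y + ((1 - η) / η) • (y - x)) - f y)‖
      ≤ L * a ^ 2 / η := by
  set q := y + ((1 - η) / η) • (y - x)
  have hq : q - y = ((1 - η) / η) • (y - x) := by simp [q]
  have h1 : 0 ≤ 1 - η := sub_nonneg.2 hη1
  have e : (1 - η) • (f x - f y) + η • (f q - f y)
      = (1 - η) • (f x - f y - D y (x - y)) + η • (f q - f y - D y (q - y)) := by
    -- This is the reason for the extrapolation weight `(1 - η) / η`: the linear terms of the two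
    -- increments are opposite, and only the Taylor remainders survive.
    have h2 : η • D y (q - y) = (1 - η) • D y (y - x) := by
      rw [hq, map_smul, smul_smul, mul_div_cancel₀ _ hη.ne']
    have h3 : D y (x - y) = -D y (y - x) := by rw [← map_neg, neg_sub]
    rw [smul_sub (1 - η) (f x - f y), smul_sub η (f q - f y), h2, h3, smul_neg]
    abel
  have hx : ‖f x - f y - D y (x - y)‖ ≤ L * a ^ 2 := by
    refine (norm_taylor_le hL0 hf hL x y).trans ?_
    rw [norm_sub_rev]
    gcongr
  have hq' : ‖f q - f y - D y (q - y)‖ ≤ L * ((1 - η) / η * a) ^ 2 := by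
    refine (norm_taylor_le hL0 hf hL q y).trans ?_
    rw [hq, norm_smul, Real.norm_of_nonneg (by positivity)]
    gcongr
  rw [e]
  refine (norm_add_le _ _).trans ?_
  rw [norm_smul, norm_smul, Real.norm_of_nonneg h1, Real.norm_of_nonneg hη.le]
  refine (add_le_add (mul_le_mul_of_nonneg_left hx h1)
    (mul_le_mul_of_nonneg_left hq' hη.le)).trans ?_
  have : (1 - η) * (L * a ^ 2) + η * (L * ((1 - η) / η * a) ^ 2)
      = (1 - η) * (L * a ^ 2 / η) := by field_simp; ring
  rw [this]
  exact mul_le_of_le_one_left (by positivity) (by linarith)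

end Taylor

/-- The product of `w` with its normalization is `‖w‖ ≥ ‖v‖ - ‖w - v‖`, and replacing `w` by `v`
costs another `‖w - v‖`. For `w = 0` the direction is `0` and the bound still holds. -/
lemma sub_two_mul_norm_sub_le_inner {d : ℕ} (v w : Param d) :
    ‖v‖ - 2 * ‖w - v‖ ≤ inner ℝ v (‖w‖⁻¹ • w) := by
  rcases eq_or_ne w 0 with rfl | hw
  · simp; linarith [norm_nonneg v]
  · have hw' : ‖w‖ ≠ 0 := norm_ne_zero_iff.2 hw
    have h1 : inner ℝ w (‖w‖⁻¹ • w) = ‖w‖ := by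
      rw [real_inner_smul_right, real_inner_self_eq_norm_sq]; field_simp
    have h2 : inner ℝ (w - v) (‖w‖⁻¹ • w) ≤ ‖w - v‖ := by
      refine (real_inner_le_norm _ _).trans_eq ?_
      rw [norm_smul, norm_inv, norm_norm, inv_mul_cancel₀ hw', mul_one]
    rw [inner_sub_left, h1] at h2
    have h3 := norm_sub_norm_le v w
    rw [norm_sub_rev] at h3
    linarith

lemma norm_normalize_le {d : ℕ} (w : Param d) : ‖‖w‖⁻¹ • w‖ ≤ 1 := by
  rw [norm_smul, norm_inv, norm_norm]
  exact inv_mul_le_one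

/-! ### Ascent inequalities for the return -/

section Objective

variable {S A : Type*} [MeasurableSpace S] [MeasurableSpace A] {d : ℕ} {pol : Policy S A d}
  {Mg Mh : ℝ}

lemma BoundedScore.Lg_pos (h : BoundedScore pol Mg Mh) (mdp : MDP S A) : 0 < Lg mdp Mg Mh := by
  have := h.Mg_pos
  have := h.Mh_pos
  have := mdp.rmax_pos
  have := sub_pos.2 mdp.γ_lt_one
  rw [Lg]; positivity

lemma BoundedScore.sigmaSq_pos (h : BoundedScore pol Mg Mh) (mdp : MDP S A) :
    0 < sigmaSq mdp Mg := by
  have := h.Mg_pos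
  have := mdp.rmax_pos
  have := sub_pos.2 mdp.γ_lt_one
  rw [sigmaSq]; positivity

lemma BoundedScore.hasFDerivAt_J_fderiv (h : BoundedScore pol Mg Mh) (mdp : MDP S A)
    (θ : Param d) : HasFDerivAt (J mdp pol) (fderiv ℝ (J mdp pol) θ) θ :=
  ((h.hasFDerivAt_J mdp).1 θ).differentiableAt.hasFDerivAt

lemma BoundedScore.hasFDerivAt_fderiv_J (h : BoundedScore pol Mg Mh) (mdp : MDP S A)
    (θ : Param d) :
    HasFDerivAt (fderiv ℝ (J mdp pol)) (fderiv ℝ (fderiv ℝ (J mdp pol)) θ) θ :=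
  ((h.hasFDerivAt_J mdp).2 θ).differentiableAt.hasFDerivAt

lemma BoundedScore.le_J_step (h : BoundedScore pol Mg Mh) (mdp : MDP S A) (θ u : Param d) :
    J mdp pol θ + inner ℝ (gradient (J mdp pol) θ) u - Lg mdp Mg Mh * ‖u‖ ^ 2
      ≤ J mdp pol (θ + u) := by
  have h1 := norm_taylor_le (h.Lg_pos mdp).le (h.hasFDerivAt_J_fderiv mdp)
    (norm_sub_le_of_norm_fderiv_le (F := Param d →L[ℝ] ℝ) (h.hasFDerivAt_fderiv_J mdp)
      (h.norm_fderiv_fderiv_J_le mdp)) (θ + u) θ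
  rw [add_sub_cancel_left, Real.norm_eq_abs, abs_le] at h1
  rw [gradient_eq_rep, inner_rep]
  linarith [h1.1]

/-- A step of `1 / (2 L_g)` times the gradient gains at least `‖∇J‖² / (4 L_g)`, which cannot exceed
`Δ`. This settles the case of small `Δ`. -/
lemma BoundedScore.norm_gradient_sq_le (h : BoundedScore pol Mg Mh) (mdp : MDP S A) {θ : Param d}
    {Δ : ℝ} (hΔ : ∀ ϑ, J mdp pol ϑ ≤ J mdp pol θ + Δ) :
    ‖gradient (J mdp pol) θ‖ ^ 2 ≤ 4 * Lg mdp Mg Mh * Δ := by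
  have hL := h.Lg_pos mdp
  have h1 := h.le_J_step mdp θ ((1 / (2 * Lg mdp Mg Mh)) • gradient (J mdp pol) θ)
  have h2 := hΔ (θ + (1 / (2 * Lg mdp Mg Mh)) • gradient (J mdp pol) θ)
  rw [real_inner_smul_right, real_inner_self_eq_norm_sq, norm_smul, mul_pow, Real.norm_eq_abs,
    sq_abs] at h1
  have h3 : 1 / (2 * Lg mdp Mg Mh) * ‖gradient (J mdp pol) θ‖ ^ 2 - Lg mdp Mg Mh *
      ((1 / (2 * Lg mdp Mg Mh)) ^ 2 * ‖gradient (J mdp pol) θ‖ ^ 2)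
      = ‖gradient (J mdp pol) θ‖ ^ 2 / (4 * Lg mdp Mg Mh) := by field_simp; ring
  have h4 : ‖gradient (J mdp pol) θ‖ ^ 2 / (4 * Lg mdp Mg Mh) ≤ Δ := by linarith
  rw [div_le_iff₀ (by positivity)] at h4
  linarith

lemma bddAbove_J (mdp : MDP S A) (pol : Policy S A d) : BddAbove (Set.range (J mdp pol)) :=
  ⟨mdp.rmax / (1 - mdp.γ), by
    rintro _ ⟨θ, rfl⟩
    exact (le_abs_self _).trans (abs_J_le mdp pol θ)⟩

lemma BoundedScore.continuous_gradient_J (h : BoundedScore pol Mg Mh) (mdp : MDP S A) :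
    Continuous (gradient (J mdp pol)) :=
  continuous_rep.comp (continuous_iff_continuousAt.2 fun x =>
    (h.hasFDerivAt_fderiv_J mdp x).continuousAt)

end Objective

/-! ### Error of the search direction and convergence -/

namespace Execution

section

variable {S A Ω : Type*} [MeasurableSpace S] [MeasurableSpace A] [mΩ : MeasurableSpace Ω]
  {μ : Measure Ω} {d : ℕ} {mdp : MDP S A} {pol : Policy S A d} {n : ℕ}
  {hdot : Fin n → ℝ} {κ : ℝ} {θ₀ : Param d} {η α : ℝ} {Minit M H : ℕ} {Mg Mh : ℝ}
  (X : Execution μ mdp pol hdot κ θ₀ η α Minit M H)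

/-- The part of the error of `dir t` due to the sampling noise. -/
noncomputable def avgNoise : ℕ → Ω → Param d
  | 0, ω => X.noise 0 ω
  | t + 1, ω => (1 - η) • avgNoise t ω + η • X.noise (t + 1) ω

lemma measurable_avgNoise (h : BoundedScore pol Mg Mh) (t : ℕ) :
    Measurable[X.ℱ (t + 1)] (X.avgNoise t) := by
  induction t with
  | zero => exact X.measurable_noise h 0
  | succ t ih =>
    exact ((ih.mono (X.ℱ.mono (Nat.le_succ _)) le_rfl).fun_const_smul (1 - η)).fun_add
      ((X.measurable_noise h (t + 1)).fun_const_smul η)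

lemma norm_avgNoise_le (h : BoundedScore pol Mg Mh) (hB : ∀ t, 0 < X.size t) (hη : 0 ≤ η)
    (hη1 : η ≤ 1) (t : ℕ) (ω : Ω) : ‖X.avgNoise t ω‖ ≤ 2 * (mdp.rmax * (H * Mg * H)) := by
  induction t with
  | zero => exact X.norm_noise_le h 0 (hB 0) ω
  | succ t ih =>
    refine (norm_add_le _ _).trans ?_
    rw [norm_smul, norm_smul, Real.norm_of_nonneg hη, Real.norm_of_nonneg (sub_nonneg.2 hη1)]
    have h1 := mul_le_mul_of_nonneg_left ih (sub_nonneg.2 hη1)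
    have h2 := mul_le_mul_of_nonneg_left (X.norm_noise_le h (t + 1) (hB _) ω) hη
    linarith

/-- Apart from the noise, the error satisfies `e_{t+1} ≤ (1 - η) e_t + η b + L_h α² / η`, the last
term from transport. The claimed bound is the fixed point of this recursion and holds surely. -/
lemma norm_dir_sub_le (h : BoundedScore pol Mg Mh) {Lh : ℝ} (hLh : 0 ≤ Lh)
    (hl : HessianLipschitz (J mdp pol) Lh) (hη : 0 < η) (hη1 : η ≤ 1) (hα : 0 ≤ α) {b : ℝ}
    (hb : ∀ θ, ‖truncGrad mdp pol H θ - gradient (J mdp pol) θ‖ ≤ b) (t : ℕ) (ω : Ω) :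
    ‖X.dir t ω - gradient (J mdp pol) (X.θ t ω) - X.avgNoise t ω‖ ≤ b + Lh * α ^ 2 / η ^ 2 := by
  induction t with
  | zero =>
    have e : X.dir 0 ω - gradient (J mdp pol) (X.θ 0 ω) - X.avgNoise 0 ω
        = truncGrad mdp pol H θ₀ - gradient (J mdp pol) θ₀ := by
      rw [avgNoise, noise, X.dir_zero, X.θ_zero, X.query_zero]; abel
    rw [e]
    exact (hb _).trans (le_add_of_nonneg_right (by positivity))
  | succ t ih =>
    have hstep : ‖X.θ (t + 1) ω - X.θ t ω‖ ≤ α := by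
      rw [X.θ_succ, add_sub_cancel_left, norm_smul, Real.norm_of_nonneg hα]
      exact mul_le_of_le_one_right hα (norm_normalize_le _)
    have h1 := norm_transport_le (F := Param d →L[ℝ] ℝ) hLh (h.hasFDerivAt_fderiv_J mdp) hl.2
      hη hη1 hstep
    rw [← X.query_succ, ← norm_rep] at h1
    set G := gradient (J mdp pol)
    have e1 : rep ((1 - η) • (fderiv ℝ (J mdp pol) (X.θ t ω)
        - fderiv ℝ (J mdp pol) (X.θ (t + 1) ω)) + η • (fderiv ℝ (J mdp pol) (X.query (t + 1) ω)
        - fderiv ℝ (J mdp pol) (X.θ (t + 1) ω)))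
        = (1 - η) • (G (X.θ t ω) - G (X.θ (t + 1) ω))
          + η • (G (X.query (t + 1) ω) - G (X.θ (t + 1) ω)) := by
      simp [G, gradient, rep]
    rw [e1] at h1
    have e2 : X.dir (t + 1) ω - G (X.θ (t + 1) ω) - X.avgNoise (t + 1) ω
        = (1 - η) • (X.dir t ω - G (X.θ t ω) - X.avgNoise t ω)
          + ((1 - η) • (G (X.θ t ω) - G (X.θ (t + 1) ω))
            + η • (G (X.query (t + 1) ω) - G (X.θ (t + 1) ω)))
          + η • (truncGrad mdp pol H (X.query (t + 1) ω) - G (X.query (t + 1) ω)) := by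
      rw [avgNoise, noise, X.dir_succ]
      module
    rw [e2]
    refine (norm_add₃_le).trans ?_
    rw [norm_smul, norm_smul, Real.norm_of_nonneg hη.le, Real.norm_of_nonneg (sub_nonneg.2 hη1)]
    have h2 := mul_le_mul_of_nonneg_left ih (sub_nonneg.2 hη1)
    have h3 := mul_le_mul_of_nonneg_left (hb (X.query (t + 1) ω)) hη.le
    have e3 : Lh * α ^ 2 / η = η * (Lh * α ^ 2 / η ^ 2) := by field_simp
    rw [e3] at h1
    linarith

lemma integrable_norm_avgNoise_sq [IsProbabilityMeasure μ] (h : BoundedScore pol Mg Mh)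
    (hB : ∀ t, 0 < X.size t) (hη : 0 ≤ η) (hη1 : η ≤ 1) (t : ℕ) :
    Integrable (fun ω => ‖X.avgNoise t ω‖ ^ 2) μ := by
  refine Integrable.of_bound (Measurable.aestronglyMeasurable ?_)
    ((2 * (mdp.rmax * (H * Mg * H))) ^ 2) (ae_of_all _ fun ω => ?_)
  · exact ((X.measurable_avgNoise h t).mono (X.ℱ.le _) le_rfl).norm.pow_const 2
  · rw [norm_pow, norm_norm]
    exact pow_le_pow_left₀ (norm_nonneg _) (X.norm_avgNoise_le h hB hη hη1 t ω) 2

lemma integrable_norm_avgNoise [IsProbabilityMeasure μ] (h : BoundedScore pol Mg Mh)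
    (hB : ∀ t, 0 < X.size t) (hη : 0 ≤ η) (hη1 : η ≤ 1) (t : ℕ) :
    Integrable (fun ω => ‖X.avgNoise t ω‖) μ := by
  refine Integrable.of_bound (Measurable.aestronglyMeasurable ?_)
    (2 * (mdp.rmax * (H * Mg * H))) (ae_of_all _ fun ω => ?_)
  · exact ((X.measurable_avgNoise h t).mono (X.ℱ.le _) le_rfl).norm
  · rw [norm_norm]
    exact X.norm_avgNoise_le h hB hη hη1 t ω

/-- New noise is uncorrelated with the past average, so the variances obey `v_{t+1} ≤ (1 - η)² v_t +
η² σ² / M`. The stationary part is kept by `(1 - η)² η + η² ≤ η`. -/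
lemma integral_norm_avgNoise_sq_le [IsProbabilityMeasure μ] (h : BoundedScore pol Mg Mh)
    (hinit : 0 < Minit) (hM : 0 < M) (hη : 0 ≤ η) (hη1 : η ≤ 1) (t : ℕ) :
    ∫ ω, ‖X.avgNoise t ω‖ ^ 2 ∂μ
      ≤ (1 - η) ^ (2 * t) * (sigmaSq mdp Mg / Minit) + η * (sigmaSq mdp Mg / M) := by
  have hB : ∀ t, 0 < X.size t := fun t => by rw [size]; split_ifs <;> assumption
  have hs : 0 ≤ sigmaSq mdp Mg / M := div_nonneg (h.sigmaSq_pos mdp).le (Nat.cast_nonneg _)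
  induction t with
  | zero =>
    have := X.integral_norm_noise_sq_le h 0 (hB 0)
    rw [size, if_pos rfl] at this
    simp only [avgNoise, mul_zero, pow_zero, one_mul]
    linarith [mul_nonneg hη hs]
  | succ t ih =>
    have hm1 : Measurable (X.noise (t + 1)) := (X.measurable_noise h (t + 1)).mono (X.ℱ.le _) le_rfl
    have hm2 : Measurable (X.avgNoise t) := (X.measurable_avgNoise h t).mono (X.ℱ.le _) le_rfl
    have e : ∀ ω, ‖X.avgNoise (t + 1) ω‖ ^ 2 = ((1 - η) ^ 2 * ‖X.avgNoise t ω‖ ^ 2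
        + 2 * (1 - η) * η * inner ℝ (X.noise (t + 1) ω) (X.avgNoise t ω))
        + η ^ 2 * ‖X.noise (t + 1) ω‖ ^ 2 := fun ω => by
      rw [avgNoise, norm_add_sq_real, norm_smul, norm_smul, real_inner_smul_left,
        real_inner_smul_right, mul_pow, mul_pow, Real.norm_eq_abs, Real.norm_eq_abs, sq_abs, sq_abs,
        real_inner_comm]
      ring
    have i1 := X.integrable_norm_avgNoise_sq h hB hη hη1 t
    have i2 : Integrable (fun ω => inner ℝ (X.noise (t + 1) ω) (X.avgNoise t ω)) μ := by
      have hm3 : Measurable fun ω => inner ℝ (X.noise (t + 1) ω) (X.avgNoise t ω) := hm1.inner hm2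
      refine Integrable.of_bound hm3.aestronglyMeasurable
        (2 * (mdp.rmax * (H * Mg * H)) * (2 * (mdp.rmax * (H * Mg * H)))) (ae_of_all _ fun ω => ?_)
      have h4 := X.norm_noise_le h (t + 1) (hB _) ω
      exact (norm_inner_le_norm _ _).trans (mul_le_mul h4
        (X.norm_avgNoise_le h hB hη hη1 t ω) (norm_nonneg _) ((norm_nonneg _).trans h4))
    have i3 : Integrable (fun ω => ‖X.noise (t + 1) ω‖ ^ 2) μ := by
      refine Integrable.of_bound (hm1.norm.pow_const 2).aestronglyMeasurable
        ((2 * (mdp.rmax * (H * Mg * H))) ^ 2) (ae_of_all _ fun ω => ?_)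
      rw [norm_pow, norm_norm]
      exact pow_le_pow_left₀ (norm_nonneg _) (X.norm_noise_le h (t + 1) (hB _) ω) 2
    simp only [e]
    rw [integral_add ((i1.const_mul _).fun_add (i2.const_mul _)) (i3.const_mul _),
      integral_add (i1.const_mul _) (i2.const_mul _), integral_const_mul, integral_const_mul,
      integral_const_mul, X.integral_inner_noise h (t + 1) (hB _) (X.measurable_avgNoise h t)
        (X.norm_avgNoise_le h hB hη hη1 t)]
    have h5 := X.integral_norm_noise_sq_le h (t + 1) (hB _)
    rw [size, if_neg (Nat.succ_ne_zero t)] at h5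
    have h6 := mul_le_mul_of_nonneg_left ih (sq_nonneg (1 - η))
    have h7 := mul_le_mul_of_nonneg_left h5 (sq_nonneg η)
    have h8 : ((1 - η) ^ 2 * η + η ^ 2) * (sigmaSq mdp Mg / M) ≤ η * (sigmaSq mdp Mg / M) := by
      refine mul_le_mul_of_nonneg_right ?_ hs
      nlinarith [mul_nonneg (mul_nonneg hη hη) (sub_nonneg.2 hη1)]
    have e9 : (1 - η) ^ (2 * (t + 1)) = (1 - η) ^ 2 * (1 - η) ^ (2 * t) := by
      rw [← pow_add]; congr 1; ring
    rw [e9]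
    linarith

/-- Jensen's inequality, then the square root of a sum of squares is at most the sum. -/
lemma integral_norm_avgNoise_le [IsProbabilityMeasure μ] (h : BoundedScore pol Mg Mh)
    (hinit : 0 < Minit) (hM : 0 < M) (hη : 0 ≤ η) (hη1 : η ≤ 1) {ε : ℝ} (hε : 0 ≤ ε)
    (h1 : sigmaSq mdp Mg / Minit ≤ ε ^ 2) (h2 : η * (sigmaSq mdp Mg / M) ≤ (ε / 8) ^ 2) (t : ℕ) :
    ∫ ω, ‖X.avgNoise t ω‖ ∂μ ≤ (1 - η) ^ t * ε + ε / 8 := by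
  have hB : ∀ t, 0 < X.size t := fun t => by rw [size]; split_ifs <;> assumption
  have h1η := sub_nonneg.2 hη1
  refine le_of_sq_le_sq ?_ (by positivity)
  have h3 := X.integral_norm_avgNoise_sq_le h hinit hM hη hη1 t
  have h4 : (∫ ω, ‖X.avgNoise t ω‖ ∂μ) ^ 2 ≤ ∫ ω, ‖X.avgNoise t ω‖ ^ 2 ∂μ := by
    have i1 := X.integrable_norm_avgNoise_sq h hB hη hη1 t
    have i2 := X.integrable_norm_avgNoise h hB hη hη1 t
    set c := ∫ ω, ‖X.avgNoise t ω‖ ∂μ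
    have h5 : 0 ≤ ∫ ω, (‖X.avgNoise t ω‖ - c) ^ 2 ∂μ := integral_nonneg fun ω => sq_nonneg _
    have e : ∀ ω, (‖X.avgNoise t ω‖ - c) ^ 2
        = (‖X.avgNoise t ω‖ ^ 2 + (-2 * c) * ‖X.avgNoise t ω‖) + c ^ 2 := fun ω => by ring
    simp only [e] at h5
    rw [integral_add (i1.fun_add (i2.const_mul _)) (integrable_const _),
      integral_add i1 (i2.const_mul _), integral_const_mul] at h5
    simp only [integral_const, probReal_univ, smul_eq_mul, one_mul] at h5
    have : -2 * c * ∫ ω, ‖X.avgNoise t ω‖ ∂μ = -2 * c * c := rfl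
    nlinarith
  have h6 : (1 - η) ^ (2 * t) * (sigmaSq mdp Mg / Minit) ≤ ((1 - η) ^ t * ε) ^ 2 := by
    rw [mul_pow, ← pow_mul, mul_comm t 2]
    exact mul_le_mul_of_nonneg_left h1 (by positivity)
  have h7 : 0 ≤ (1 - η) ^ t * ε * (ε / 8) := by positivity
  nlinarith

lemma integrable_norm_gradient [IsProbabilityMeasure μ] (h : BoundedScore pol Mg Mh) (t : ℕ) :
    Integrable (fun ω => ‖gradient (J mdp pol) (X.θ t ω)‖) μ := by
  have hθ : Measurable (X.θ t) := (X.measurable_aux h t).1.mono (X.ℱ.le _) le_rfl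
  have hm : Measurable fun ω => ‖gradient (J mdp pol) (X.θ t ω)‖ :=
    ((h.continuous_gradient_J mdp).measurable.comp hθ).norm
  refine Integrable.of_bound hm.aestronglyMeasurable
    (mdp.rmax * Mg / (1 - mdp.γ) ^ 2) (ae_of_all _ fun ω => ?_)
  rw [norm_norm, gradient_eq_rep, norm_rep]
  exact h.norm_fderiv_J_le mdp _

/-- The gains `J (θ_{t+1}) - J (θ_t)` telescope to at most `Δ`; every step loses twice the error of
its direction and the smoothness term. -/
lemma mul_sum_norm_gradient_le (h : BoundedScore pol Mg Mh) {Δ r : ℝ} (hα : 0 ≤ α)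
    (hsup : ∀ θ, J mdp pol θ ≤ J mdp pol θ₀ + Δ)
    (hr : ∀ t ω, ‖X.dir t ω - gradient (J mdp pol) (X.θ t ω) - X.avgNoise t ω‖ ≤ r) (T : ℕ)
    (ω : Ω) :
    ∑ t ∈ Finset.range T, α * ‖gradient (J mdp pol) (X.θ t ω)‖
      ≤ Δ + ∑ t ∈ Finset.range T, (2 * α * (‖X.avgNoise t ω‖ + r) + Lg mdp Mg Mh * α ^ 2) := by
  have hstep : ∀ t, α * ‖gradient (J mdp pol) (X.θ t ω)‖ ≤ J mdp pol (X.θ (t + 1) ω)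
      - J mdp pol (X.θ t ω) + (2 * α * (‖X.avgNoise t ω‖ + r) + Lg mdp Mg Mh * α ^ 2) := fun t => by
    have h1 := h.le_J_step mdp (X.θ t ω) (α • (‖X.dir t ω‖⁻¹ • X.dir t ω))
    rw [← X.θ_succ, real_inner_smul_right] at h1
    have h2 := mul_le_mul_of_nonneg_left
      (sub_two_mul_norm_sub_le_inner (gradient (J mdp pol) (X.θ t ω)) (X.dir t ω)) hα
    have h3 : ‖X.dir t ω - gradient (J mdp pol) (X.θ t ω)‖ ≤ ‖X.avgNoise t ω‖ + r := by
      have := norm_sub_norm_le (X.dir t ω - gradient (J mdp pol) (X.θ t ω)) (X.avgNoise t ω)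
      linarith [hr t ω]
    have h4 : ‖α • (‖X.dir t ω‖⁻¹ • X.dir t ω)‖ ^ 2 ≤ α ^ 2 := by
      refine pow_le_pow_left₀ (norm_nonneg _) ?_ 2
      rw [norm_smul, Real.norm_of_nonneg hα]
      exact mul_le_of_le_one_right hα (norm_normalize_le _)
    have h5 := mul_le_mul_of_nonneg_left h4 (h.Lg_pos mdp).le
    have h6 := mul_le_mul_of_nonneg_left h3 (mul_nonneg zero_le_two hα)
    linarith
  refine (Finset.sum_le_sum fun t _ => hstep t).trans ?_
  rw [Finset.sum_add_distrib, Finset.sum_range_sub fun t => J mdp pol (X.θ t ω), X.θ_zero]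
  linarith [hsup (X.θ T ω)]

/-- The initial noise of size `ε` decays geometrically and contributes `2 ε / η` in total. The
persistent errors contribute `2 (ε/8 + ε/8) + ε/8 ≤ 3 ε / 4` per step. -/
lemma expGradNorm_le [IsProbabilityMeasure μ] (h : BoundedScore pol Mg Mh) {Lh : ℝ} (hLh : 0 ≤ Lh)
    (hl : HessianLipschitz (J mdp pol) Lh) (hη : 0 < η) (hη1 : η ≤ 1) (hα : 0 < α) {Δ ε b : ℝ}
    (hε : 0 ≤ ε) (hsup : ∀ θ, J mdp pol θ ≤ J mdp pol θ₀ + Δ) (hinit : 0 < Minit) (hM : 0 < M)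
    (h1 : sigmaSq mdp Mg / Minit ≤ ε ^ 2) (h2 : η * (sigmaSq mdp Mg / M) ≤ (ε / 8) ^ 2)
    (hb : ∀ θ, ‖truncGrad mdp pol H θ - gradient (J mdp pol) θ‖ ≤ b)
    (h3 : b + Lh * α ^ 2 / η ^ 2 ≤ ε / 8) (h4 : Lg mdp Mg Mh * α ≤ ε / 8) {T : ℕ} (hT : 0 < T) :
    X.expGradNorm T ≤ (Δ / α + 2 * ε / η) / T + 3 * ε / 4 := by
  have hB : ∀ t, 0 < X.size t := fun t => by rw [size]; split_ifs <;> assumption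
  have hT' : (0 : ℝ) < T := by exact_mod_cast hT
  set r := b + Lh * α ^ 2 / η ^ 2
  have iG := fun t => X.integrable_norm_gradient h t
  have iN := fun t => X.integrable_norm_avgNoise h hB hη.le hη1 t
  have iR : ∀ t, Integrable (fun ω => 2 * α * (‖X.avgNoise t ω‖ + r) + Lg mdp Mg Mh * α ^ 2) μ :=
    fun t => (((iN t).fun_add (integrable_const _)).const_mul _).fun_add (integrable_const _)
  have key : ∫ ω, ∑ t ∈ Finset.range T, α * ‖gradient (J mdp pol) (X.θ t ω)‖ ∂μ
      ≤ ∫ ω, (Δ + ∑ t ∈ Finset.range T, (2 * α * (‖X.avgNoise t ω‖ + r)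
        + Lg mdp Mg Mh * α ^ 2)) ∂μ :=
    integral_mono (integrable_finsetSum _ fun t _ => (iG t).const_mul α)
      ((integrable_const _).fun_add (integrable_finsetSum _ fun t _ => iR t)) fun ω =>
        X.mul_sum_norm_gradient_le h hα.le hsup
          (X.norm_dir_sub_le h hLh hl hη hη1 hα.le hb) T ω
  rw [integral_finsetSum _ fun t _ => (iG t).const_mul α,
    integral_add (integrable_const _) (integrable_finsetSum _ fun t _ => iR t),
    integral_finsetSum _ fun t _ => iR t] at key
  simp only [integral_const_mul, integral_const, probReal_univ, smul_eq_mul, one_mul] at key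
  rw [← Finset.mul_sum] at key
  have hterm : ∀ t ∈ Finset.range T,
      ∫ ω, (2 * α * (‖X.avgNoise t ω‖ + r) + Lg mdp Mg Mh * α ^ 2) ∂μ
        ≤ α * (2 * ε * (1 - η) ^ t + 3 * ε / 4) := fun t _ => by
    rw [integral_add (((iN t).fun_add (integrable_const _)).const_mul _) (integrable_const _),
      integral_const_mul, integral_add (iN t) (integrable_const _)]
    simp only [integral_const, probReal_univ, smul_eq_mul, one_mul]
    have h5 := X.integral_norm_avgNoise_le h hinit hM hη.le hη1 hε h1 h2 t
    have h6 : (∫ ω, ‖X.avgNoise t ω‖ ∂μ) + r ≤ (1 - η) ^ t * ε + ε / 4 := by linarith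
    have h7 := mul_le_mul_of_nonneg_left h6 (mul_nonneg zero_le_two hα.le)
    have h8 := mul_le_mul_of_nonneg_right h4 hα.le
    nlinarith [mul_nonneg hα.le hε]
  have hgeom : ∑ t ∈ Finset.range T, (1 - η) ^ t ≤ 1 / η := by
    have h5 := mul_neg_geom_sum (1 - η) T
    rw [le_div_iff₀ hη]
    have h6 : 0 ≤ (1 - η) ^ T := pow_nonneg (sub_nonneg.2 hη1) T
    rw [sub_sub_cancel, mul_comm] at h5
    linarith
  have hsum := Finset.sum_le_sum hterm
  rw [← Finset.mul_sum, Finset.sum_add_distrib, ← Finset.mul_sum, Finset.sum_const,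
    Finset.card_range, nsmul_eq_mul] at hsum
  have h9 : α * (2 * ε * ∑ t ∈ Finset.range T, (1 - η) ^ t + T * (3 * ε / 4))
      ≤ α * (2 * ε * (1 / η) + T * (3 * ε / 4)) := by gcongr
  have h10 : α * ∑ t ∈ Finset.range T, ∫ ω, ‖gradient (J mdp pol) (X.θ t ω)‖ ∂μ
      ≤ α * (Δ / α + 2 * ε / η + T * (3 * ε / 4)) := by
    have e : α * (Δ / α + 2 * ε / η + T * (3 * ε / 4))
        = Δ + α * (2 * ε * (1 / η) + T * (3 * ε / 4)) := by field_simp; ring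
    rw [e]; linarith
  have h11 := le_of_mul_le_mul_left h10 hα
  rw [expGradNorm]
  refine (mul_le_mul_of_nonneg_left h11 (by positivity)).trans_eq ?_
  field_simp

end

end Execution

/-! ### Duration of the aggregation calls -/

section ArrivalTime

variable {n : ℕ} {hdot : Fin n → ℝ}

lemma harmonicMean_pos (hpos : ∀ i, 0 < hdot i) (m : Fin n) : 0 < harmonicMean hdot m := by
  have : 0 < ∑ i ∈ Finset.Iic m, 1 / hdot i :=
    Finset.sum_pos (fun i _ => one_div_pos.2 (hpos i)) ⟨m, Finset.mem_Iic.2 le_rfl⟩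
  rw [harmonicMean]; positivity

lemma sum_delivered_le (order : ℕ → Fin n) (j : ℕ) (s : Finset (Fin n)) :
    ∑ i ∈ s, delivered order j i ≤ j := by
  refine (Finset.sum_le_sum_of_subset (Finset.subset_univ s)).trans_eq ?_
  simp only [delivered]
  rw [← Finset.card_eq_sum_card_fiberwise (f := order) (t := Finset.univ) fun _ _ => by simp,
    Finset.card_range]

/-- When the last gradient arrives at time `t`, the pending gradient of agent `i` finishes no
earlier, so `t - κ` is at most `delivered + 1` times the cost of one gradient. Dividing by the cost
and summing over the first `m` agents, whose deliveries total at most `B`, gives the bound. -/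
lemma arrivalTime_le (hpos : ∀ i, 0 < hdot i) {κ : ℝ} {H : ℕ} (hH : 0 < H)
    {bcast : Fin n → ℝ} {dur : Fin n → ℕ → ℝ} {order : ℕ → Fin n} (hb : ∀ i, bcast i ≤ κ)
    (hd : ∀ i k, dur i k ≤ hdot i * H) (ho : IsArrivalOrder bcast dur order) {B : ℕ} (hB : 0 < B)
    (m : Fin n) : arrivalTime bcast dur order (B - 1)
      ≤ κ + H * (harmonicMean hdot m * (B / ((m : ℝ) + 1) + 1)) := by
  set t := arrivalTime bcast dur order (B - 1)
  have hH' : (0 : ℝ) < H := by exact_mod_cast hH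
  have h1 : ∀ i, (t - κ) / H * (1 / hdot i) ≤ delivered order (B - 1) i + 1 := fun i => by
    have h2 : t ≤ κ + (delivered order (B - 1) i + 1 : ℕ) * (hdot i * H) := by
      refine (ho (B - 1) i).trans (add_le_add (hb i) ?_)
      refine (Finset.sum_le_card_nsmul _ _ _ fun l _ => hd i l).trans_eq ?_
      rw [Finset.card_range, nsmul_eq_mul]
    rw [div_mul_div_comm, mul_one, div_le_iff₀ (mul_pos hH' (hpos i))]
    push_cast at h2
    linarith
  have h3 := Finset.sum_le_sum fun i (_ : i ∈ Finset.Iic m) => h1 i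
  rw [← Finset.mul_sum, Finset.sum_add_distrib, Finset.sum_const, Fin.card_Iic, nsmul_eq_mul,
    mul_one] at h3
  have h4 : ∑ i ∈ Finset.Iic m, (delivered order (B - 1) i : ℝ) ≤ B := by
    exact_mod_cast (sum_delivered_le order (B - 1) _).trans (Nat.sub_le _ _)
  have hS : 0 < ∑ i ∈ Finset.Iic m, 1 / hdot i :=
    Finset.sum_pos (fun i _ => one_div_pos.2 (hpos i)) ⟨m, Finset.mem_Iic.2 le_rfl⟩
  have hm : (0 : ℝ) < (m : ℝ) + 1 := by positivity
  have e : (H : ℝ) * (harmonicMean hdot m * (B / ((m : ℝ) + 1) + 1))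
      = H * (B + ((m : ℝ) + 1)) / ∑ i ∈ Finset.Iic m, 1 / hdot i := by
    rw [harmonicMean]; field_simp
  rw [e, ← sub_le_iff_le_add', le_div_iff₀ hS]
  push_cast at h3
  have h5 : (t - κ) / H * ∑ i ∈ Finset.Iic m, 1 / hdot i ≤ B + ((m : ℝ) + 1) := by linarith
  rw [div_mul_eq_mul_div, div_le_iff₀ hH'] at h5
  linarith

end ArrivalTime

namespace Execution

variable {S A Ω : Type*} [MeasurableSpace S] [MeasurableSpace A] [MeasurableSpace Ω]
  {μ : Measure Ω} {d : ℕ} {mdp : MDP S A} {pol : Policy S A d} {n : ℕ} {hdot : Fin n → ℝ} {κ : ℝ}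
  {θ₀ : Param d} {η α : ℝ} {Minit M H : ℕ}

/-- The time of `K` aggregation calls. -/
lemma clock_le (X : Execution μ mdp pol hdot κ θ₀ η α Minit M H) (hpos : ∀ i, 0 < hdot i)
    (hH : 0 < H) (hinit : 0 < Minit) (hM : 0 < M) (m : Fin n) (K : ℕ) (ω : Ω) :
    X.clock K ω ≤ K * (2 * κ + H * (harmonicMean hdot m * (M / ((m : ℝ) + 1) + 1)))
      + H * (harmonicMean hdot m * (Minit / ((m : ℝ) + 1))) := by
  have hhm := (harmonicMean_pos hpos m).le
  have hcall : ∀ t, X.callTime t ω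
      ≤ 2 * κ + H * (harmonicMean hdot m * ((if t = 0 then Minit else M : ℕ) / ((m : ℝ) + 1) + 1)) :=
    fun t => by
      have := arrivalTime_le hpos hH (fun i => (X.bcast_mem t i ω).2)
        (fun i k => (X.dur_mem t i k ω).2) (X.isArrivalOrder t ω)
        (B := if t = 0 then Minit else M) (by split_ifs <;> assumption) m
      rw [callTime]
      linarith [(X.aggr_mem t ω).2]
  have hnn : 0 ≤ H * (harmonicMean hdot m * (Minit / ((m : ℝ) + 1))) := by positivity
  cases K with
  | zero => simpa [clock] using hnn
  | succ K =>
    -- Call `0` is split off because it alone has batch size `Minit`.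
    rw [clock, Finset.sum_range_succ']
    have h1 := Finset.sum_le_card_nsmul (Finset.range K) (fun t => X.callTime (t + 1) ω) _
      fun t _ => by
        have := hcall (t + 1)
        rw [if_neg (Nat.succ_ne_zero t)] at this
        exact this
    have h2 := hcall 0
    rw [if_pos rfl] at h2
    rw [Finset.card_range, nsmul_eq_mul] at h1
    have h3 : (0 : ℝ) ≤ H * (harmonicMean hdot m * (M / ((m : ℝ) + 1))) := by positivity
    push_cast
    linarith

end Execution

/-! ### The choice of batch size, momentum and step size -/

section Parameters

variable {s L ℓ Δ ε : ℝ}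

lemma rpow_seven_halves (hε : 0 < ε) : ε ^ (7 / 2 : ℝ) = ε ^ 2 * ε ^ (3 / 2 : ℝ) := by
  rw [← Real.rpow_natCast ε 2, ← Real.rpow_add hε]; norm_num

lemma rpow_three_halves (hε : 0 < ε) : ε ^ (3 / 2 : ℝ) = ε * √ε := by
  rw [Real.sqrt_eq_rpow, ← Real.rpow_one_add' hε.le (by norm_num)]; norm_num

lemma noiseRate_eq (hε : 0 < ε) :
    noiseRate s ℓ Δ ε = s / ε ^ 2 * (1 + √ℓ * Δ / ε ^ (3 / 2 : ℝ)) := by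
  have : 0 < ε ^ (3 / 2 : ℝ) := Real.rpow_pos_of_pos hε _
  rw [noiseRate, rpow_seven_halves hε]; field_simp

lemma iterRate_pos (hL : 0 < L) (hΔ : 0 < Δ) (hε : 0 < ε) : 0 < iterRate L ℓ Δ ε := by
  have : 0 < ε ^ (3 / 2 : ℝ) := Real.rpow_pos_of_pos hε _
  rw [iterRate]; positivity

lemma initBatch_pos : 0 < initBatch s ε := by
  rw [initBatch]; exact lt_max_of_lt_right one_pos

lemma batch_pos : 0 < batch s L ℓ Δ ε := by
  rw [batch]; exact lt_max_of_lt_right one_pos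

lemma natCast_max_ceil_le {x : ℝ} (hx : 0 ≤ x) : ((max ⌈x⌉₊ 1 : ℕ) : ℝ) ≤ x + 1 := by
  push_cast
  exact max_le (Nat.ceil_lt_add_one hx).le (by linarith)

lemma le_natCast_max_ceil (x : ℝ) : x ≤ ((max ⌈x⌉₊ 1 : ℕ) : ℝ) := by
  push_cast
  exact (Nat.le_ceil x).trans (le_max_left _ _)

lemma div_initBatch_le (hε : 0 < ε) : s / initBatch s ε ≤ ε ^ 2 := by
  have h1 : (0 : ℝ) < initBatch s ε := by exact_mod_cast initBatch_pos
  have h2 : s / ε ^ 2 ≤ initBatch s ε := le_natCast_max_ceil _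
  rw [div_le_iff₀ (by positivity)] at h2
  rw [div_le_iff₀ h1]
  linarith

variable {M : ℕ}

lemma momentum_pos (hs : 0 < s) (hε : 0 < ε) (hM : 0 < M) : 0 < momentum s ε M := by
  have : (0 : ℝ) < M := by exact_mod_cast hM
  rw [momentum]
  exact lt_min (by positivity) (by norm_num)

lemma momentum_le_half : momentum s ε M ≤ 1 / 2 := min_le_right _ _

lemma momentum_mul_le (hs : 0 < s) (hM : 0 < M) : momentum s ε M * (s / M) ≤ (ε / 8) ^ 2 := by
  have hM' : (0 : ℝ) < M := by exact_mod_cast hM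
  have h1 : momentum s ε M ≤ M * ε ^ 2 / (64 * s) := min_le_left _ _
  refine (mul_le_mul_of_nonneg_right h1 (by positivity)).trans_eq ?_
  field_simp; norm_num

lemma inv_momentum_le (hs : 0 < s) (hε : 0 < ε) (hM : 0 < M) :
    1 / momentum s ε M ≤ 2 + 64 * (s / ε ^ 2 / M) := by
  have hM' : (0 : ℝ) < M := by exact_mod_cast hM
  have h1 : 0 ≤ 64 * (s / ε ^ 2 / M) := by positivity
  rw [momentum]
  rcases min_choice (M * ε ^ 2 / (64 * s)) (1 / 2 : ℝ) with h | h
  · rw [h]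
    have : 1 / (M * ε ^ 2 / (64 * s)) = 64 * (s / ε ^ 2 / M) := by field_simp
    linarith
  · rw [h]
    norm_num
    linarith

variable {η : ℝ}

lemma stepSize_pos (hL : 0 < L) (hℓ : 0 < ℓ) (hε : 0 < ε) (hη : 0 < η) :
    0 < stepSize L ℓ ε η := by
  have := Real.sqrt_pos.2 hℓ
  have := Real.sqrt_pos.2 hε
  rw [stepSize]
  exact lt_min (by positivity) (by positivity)

lemma mul_stepSize_le (hL : 0 < L) : L * stepSize L ℓ ε η ≤ ε / 8 := by
  have h1 : stepSize L ℓ ε η ≤ ε / (8 * L) := min_le_left _ _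
  refine (mul_le_mul_of_nonneg_left h1 hL.le).trans_eq ?_
  field_simp

lemma mul_stepSize_sq_div_le (hL : 0 < L) (hℓ : 0 < ℓ) (hε : 0 < ε) (hη : 0 < η) :
    ℓ * stepSize L ℓ ε η ^ 2 / η ^ 2 ≤ ε / 16 := by
  have h1 : stepSize L ℓ ε η ≤ η * √ε / (4 * √ℓ) := min_le_right _ _
  have h2 := pow_le_pow_left₀ (stepSize_pos hL hℓ hε hη).le h1 2
  rw [div_pow, mul_pow, mul_pow, Real.sq_sqrt hε.le, Real.sq_sqrt hℓ.le] at h2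
  rw [div_le_iff₀ (by positivity)]
  refine (mul_le_mul_of_nonneg_left h2 hℓ.le).trans_eq ?_
  field_simp; norm_num

/-- The reciprocal of a minimum is at most the sum of the reciprocals. One factor `ε` is taken out
so that the rates of the theorem appear. -/
lemma div_stepSize_le (hL : 0 < L) (hℓ : 0 < ℓ) (hΔ : 0 < Δ) (hε : 0 < ε) (hη : 0 < η) :
    Δ / stepSize L ℓ ε η
      ≤ ε * (8 * (L * Δ / ε ^ 2) + 4 * (√ℓ * Δ / ε ^ (3 / 2 : ℝ)) * (1 / η)) := by
  have h1 := Real.sqrt_pos.2 hℓ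
  have h2 := Real.sqrt_pos.2 hε
  have e3 : √ε ^ 2 = ε := Real.sq_sqrt hε.le
  rw [rpow_three_halves hε, stepSize]
  have h4 : 0 ≤ ε * (8 * (L * Δ / ε ^ 2)) := by positivity
  have h5 : 0 ≤ ε * (4 * (√ℓ * Δ / (ε * √ε)) * (1 / η)) := by positivity
  rcases min_choice (ε / (8 * L)) (η * √ε / (4 * √ℓ)) with h | h
  · rw [h]
    have : Δ / (ε / (8 * L)) = ε * (8 * (L * Δ / ε ^ 2)) := by field_simp
    linarith
  · rw [h]
    have : Δ / (η * √ε / (4 * √ℓ)) = ε * (4 * (√ℓ * Δ / (ε * √ε)) * (1 / η)) := by field_simp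
    linarith

/-- The number of iterations that the method needs. -/
lemma iterations_le (hs : 0 < s) (hL : 0 < L) (hℓ : 0 < ℓ) (hΔ : 0 < Δ) (hε : 0 < ε) :
    Δ / stepSize L ℓ ε (momentum s ε (batch s L ℓ Δ ε))
        + 2 * ε / momentum s ε (batch s L ℓ Δ ε)
      ≤ ε * (264 * iterRate L ℓ Δ ε + 4) := by
  have hM : 0 < batch s L ℓ Δ ε := batch_pos
  have hM' : (0 : ℝ) < batch s L ℓ Δ ε := by exact_mod_cast hM
  have hη := momentum_pos hs hε hM
  have h1 := div_stepSize_le hL hℓ hΔ hε hη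
  have h2 := inv_momentum_le hs hε hM
  have h3 : noiseRate s ℓ Δ ε / iterRate L ℓ Δ ε ≤ batch s L ℓ Δ ε := le_natCast_max_ceil _
  have hR := iterRate_pos (ℓ := ℓ) hL hΔ hε
  rw [div_le_iff₀ hR, noiseRate_eq hε] at h3
  have hp : 0 < √ℓ * Δ / ε ^ (3 / 2 : ℝ) := by
    have := Real.rpow_pos_of_pos hε (3 / 2)
    have := Real.sqrt_pos.2 hℓ
    positivity
  have hRe : iterRate L ℓ Δ ε = L * Δ / ε ^ 2 + √ℓ * Δ / ε ^ (3 / 2 : ℝ) := rfl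
  generalize iterRate L ℓ Δ ε = R at *
  generalize √ℓ * Δ / ε ^ (3 / 2 : ℝ) = p at *
  generalize L * Δ / ε ^ 2 = q at *
  generalize momentum s ε (batch s L ℓ Δ ε) = η at *
  generalize ((batch s L ℓ Δ ε : ℕ) : ℝ) = m at *
  -- The defining property of the batch size. The term `64 s / (ε² m)` of `1 / η`, multiplied by `4
  -- p + 2 ≤ 4 (1 + p)`, thus costs at most `256 R`; with `8 q + 8 p = 8 R` this makes `264 R + 4`.
  have h4 : s / ε ^ 2 / m * (1 + p) ≤ R := by
    rw [div_mul_eq_mul_div, div_le_iff₀ hM']; linarith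
  have h5 : 0 ≤ s / ε ^ 2 / m := by positivity
  have h6 : (4 * p + 2) * (1 / η) ≤ (4 * p + 2) * (2 + 64 * (s / ε ^ 2 / m)) := by gcongr
  have h7 : Δ / stepSize L ℓ ε η + 2 * ε / η ≤ ε * (8 * q + (4 * p + 2) * (1 / η)) := by
    have : 2 * ε / η = ε * (2 * (1 / η)) := by field_simp
    rw [this]; linarith
  refine h7.trans (mul_le_mul_of_nonneg_left ?_ hε.le)
  nlinarith

end Parameters

/-! ### Existence and size of the horizon -/

section Horizon

variable {S A : Type*} [MeasurableSpace S] [MeasurableSpace A] {d : ℕ} {pol : Policy S A d}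
  {Mg Mh ε η α : ℝ}

/-- The right-hand side of the equation for the horizon. -/
noncomputable def horizonMap (mdp : MDP S A) (Mg Mh ε η α : ℝ) (H : ℕ) : ℕ :=
  max ⌈Real.logb mdp.γ (ε * η / (64 * max (Dg mdp Mg H) (α * Dh mdp Mg Mh H)))⌉₊ 1

/-- The least `k` with `φ k ≤ k` is fixed: otherwise `φ k` would be a smaller one, by monotonicity.
-/
lemma exists_fixedPoint_of_monotone {φ : ℕ → ℕ} (hφ : Monotone φ) (h : ∃ k, φ k ≤ k) :
    ∃ k, k = φ k := by
  classical
  refine ⟨Nat.find h, le_antisymm ?_ (Nat.find_spec h)⟩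
  by_contra hlt
  exact Nat.find_min h (not_le.1 hlt) (hφ (Nat.find_spec h))

lemma BoundedScore.Dg_pos (h : BoundedScore pol Mg Mh) (mdp : MDP S A) (H : ℕ) :
    0 < Dg mdp Mg H := by
  have := h.Mg_pos
  have := mdp.rmax_pos
  have := sub_pos.2 mdp.γ_lt_one
  rw [Dg]
  have : 0 < √(1 / (1 - mdp.γ) + H) := Real.sqrt_pos.2 (by positivity)
  positivity

/-- With `Dh_eq`, this isolates the dependence on `x = (1 - γ) H`: the constants grow at most
linearly in `1 + x`. -/
lemma BoundedScore.Dg_eq (h : BoundedScore pol Mg Mh) (mdp : MDP S A) (H : ℕ) :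
    Dg mdp Mg H = √(sigmaSq mdp Mg) * √(1 + (1 - mdp.γ) * H) := by
  have h1 := h.Mg_pos
  have h2 := mdp.rmax_pos
  have h3 := sub_pos.2 mdp.γ_lt_one
  have e1 : 1 / (1 - mdp.γ) + H = (1 + (1 - mdp.γ) * H) / (1 - mdp.γ) := by field_simp
  have e2 : sigmaSq mdp Mg = (Mg * mdp.rmax / (1 - mdp.γ)) ^ 2 / (1 - mdp.γ) := by
    rw [sigmaSq]; field_simp
  rw [Dg, e1, e2, Real.sqrt_div (by positivity), Real.sqrt_div (by positivity),
    Real.sqrt_sq (by positivity)]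
  ring

lemma Dh_eq (mdp : MDP S A) (H : ℕ) :
    Dh mdp Mg Mh H = Lg mdp Mg Mh * (1 + (1 - mdp.γ) * H) := by
  have h3 := sub_pos.2 mdp.γ_lt_one
  rw [Dh, Lg]; field_simp; ring

lemma BoundedScore.horizonMap_mono (h : BoundedScore pol Mg Mh) (mdp : MDP S A) (hε : 0 < ε)
    (hη : 0 < η) (hα : 0 ≤ α) : Monotone (horizonMap mdp Mg Mh ε η α) := by
  intro H H' hH
  have h3 := sub_pos.2 mdp.γ_lt_one
  have hH' : (H : ℝ) ≤ H' := by exact_mod_cast hH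
  have hg : Dg mdp Mg H ≤ Dg mdp Mg H' := by
    rw [h.Dg_eq, h.Dg_eq]; gcongr
  have hh : α * Dh mdp Mg Mh H ≤ α * Dh mdp Mg Mh H' := by
    rw [Dh_eq, Dh_eq]
    have := (h.Lg_pos mdp).le
    gcongr
  have hp : 0 < max (Dg mdp Mg H) (α * Dh mdp Mg Mh H) := lt_max_of_lt_left (h.Dg_pos mdp H)
  have hp' : 0 < max (Dg mdp Mg H') (α * Dh mdp Mg Mh H') := lt_max_of_lt_left (h.Dg_pos mdp H')
  refine max_le_max_right 1 (Nat.ceil_mono ?_)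
  rw [Real.logb, Real.logb, div_le_div_right_of_neg (Real.log_neg mdp.γ_pos mdp.γ_lt_one)]
  refine Real.log_le_log (by positivity) ?_
  gcongr

/-- The horizon makes `γ ^ H` at most `ε η / (64 D)` with `D ≥ D_g`, so the truncation bias is at
most `ε η / 64`. -/
lemma BoundedScore.Dg_mul_pow_le (h : BoundedScore pol Mg Mh) (mdp : MDP S A) (hε : 0 < ε)
    (hη : 0 < η) {H : ℕ} (hH : IsHorizon mdp Mg Mh ε η α H) :
    Dg mdp Mg H * mdp.γ ^ H ≤ ε * η / 64 := by
  have hD := h.Dg_pos mdp H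
  set D := max (Dg mdp Mg H) (α * Dh mdp Mg Mh H)
  have hDD : Dg mdp Mg H ≤ D := le_max_left _ _
  have hp : 0 < D := hD.trans_le hDD
  have h1 : Real.logb mdp.γ (ε * η / (64 * D)) ≤ H := by
    conv_rhs => rw [hH]
    exact le_natCast_max_ceil _
  have h2 := Real.rpow_le_rpow_of_exponent_ge mdp.γ_pos mdp.γ_lt_one.le h1
  rw [Real.rpow_logb mdp.γ_pos mdp.γ_lt_one.ne (by positivity), Real.rpow_natCast] at h2
  refine (mul_le_mul hDD h2 (pow_nonneg mdp.γ_pos.le _) hp.le).trans_eq ?_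
  field_simp

lemma one_le_log_exp_one_add {v : ℝ} (hv : 0 ≤ v) : 1 ≤ Real.log (Real.exp 1 + v) := by
  rw [Real.le_log_iff_exp_le (by positivity)]; linarith

/-- The right-hand side of the equation depends on `H` through `log (1 + x)` with `x = (1 - γ) H`,
which is at most `(1 + x) / 2`. The slope `1/2` gives both a point with `φ H ≤ H` and a bound on
every fixed point. -/
lemma BoundedScore.horizonMap_le (h : BoundedScore pol Mg Mh) (mdp : MDP S A) (hε : 0 < ε)
    (hη : 0 < η) (hη' : 1 / η ≤ 2 + 64 * (sigmaSq mdp Mg / ε ^ 2))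
    (hα' : Lg mdp Mg Mh * α ≤ ε / 8) (H : ℕ) :
    (1 - mdp.γ) * horizonMap mdp Mg Mh ε η α H
      ≤ 12 + 2 * Real.log (Real.exp 1 + sigmaSq mdp Mg / ε ^ 2) + (1 - mdp.γ) * H / 2 := by
  have hγ := sub_pos.2 mdp.γ_lt_one
  have hγ0 := mdp.γ_pos
  have hs := h.sigmaSq_pos mdp
  set v := sigmaSq mdp Mg / ε ^ 2 with hv
  have hv0 : 0 < v := by positivity
  set x := (1 - mdp.γ) * H with hx
  have hx0 : 0 ≤ x := by positivity
  set D := max (Dg mdp Mg H) (α * Dh mdp Mg Mh H) with hD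
  have hDpos : 0 < D := lt_max_of_lt_left (h.Dg_pos mdp H)
  have hlog := one_le_log_exp_one_add hv0.le
  have hDle : D ≤ ε * ((1 + v) * (1 + x)) := by
    refine max_le ?_ ?_
    · have e : √(sigmaSq mdp Mg) = ε * √v := by
        rw [hv, Real.sqrt_div hs.le, Real.sqrt_sq hε.le]; field_simp
      rw [h.Dg_eq, e, mul_assoc]
      have h1 : √v ≤ 1 + v := Real.sqrt_le_iff.2 ⟨by positivity, by nlinarith⟩
      have h2 : √(1 + x) ≤ 1 + x := Real.sqrt_le_iff.2 ⟨by positivity, by nlinarith⟩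
      gcongr
    · rw [Dh_eq, ← mul_assoc, mul_comm α, ← mul_assoc ε]
      refine mul_le_mul_of_nonneg_right (hα'.trans ?_) (by positivity)
      nlinarith
  -- `2 ^ 12 = 64 * 64`: one factor from the equation for `H`, the other from `1 / η ≤ 64 (1 + v)`.
  have hz : (ε * η / (64 * D))⁻¹ ≤ 2 ^ 12 * (Real.exp 1 + v) ^ 2 * (1 + x) := by
    have e : (ε * η / (64 * D))⁻¹ = 64 * (D / ε) * (1 / η) := by field_simp
    rw [e]
    have h1 : D / ε ≤ (1 + v) * (1 + x) := by rw [div_le_iff₀ hε]; linarith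
    have h2 : 1 / η ≤ 64 * (1 + v) := by linarith
    have h3 : 1 + v ≤ Real.exp 1 + v := by linarith [Real.add_one_le_exp (1 : ℝ)]
    calc 64 * (D / ε) * (1 / η) ≤ 64 * ((1 + v) * (1 + x)) * (64 * (1 + v)) := by gcongr
      _ = 2 ^ 12 * (1 + v) ^ 2 * (1 + x) := by ring
      _ ≤ 2 ^ 12 * (Real.exp 1 + v) ^ 2 * (1 + x) := by gcongr
  have hlogz : -Real.log (ε * η / (64 * D))
      ≤ 9 + 2 * Real.log (Real.exp 1 + v) + (1 + x) / 2 := by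
    rw [← Real.log_inv]
    refine (Real.log_le_log (by positivity) hz).trans ?_
    rw [Real.log_mul (by positivity) (by positivity), Real.log_mul (by positivity) (by positivity),
      Real.log_pow, Real.log_pow]
    have h1 := Real.log_two_lt_d9
    have h2 : Real.log (1 + x) ≤ (1 + x) / 2 := by
      have h3 := Real.log_le_sub_one_of_pos (x := (1 + x) / 2) (by positivity)
      rw [Real.log_div (by positivity) two_ne_zero] at h3
      linarith
    push_cast
    linarith
  -- Turns the logarithm to base `γ` into the factor `1 / (1 - γ)` of the theorem.
  have hlogγ : 1 - mdp.γ ≤ -Real.log mdp.γ := by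
    linarith [Real.log_le_sub_one_of_pos hγ0]
  have hbound : 0 ≤ 9 + 2 * Real.log (Real.exp 1 + v) + (1 + x) / 2 := by positivity
  have hlogb : (1 - mdp.γ) * Real.logb mdp.γ (ε * η / (64 * D))
      ≤ 9 + 2 * Real.log (Real.exp 1 + v) + (1 + x) / 2 := by
    rw [Real.logb, ← neg_div_neg_eq, mul_div_assoc', div_le_iff₀ (hγ.trans_le hlogγ)]
    calc (1 - mdp.γ) * -Real.log (ε * η / (64 * D))
        ≤ (1 - mdp.γ) * (9 + 2 * Real.log (Real.exp 1 + v) + (1 + x) / 2) := by gcongr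
      _ ≤ -Real.log mdp.γ * (9 + 2 * Real.log (Real.exp 1 + v) + (1 + x) / 2) := by gcongr
      _ = _ := by ring
  have hmain : (horizonMap mdp Mg Mh ε η α H : ℝ)
      ≤ max (Real.logb mdp.γ (ε * η / (64 * D))) 0 + 1 := by
    rw [horizonMap]
    push_cast
    refine max_le ?_ (by linarith [le_max_right (Real.logb mdp.γ (ε * η / (64 * D))) 0])
    refine (Nat.cast_le.2 (Nat.ceil_mono (le_max_left _ (0 : ℝ)))).trans ?_
    exact (Nat.ceil_lt_add_one (le_max_right _ _)).le
  refine (mul_le_mul_of_nonneg_left hmain hγ.le).trans ?_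
  have h4 : (1 - mdp.γ) * max (Real.logb mdp.γ (ε * η / (64 * D))) 0
      ≤ 9 + 2 * Real.log (Real.exp 1 + v) + (1 + x) / 2 := by
    rw [mul_max_of_nonneg _ _ hγ.le, mul_zero]
    exact max_le hlogb hbound
  linarith

lemma BoundedScore.exists_isHorizon (h : BoundedScore pol Mg Mh) (mdp : MDP S A) (hε : 0 < ε)
    (hη : 0 < η) (hα : 0 ≤ α) (hη' : 1 / η ≤ 2 + 64 * (sigmaSq mdp Mg / ε ^ 2))
    (hα' : Lg mdp Mg Mh * α ≤ ε / 8) : ∃ H, IsHorizon mdp Mg Mh ε η α H := by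
  refine exists_fixedPoint_of_monotone (φ := horizonMap mdp Mg Mh ε η α)
    (h.horizonMap_mono mdp hε hη hα) ?_
  have hγ := sub_pos.2 mdp.γ_lt_one
  obtain ⟨H, hH⟩ := exists_nat_ge
    (2 * (12 + 2 * Real.log (Real.exp 1 + sigmaSq mdp Mg / ε ^ 2)) / (1 - mdp.γ))
  refine ⟨H, ?_⟩
  have h1 := h.horizonMap_le mdp hε hη hη' hα' H
  rw [div_le_iff₀ hγ] at hH
  have h2 : (1 - mdp.γ) * horizonMap mdp Mg Mh ε η α H ≤ (1 - mdp.γ) * H := by linarith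
  exact_mod_cast le_of_mul_le_mul_left h2 hγ

lemma BoundedScore.horizon_le (h : BoundedScore pol Mg Mh) (mdp : MDP S A) (hε : 0 < ε)
    (hη : 0 < η) (hη' : 1 / η ≤ 2 + 64 * (sigmaSq mdp Mg / ε ^ 2))
    (hα' : Lg mdp Mg Mh * α ≤ ε / 8) {H : ℕ} (hH : IsHorizon mdp Mg Mh ε η α H) :
    H ≤ 28 * Real.log (Real.exp 1 + sigmaSq mdp Mg / ε ^ 2) * (1 / (1 - mdp.γ)) := by
  have hγ := sub_pos.2 mdp.γ_lt_one
  have h1 := h.horizonMap_le mdp hε hη hη' hα' H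
  rw [horizonMap, ← hH] at h1
  -- From `x ≤ 12 + 2 log + x / 2` follows `x ≤ 24 + 4 log`, and the logarithm is at least `1`.
  have h2 := one_le_log_exp_one_add (v := sigmaSq mdp Mg / ε ^ 2)
    (div_nonneg (h.sigmaSq_pos mdp).le (sq_nonneg _))
  rw [mul_one_div, le_div_iff₀ hγ]
  linarith

end Horizon

/-! ### Assembling the time bound -/

/-- A bound valid for every number of agents passes to the infimum; `n ≥ 1` keeps the index set
nonempty. -/
lemma le_timeComplexity {n : ℕ} (hn : 1 ≤ n) {hdot : Fin n → ℝ} {κ γ s L ℓ Δ ε a c t : ℝ}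
    (hc : 0 ≤ c) (hγ : 0 < 1 - γ)
    (h : ∀ m : Fin n, t ≤ a * (κ * iterRate L ℓ Δ ε) + c * (1 / (1 - γ) * (harmonicMean hdot m *
      (L * Δ / ε ^ 2 + √ℓ * Δ / ε ^ (3 / 2 : ℝ) + s / (((m : ℝ) + 1) * ε ^ 2)
        + s * √ℓ * Δ / (((m : ℝ) + 1) * ε ^ (7 / 2 : ℝ))))))
    (hac : a * (κ * iterRate L ℓ Δ ε) ≤ c * (κ * iterRate L ℓ Δ ε)) :
    t ≤ c * timeComplexity hdot κ γ s L ℓ Δ ε := by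
  have : Nonempty (Fin n) := ⟨⟨0, hn⟩⟩
  have h1 : t - a * (κ * iterRate L ℓ Δ ε) ≤ c * (1 / (1 - γ) * ⨅ m : Fin n, harmonicMean hdot m *
      (L * Δ / ε ^ 2 + √ℓ * Δ / ε ^ (3 / 2 : ℝ) + s / (((m : ℝ) + 1) * ε ^ 2)
        + s * √ℓ * Δ / (((m : ℝ) + 1) * ε ^ (7 / 2 : ℝ)))) := by
    rw [Real.mul_iInf_of_nonneg (by positivity), Real.mul_iInf_of_nonneg hc]
    exact le_ciInf fun m => by linarith [h m]
  have h2 : iterRate L ℓ Δ ε = L * Δ / ε ^ 2 + √ℓ * Δ / ε ^ (3 / 2 : ℝ) := rfl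
  rw [h2] at h1 hac
  rw [timeComplexity, mul_add]
  linarith

lemma timeComplexity_nonneg {n : ℕ} {hdot : Fin n → ℝ} (hpos : ∀ i, 0 < hdot i)
    {κ γ s L ℓ Δ ε : ℝ} (hκ : 0 ≤ κ) (hγ : 0 < 1 - γ) (hs : 0 < s) (hL : 0 < L) (hΔ : 0 < Δ)
    (hε : 0 < ε) : 0 ≤ timeComplexity hdot κ γ s L ℓ Δ ε := by
  have h1 : 0 ≤ ⨅ m : Fin n, harmonicMean hdot m *
      (L * Δ / ε ^ 2 + √ℓ * Δ / ε ^ (3 / 2 : ℝ) + s / (((m : ℝ) + 1) * ε ^ 2)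
        + s * √ℓ * Δ / (((m : ℝ) + 1) * ε ^ (7 / 2 : ℝ))) := Real.iInf_nonneg fun m => by
    have := (harmonicMean_pos hpos m).le
    positivity
  rw [timeComplexity]
  positivity

section Rates

variable {s L ℓ Δ ε : ℝ}

/-- The number of gradients collected in `K` calls, per agent. -/
lemma mul_batch_le (hs : 0 < s) (hL : 0 < L) (hΔ : 0 < Δ) (hε : 0 < ε) {K m : ℝ}
    (hm : 1 ≤ m) (hK : K ≤ 1120 * iterRate L ℓ Δ ε)
    (hR : 1 ≤ 4 * iterRate L ℓ Δ ε) :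
    K * (batch s L ℓ Δ ε / m + 1) + initBatch s ε / m
      ≤ 2244 * (L * Δ / ε ^ 2 + √ℓ * Δ / ε ^ (3 / 2 : ℝ) + s / (m * ε ^ 2)
        + s * √ℓ * Δ / (m * ε ^ (7 / 2 : ℝ))) := by
  have hm0 : 0 < m := by linarith
  have hRpos := iterRate_pos (ℓ := ℓ) hL hΔ hε
  have h32 : 0 < ε ^ (7 / 2 : ℝ) := Real.rpow_pos_of_pos hε _
  have hnn : 0 ≤ noiseRate s ℓ Δ ε := by rw [noiseRate]; positivity
  have h1 : (batch s L ℓ Δ ε : ℝ) ≤ noiseRate s ℓ Δ ε / iterRate L ℓ Δ ε + 1 :=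
    natCast_max_ceil_le (by positivity)
  have h2 : (initBatch s ε : ℝ) ≤ s / ε ^ 2 + 1 := natCast_max_ceil_le (by positivity)
  have h3 : K * batch s L ℓ Δ ε ≤ 1120 * (noiseRate s ℓ Δ ε + iterRate L ℓ Δ ε) := by
    calc K * batch s L ℓ Δ ε
        ≤ 1120 * iterRate L ℓ Δ ε * (noiseRate s ℓ Δ ε / iterRate L ℓ Δ ε + 1) := by gcongr
      _ = 1120 * (noiseRate s ℓ Δ ε + iterRate L ℓ Δ ε) := by field_simp
  have h4 : s / ε ^ 2 ≤ noiseRate s ℓ Δ ε := by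
    rw [noiseRate]; exact le_add_of_nonneg_right (by positivity)
  have e1 : L * Δ / ε ^ 2 + √ℓ * Δ / ε ^ (3 / 2 : ℝ) + s / (m * ε ^ 2)
      + s * √ℓ * Δ / (m * ε ^ (7 / 2 : ℝ)) = iterRate L ℓ Δ ε + noiseRate s ℓ Δ ε / m := by
    rw [iterRate, noiseRate]; field_simp; ring
  have e2 : K * (batch s L ℓ Δ ε / m + 1) + initBatch s ε / m
      = (K * batch s L ℓ Δ ε + initBatch s ε) / m + K := by field_simp; ring
  rw [e1, e2]
  have h5 : (K * batch s L ℓ Δ ε + initBatch s ε) / m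
      ≤ (1121 * noiseRate s ℓ Δ ε + 1124 * iterRate L ℓ Δ ε) / m := by
    refine div_le_div_of_nonneg_right ?_ hm0.le
    linarith
  -- `1124 = 1120 + 4`: the rounding of the initial batch costs `1 ≤ 4 R`. The `K` unfinished
  -- gradients per agent add another `1120 R`.
  have h6 : iterRate L ℓ Δ ε / m ≤ iterRate L ℓ Δ ε := div_le_self hRpos.le hm
  have h7 : 0 ≤ noiseRate s ℓ Δ ε / m := by positivity
  have e3 : (1121 * noiseRate s ℓ Δ ε + 1124 * iterRate L ℓ Δ ε) / m
      = 1121 * (noiseRate s ℓ Δ ε / m) + 1124 * (iterRate L ℓ Δ ε / m) := by ring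
  linarith

end Rates

namespace Execution

variable {S A Ω : Type*} [MeasurableSpace S] [MeasurableSpace A] [MeasurableSpace Ω]
  {μ : Measure Ω} {d : ℕ} {mdp : MDP S A} {pol : Policy S A d} {n : ℕ} {hdot : Fin n → ℝ} {κ : ℝ}
  {θ₀ : Param d} {η α : ℝ} {H : ℕ} {s L ℓ Δ ε : ℝ}

/-- The horizon supplies the factor `28 log / (1 - γ)`, the gradients per agent the factor `2244`,
and `28 * 2244 ≤ 70000`. Communication costs `2 κ` per call, hence `2240 = 2 * 1120`. -/
lemma clock_le_timeComplexity
    (X : Execution μ mdp pol hdot κ θ₀ η α (initBatch s ε) (batch s L ℓ Δ ε) H) (hn : 1 ≤ n)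
    (hpos : ∀ i, 0 < hdot i) (hκ : 0 ≤ κ) (hs : 0 < s) (hL : 0 < L) (hΔ : 0 < Δ) (hε : 0 < ε)
    (hH0 : 0 < H)
    (hH : H ≤ 28 * Real.log (Real.exp 1 + s / ε ^ 2) * (1 / (1 - mdp.γ))) {K : ℕ}
    (hK : K ≤ 1120 * iterRate L ℓ Δ ε) (hR : 1 ≤ 4 * iterRate L ℓ Δ ε) (ω : Ω) :
    X.clock K ω ≤ 70000 * Real.log (Real.exp 1 + s / ε ^ 2) *
      timeComplexity hdot κ mdp.γ s L ℓ Δ ε := by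
  have hγ := sub_pos.2 mdp.γ_lt_one
  have hlog := one_le_log_exp_one_add (v := s / ε ^ 2) (by positivity)
  have hRpos := iterRate_pos (ℓ := ℓ) hL hΔ hε
  refine le_timeComplexity hn (a := 2240) (by positivity) hγ (fun m => ?_) ?_
  · have h1 := X.clock_le hpos hH0 initBatch_pos batch_pos m K ω
    have hhm := (harmonicMean_pos hpos m).le
    have hm : (1 : ℝ) ≤ (m : ℝ) + 1 := by linarith [(Nat.cast_nonneg (m : ℕ) : (0 : ℝ) ≤ (m : ℕ))]
    have h2 := mul_batch_le hs hL hΔ hε hm hK hR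
    set Q := L * Δ / ε ^ 2 + √ℓ * Δ / ε ^ (3 / 2 : ℝ) + s / (((m : ℝ) + 1) * ε ^ 2)
        + s * √ℓ * Δ / (((m : ℝ) + 1) * ε ^ (7 / 2 : ℝ))
    have hQ : 0 ≤ Q := by positivity
    have h3 : X.clock K ω ≤ 2 * (K * κ) + H * (harmonicMean hdot m *
        (K * (batch s L ℓ Δ ε / ((m : ℝ) + 1) + 1) + initBatch s ε / ((m : ℝ) + 1))) := by
      linarith
    have h4 : 2 * (K * κ) ≤ 2240 * (κ * iterRate L ℓ Δ ε) := by
      have := mul_le_mul_of_nonneg_right hK hκ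
      linarith
    have h5 : H * (harmonicMean hdot m *
        (K * (batch s L ℓ Δ ε / ((m : ℝ) + 1) + 1) + initBatch s ε / ((m : ℝ) + 1)))
        ≤ 28 * Real.log (Real.exp 1 + s / ε ^ 2) * (1 / (1 - mdp.γ))
          * (harmonicMean hdot m * (2244 * Q)) := by gcongr
    have h6 : 0 ≤ Real.log (Real.exp 1 + s / ε ^ 2) *
        (1 / (1 - mdp.γ) * (harmonicMean hdot m * Q)) := by positivity
    linarith
  · exact mul_le_mul_of_nonneg_right (by linarith) (by positivity)

end Execution

end RennalaNIGT

/-! ### The main theorem -/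

theorem mainTheorem1 :
    ∃ C : ℝ, 0 < C ∧
      ∀ (S A : Type*) [MeasurableSpace S] [MeasurableSpace A] (d : ℕ)
        (mdp : RennalaNIGT.MDP S A) (pol : RennalaNIGT.Policy S A d) (Mg Mh l₂ : ℝ)
        (_ : RennalaNIGT.BoundedScore pol Mg Mh)
        (_ : RennalaNIGT.LipschitzScoreHessian pol l₂),
      -- the Hessian of `J` is Lipschitz with an explicit constant
      RennalaNIGT.HessianLipschitz (RennalaNIGT.J mdp pol)
          (RennalaNIGT.hessConst mdp Mg Mh l₂) ∧
      -- `Lh` is any Lipschitz constant of the Hessian of `J`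
      ∀ (Lh : ℝ) (_ : 0 < Lh) (_ : RennalaNIGT.HessianLipschitz (RennalaNIGT.J mdp pol) Lh)
        (ε Δ : ℝ) (_ : 0 < ε) (_ : 0 < Δ) (θ₀ : RennalaNIGT.Param d)
        (_ : (⨆ θ, RennalaNIGT.J mdp pol θ) - RennalaNIGT.J mdp pol θ₀ ≤ Δ),
      let Lg := RennalaNIGT.Lg mdp Mg Mh
      let σsq := RennalaNIGT.sigmaSq mdp Mg
      let Minit := RennalaNIGT.initBatch σsq ε
      let M := RennalaNIGT.batch σsq Lg Lh Δ ε
      let η := RennalaNIGT.momentum σsq ε M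
      let α := RennalaNIGT.stepSize Lg Lh ε η
      (∃ H : ℕ, RennalaNIGT.IsHorizon mdp Mg Mh ε η α H) ∧
      ∀ H : ℕ, RennalaNIGT.IsHorizon mdp Mg Mh ε η α H →
        ∃ T : ℕ, 1 ≤ T ∧
          ∀ (n : ℕ) (_ : 1 ≤ n) (hdot : Fin n → ℝ) (_ : ∀ i, 0 < hdot i) (_ : Monotone hdot)
            (κ : ℝ) (_ : 0 ≤ κ)
            (Ω : Type*) [MeasurableSpace Ω] (μ : MeasureTheory.Measure Ω)
            [MeasureTheory.IsProbabilityMeasure μ]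
            (X : RennalaNIGT.Execution μ mdp pol hdot κ θ₀ η α Minit M H),
          -- the output is an `ε`-stationary point
          (∀ t < T, MeasureTheory.Integrable
            (fun ω => ‖gradient (RennalaNIGT.J mdp pol) (X.θ t ω)‖) μ) ∧
          X.expGradNorm T ≤ ε ∧
          -- and the iterates it is sampled from are available within the claimed time
          ∀ ω, X.clock (T - 1) ω ≤
            C * Real.log (Real.exp 1 + σsq / ε ^ 2) *
              RennalaNIGT.timeComplexity hdot κ mdp.γ σsq Lg Lh Δ ε := by
  refine ⟨70000, by norm_num, ?_⟩
  intro S A _ _ d mdp pol Mg Mh l₂ h hl₂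
  refine ⟨h.hessianLipschitz_J hl₂ mdp, ?_⟩
  intro Lh hLh hl ε Δ hε hΔ θ₀ hsup Lg σsq Minit M η α
  have hL : 0 < Lg := h.Lg_pos mdp
  have hs : 0 < σsq := h.sigmaSq_pos mdp
  have hinit : 0 < Minit := RennalaNIGT.initBatch_pos
  have hM : 0 < M := RennalaNIGT.batch_pos
  have hM1 : (1 : ℝ) ≤ M := by exact_mod_cast hM
  have hη : 0 < η := RennalaNIGT.momentum_pos hs hε hM
  have hη2 : η ≤ 1 / 2 := RennalaNIGT.momentum_le_half
  have hα : 0 < α := RennalaNIGT.stepSize_pos hL hLh hε hη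
  have hLα : Lg * α ≤ ε / 8 := RennalaNIGT.mul_stepSize_le hL
  have hηinv : 1 / η ≤ 2 + 64 * (σsq / ε ^ 2) := by
    refine (RennalaNIGT.inv_momentum_le hs hε hM).trans ?_
    have := div_le_self (div_pos hs (pow_pos hε 2)).le hM1
    linarith
  refine ⟨h.exists_isHorizon mdp hε hη hα.le hηinv hLα, ?_⟩
  intro H hH
  have hH0 : 0 < H := by
    rw [hH]; exact lt_max_of_lt_right one_pos
  have hbound : ∀ θ, RennalaNIGT.J mdp pol θ ≤ RennalaNIGT.J mdp pol θ₀ + Δ := fun θ => by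
    linarith [le_ciSup (RennalaNIGT.bddAbove_J mdp pol) θ]
  have hR := RennalaNIGT.iterRate_pos (ℓ := Lh) hL hΔ hε
  have hγ := sub_pos.2 mdp.γ_lt_one
  -- In the first case `‖∇J(θ₀)‖² ≤ 4 L_g Δ ≤ ε²`, so `T = 1` works. The only iterate is `θ₀`,
  -- available at time zero; even one call could exceed the claimed time, as the rates may be
  -- arbitrarily small.
  by_cases hq : Lg * Δ / ε ^ 2 ≤ 1 / 4
  · refine ⟨1, le_rfl, fun n hn hdot hpos _ κ hκ Ω _ μ _ X => ⟨fun t _ =>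
      X.integrable_norm_gradient h t, ?_, fun ω => ?_⟩⟩
    · have h1 := h.norm_gradient_sq_le mdp hbound
      rw [div_le_iff₀ (by positivity)] at hq
      have h2 : ‖gradient (RennalaNIGT.J mdp pol) θ₀‖ ≤ ε :=
        le_of_sq_le_sq (h1.trans (by linarith)) hε.le
      simpa [RennalaNIGT.Execution.expGradNorm, X.θ_zero] using h2
    · have h1 := RennalaNIGT.one_le_log_exp_one_add (v := σsq / ε ^ 2) (by positivity)
      have h2 := RennalaNIGT.timeComplexity_nonneg (ℓ := Lh) hpos hκ hγ hs hL hΔ hε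
      simp only [RennalaNIGT.Execution.clock, Nat.sub_self, Finset.range_zero, Finset.sum_empty]
      positivity
  · have hq' : 1 ≤ 4 * RennalaNIGT.iterRate Lg Lh Δ ε := by
      have h1 : 0 ≤ √Lh * Δ / ε ^ (3 / 2 : ℝ) := by positivity
      rw [RennalaNIGT.iterRate]
      linarith
    set R := RennalaNIGT.iterRate Lg Lh Δ ε with hRdef
    -- `T` is four times the `264 R + 4` of `iterations_le`, so the transient terms average to at
    -- most `ε / 4`, next to the persistent `3 ε / 4`.
    have hT0 : 0 < ⌈1056 * R + 16⌉₊ := Nat.ceil_pos.2 (by positivity)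
    refine ⟨⌈1056 * R + 16⌉₊, hT0, fun n hn hdot hpos _ κ hκ Ω _ μ _ X => ⟨fun t _ =>
      X.integrable_norm_gradient h t, ?_, fun ω => ?_⟩⟩
    · have hb : ∀ θ, ‖RennalaNIGT.truncGrad mdp pol H θ - gradient (RennalaNIGT.J mdp pol) θ‖
          ≤ ε * η / 64 := fun θ =>
        (h.norm_truncGrad_sub_le mdp H θ).trans (h.Dg_mul_pow_le mdp hε hη hH)
      have h3 : ε * η / 64 + Lh * α ^ 2 / η ^ 2 ≤ ε / 8 := by
        have := RennalaNIGT.mul_stepSize_sq_div_le hL hLh hε hη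
        have : ε * η ≤ ε * (1 / 2) := mul_le_mul_of_nonneg_left hη2 hε.le
        linarith
      refine (X.expGradNorm_le h hLh.le hl hη (by linarith) hα hε.le hbound hinit hM
        (RennalaNIGT.div_initBatch_le hε) (RennalaNIGT.momentum_mul_le hs hM) hb h3 hLα
        hT0).trans ?_
      have h4 := RennalaNIGT.iterations_le hs hL hLh hΔ hε
      have h5 : (Δ / α + 2 * ε / η) / (⌈1056 * R + 16⌉₊ : ℝ) ≤ ε / 4 := by
        have h6 := Nat.le_ceil (1056 * R + 16)
        rw [div_le_iff₀ (by exact_mod_cast hT0)]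
        refine h4.trans ?_
        have := mul_le_mul_of_nonneg_left h6 (div_pos hε four_pos).le
        linarith
      linarith
    · refine X.clock_le_timeComplexity hn hpos hκ hs hL hΔ hε hH0
        (h.horizon_le mdp hε hη hηinv hLα hH) ?_ hq' ω
      -- The iterate `θ_{T-1}` needs `T - 1` calls, at most `1056 R + 16 ≤ 1120 R` since `1 ≤ 4 R`.
      have h6 := Nat.ceil_lt_add_one (a := 1056 * R + 16) (by positivity)
      rw [Nat.cast_sub hT0, Nat.cast_one]
      linarith
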